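/- There are a word-RAM program $P$ and a constant $c\in\mathbb{N}$ with the following property. Let $G$ be a connected graph with vertex set $\{0,\dots,n-1\}$, let $s\in V(G)$, let $Q_1,\dots,Q_p$ be a clique cover of $G$ (a partition of $V(G)$ into $p$ nonempty cliques), and let $\varepsilon>0$ be rational. Given $n$, $s$, $p$, the numerator and the denominator of $\varepsilon$ in lowest terms, the adjacency matrix of $G$ and the membership matrix of the cliques, the program $P$ outputs a broadcast protocol from $s$ with at most $(1+\varepsilon)\cdot b(G,s)$ rounds after at most $$c\cdot 3^{\,2^{2p/\varepsilon}\,p}\cdot n^{c}$$ steps (a running time of $3^{2^{2p/\varepsilon}p}\cdot n^{O(1)}$). In particular, the time is of the form $f(p,\varepsilon)\cdot n^{O(1)}$, so this is an FPT approximation scheme parameterized by the number $p$ of cliques of the given cover. Here $b(G,s)$ is the minimum number of rounds needed to inform all vertices when at first only $s$ is informed and, in each round, every informed vertex may send the message to at most one uninformed neighbour. A broadcast protocol with $t$ rounds is a spanning tree of $G$ rooted at $s$ together with a map $\tau$ from its edges to $\{1,\dots,t\}$ that is a proper edge colouring and such that, for each vertex $v\neq s$, the edge from $v$ to its parent has the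 minimum value of $\tau$ among the tree edges at $v$; it is output as the list of the parents and of the values $\tau(\{v,\mathrm{parent}(v)\})$. The word RAM has registers and arrays with words of at most $c\cdot(n+\ell)$ bits, where $\ell$ is the total bit length of the numerator and the denominator of $\varepsilon$; every addition, (truncated) subtraction, multiplication, integer division, memory access, assignment of a constant and test for zero takes one step, and no number computed overflows. -/

import Mathlib

/-! ### Broadcasting in the telephone model -/

namespace Telephone

variable {V : Type*}

/-- One round: `I` is the set of informed vertices before the round, `J` the one after it.
Every newly informed vertex `v` hears the message from a neighbour `f v` in `I`, and every vertex
of `I` sends the message to at most one vertex. -/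
def Round (G : SimpleGraph V) (I J : Set V) : Prop :=
  I ⊆ J ∧ ∃ f : V → V, Set.InjOn f (J \ I) ∧ ∀ v ∈ J \ I, f v ∈ I ∧ G.Adj (f v) v

/-- The message can be disseminated from `s` to all vertices in `t` rounds. -/
def CanBroadcast (G : SimpleGraph V) (s : V) (t : ℕ) : Prop :=
  ∃ I : ℕ → Set V, I 0 = {s} ∧ (∀ i < t, Round G (I i) (I (i + 1))) ∧ I t = Set.univ

/-- `b(G, s)`: the minimum number of rounds that inform all vertices (for connected finite `G`
the set is not empty). -/
noncomputable def broadcastTime (G : SimpleGraph V) (s : V) : ℕ :=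
  sInf {t | CanBroadcast G s t}

/-- `u` is the parent of `v` in the tree `T` rooted at `s`. -/
def IsParent (T : SimpleGraph V) (s u v : V) : Prop :=
  T.Adj u v ∧ T.dist s v = T.dist s u + 1

/-- A broadcast protocol with `t` rounds: a spanning tree rooted at `s` with time stamps in
`{1, …, t}` on its edges (values of `stamp` off the tree are irrelevant) that form a proper edge
colouring, such that the edge from a vertex `v ≠ s` to its parent has the minimum stamp among the
tree edges at `v`. -/
structure BroadcastProtocol (G : SimpleGraph V) (s : V) (t : ℕ) where
  tree : SimpleGraph V
  tree_le : tree ≤ G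
  isTree : tree.IsTree
  stamp : Sym2 V → ℕ
  stamp_mem : ∀ e ∈ tree.edgeSet, 1 ≤ stamp e ∧ stamp e ≤ t
  proper : ∀ e ∈ tree.edgeSet, ∀ f ∈ tree.edgeSet, e ≠ f → (∃ v, v ∈ e ∧ v ∈ f) →
    stamp e ≠ stamp f
  parent_min : ∀ u v w, IsParent tree s u v → tree.Adj v w → stamp s(u, v) ≤ stamp s(v, w)

/-- `Q` is a clique cover: a partition of the vertex set into `p` (nonempty) cliques. -/
structure IsCliqueCover (G : SimpleGraph V) {p : ℕ} (Q : Fin p → Set V) : Prop where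
  nonempty : ∀ i, (Q i).Nonempty
  isClique : ∀ i, G.IsClique (Q i)
  disjoint : Pairwise fun i j => Disjoint (Q i) (Q j)
  cover : ∀ v, ∃ i, v ∈ Q i

end Telephone

/-! ### A word RAM

The machine has registers and arrays, each cell holding a natural number below `2 ^ w`, where `w` is
the word length. Programs are structured; a program mentions finitely many registers and arrays.
Every elementary instruction and every evaluation of a branch or loop condition takes one step. -/

namespace WordRAM

structure Store where
  /-- contents of the registers -/
  reg : ℕ → ℕ
  /-- `arr i j` is the cell `j` of the array `i` -/
  arr : ℕ → ℕ → ℕ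

def Store.setReg (σ : Store) (r x : ℕ) : Store :=
  { σ with reg := Function.update σ.reg r x }

def Store.setArr (σ : Store) (i j x : ℕ) : Store :=
  { σ with arr := Function.update σ.arr i (Function.update (σ.arr i) j x) }

inductive Op where
  | add
  | sub
  | mul
  | div

/-- Subtraction is truncated at `0`, division rounds down, and division by `0` gives `0`. -/
def Op.eval : Op → ℕ → ℕ → ℕ
  | .add, x, y => x + y
  | .sub, x, y => x - y
  | .mul, x, y => x * y
  | .div, x, y => x / y

inductive Prog where
  /-- do nothing -/
  | skip
  /-- `reg d := k` -/
  | const (d k : ℕ)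
  /-- `reg d := reg x ∘ reg y` -/
  | op (o : Op) (d x y : ℕ)
  /-- `reg d := arr i (reg x)` -/
  | load (d i x : ℕ)
  /-- `arr i (reg x) := reg y` -/
  | store (i x y : ℕ)
  /-- sequential composition -/
  | seq (A B : Prog)
  /-- `A` if `reg x ≠ 0`, otherwise `B` -/
  | ite (x : ℕ) (A B : Prog)
  /-- repeat `A` as long as `reg x ≠ 0` -/
  | loop (x : ℕ) (A : Prog)

/-- `Exec w P σ τ T`: with word length `w`, the program `P` started in the store `σ` halts in the
store `τ` after exactly `T` steps. There is no such execution if a computed number does not fit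
into a word. -/
inductive Exec (w : ℕ) : Prog → Store → Store → ℕ → Prop where
  | skip (σ : Store) : Exec w .skip σ σ 1
  | const (σ : Store) (d k : ℕ) (h : k < 2 ^ w) :
      Exec w (.const d k) σ (σ.setReg d k) 1
  | op (σ : Store) (o : Op) (d x y : ℕ) (h : o.eval (σ.reg x) (σ.reg y) < 2 ^ w) :
      Exec w (.op o d x y) σ (σ.setReg d (o.eval (σ.reg x) (σ.reg y))) 1
  | load (σ : Store) (d i x : ℕ) :
      Exec w (.load d i x) σ (σ.setReg d (σ.arr i (σ.reg x))) 1
  | store (σ : Store) (i x y : ℕ) :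
      Exec w (.store i x y) σ (σ.setArr i (σ.reg x) (σ.reg y)) 1
  | seq {A B : Prog} {σ₁ σ₂ σ₃ : Store} {T₁ T₂ : ℕ} (hA : Exec w A σ₁ σ₂ T₁)
      (hB : Exec w B σ₂ σ₃ T₂) : Exec w (.seq A B) σ₁ σ₃ (T₁ + T₂)
  | ite_true {A B : Prog} {x : ℕ} {σ τ : Store} {T : ℕ} (h : σ.reg x ≠ 0)
      (hA : Exec w A σ τ T) : Exec w (.ite x A B) σ τ (T + 1)
  | ite_false {A B : Prog} {x : ℕ} {σ τ : Store} {T : ℕ} (h : σ.reg x = 0)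
      (hB : Exec w B σ τ T) : Exec w (.ite x A B) σ τ (T + 1)
  | loop_done {A : Prog} {x : ℕ} {σ : Store} (h : σ.reg x = 0) :
      Exec w (.loop x A) σ σ 1
  | loop_step {A : Prog} {x : ℕ} {σ₁ σ₂ σ₃ : Store} {T₁ T₂ : ℕ} (h : σ₁.reg x ≠ 0)
      (hA : Exec w A σ₁ σ₂ T₁) (hL : Exec w (.loop x A) σ₂ σ₃ T₂) :
      Exec w (.loop x A) σ₁ σ₃ (T₁ + T₂ + 1)

end WordRAM

namespace Telephone

open WordRAM

open Classical in
/-- The input. Registers `0, …, 4` hold `n`, the source, the number `p` of cliques, and the numerator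
and the denominator of `ε`. Array `0` is the adjacency matrix of `G` (row by row), array `1` the
`p × n` membership matrix of the cliques. Everything else is `0`. -/
noncomputable def inputStore {n p : ℕ} (G : SimpleGraph (Fin n)) (s : Fin n)
    (Q : Fin p → Set (Fin n)) (ε : ℚ) : Store where
  reg
    | 0 => n
    | 1 => s
    | 2 => p
    | 3 => ε.num.toNat
    | 4 => ε.den
    | _ => 0
  arr
    | 0 => fun x => if ∃ u v : Fin n, x = u * n + v ∧ G.Adj u v then 1 else 0
    | 1 => fun x => if ∃ (i : Fin p) (v : Fin n), x = i * n + v ∧ v ∈ Q i then 1 else 0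
    | _ => fun _ => 0

/-- The output: for every vertex `v ≠ s`, the cell `v` of array `2` holds the parent of `v`, and the
cell `v` of array `3` the time stamp of the edge from `v` to its parent. -/
def Outputs {n t : ℕ} {G : SimpleGraph (Fin n)} {s : Fin n} (σ : Store)
    (B : BroadcastProtocol G s t) : Prop :=
  ∀ u v : Fin n, IsParent B.tree s u v → σ.arr 2 v = u ∧ σ.arr 3 v = B.stamp s(u, v)

end Telephone

/-! ### A structured language compiled to the word RAM -/

namespace WordRAM

/-! Two algorithms are combined, and an integer test chooses between them. Let `L = Nat.clog 2 n`.
The informed set at most doubles in a round, so `L ≤ b(G,s)` (`CanBroadcast.card_le`).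

Approximation (`wp_approxProg`). By connectivity an edge leads from the cliques that already contain
an informed vertex to some other clique as long as there is one. Two rounds suffice to cross it: its
tail is first informed from within its clique, if necessary, and then informs the head. After
`2(p-1)` rounds every clique is covered, and then all cliques are filled in parallel by doubling in
`L` rounds (`Partial.done`). If `2(p-1) ≤ ε L`, the total `2(p-1) + L` is at most `(1+ε) L ≤ (1+ε)
b(G,s)`.

Exact solution (`wp_exactProg`). Otherwise `L < 2(p-1)/ε`, hence `n ≤ 2^(2p/ε)`, and `3^n` times a
polynomial is affordable. A word in `{0,1,2}^n` codes a possible round: `2` marks the vertices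
informed before it, `1` those informed in it. One pass over all words decides by recursion whether
the digits `1` can be matched into the digits `2`, and computes shortest paths from `{s}` in the
graph of informed sets. Every step goes from a number to a larger one, so the increasing order is a
topological order. Tracing a shortest path back yields parents and stamps, which form a protocol by
`exists_protocol`.

Running time and word length come from a small language with expressions, bounded loops and a
weakest precondition calculus, compiled to the RAM once and for all (`Expr.runs_compile`,
`Stmt.runs_compile`). Its costs are bounded statically: loops are short (at most `n` rounds) or long
(at most `K` rounds), and the program nests long loops to depth one, so the time is `O(K * n^c)`,
with `K = 3^n` or `K = 1`. -/

@[simp] lemma Store.setReg_reg (σ : Store) (r x q : ℕ) :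
    (σ.setReg r x).reg q = if q = r then x else σ.reg q := by
  simp [Store.setReg, Function.update_apply]

@[simp] lemma Store.setReg_arr (σ : Store) (r x : ℕ) : (σ.setReg r x).arr = σ.arr := rfl

@[simp] lemma Store.setArr_reg (σ : Store) (i j x : ℕ) : (σ.setArr i j x).reg = σ.reg := rfl

@[simp] lemma Store.setArr_arr (σ : Store) (i j x a : ℕ) :
    (σ.setArr i j x).arr a = if a = i then Function.update (σ.arr i) j x else σ.arr a := by
  by_cases h : a = i
  · subst h; simp [Store.setArr]
  · simp [Store.setArr, h]

/-- Expressions. `sum r e` and `sup r e` range over the values `0, …, reg 0 - 1` of the bound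
register `r`. -/
inductive Expr where
  | var (r : ℕ)
  | lit (k : ℕ)
  | bin (o : Op) (a b : Expr)
  | arr (i : ℕ) (e : Expr)
  | sum (r : ℕ) (e : Expr)
  | sup (r : ℕ) (e : Expr)

namespace Expr

def eval : Expr → Store → ℕ
  | var r, σ => σ.reg r
  | lit k, _ => k
  | bin o a b, σ => o.eval (a.eval σ) (b.eval σ)
  | arr i e, σ => σ.arr i (e.eval σ)
  | sum r e, σ => ∑ i ∈ Finset.range (σ.reg 0), e.eval (σ.setReg r i)
  | sup r e, σ => (Finset.range (σ.reg 0)).sup fun i => e.eval (σ.setReg r i)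

/-- An exponent `d` such that all values computed by the expression are at most `M ^ d` when the
store is bounded by `M`. -/
def deg : Expr → ℕ
  | var _ => 1
  | lit _ => 1
  | bin .add a b => max a.deg b.deg + 1
  | bin .sub a b => max a.deg b.deg
  | bin .mul a b => a.deg + b.deg
  | bin .div a b => max a.deg b.deg
  | arr _ e => e.deg
  | sum _ e => e.deg + 1
  | sup _ e => e.deg + 1

/-- Registers from `t` on stay free for temporaries. Literals are at most `4` because value bounds
`M` are only assumed to satisfy `4 ≤ M`, and register `0` may not be bound since it holds the range
of all sums. -/
def wf (t : ℕ) : Expr → Bool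
  | var r => r < t
  | lit k => k ≤ 4
  | bin _ a b => a.wf t && b.wf t
  | arr _ e => e.wf t
  | sum r e => r < t && r ≠ 0 && e.wf t
  | sup r e => r < t && r ≠ 0 && e.wf t

def cost (N : ℕ) : Expr → ℕ
  | var _ => 2
  | lit _ => 1
  | bin _ a b => a.cost N + b.cost N + 1
  | arr _ e => e.cost N + 1
  | sum _ e => N * (e.cost N + 20) + 20
  | sup _ e => N * (e.cost N + 20) + 20

end Expr

/-- The machine has no move instruction; clearing `d` first makes this correct only for `x ≠ d`. -/
def copy (d x : ℕ) : Prog := .seq (.const d 0) (.op .add d d x)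

/-- Runs `body` with the register `r` going through `0, 1, …`, as often as the register `t` says;
`t`, `t + 1` and `t + 2` are used for the administration. -/
def iterProg (t r : ℕ) (body : Prog) : Prog :=
  .seq (.const (t + 1) 0) (.loop t (.seq (copy r (t + 1)) (.seq body
    (.seq (.const (t + 2) 1) (.seq (.op .add (t + 1) (t + 1) (t + 2)) (.op .sub t t (t + 2)))))))

namespace Expr

/-- Code that evaluates an expression into the register `t`, using only registers from `t` on. -/
def compile : ℕ → Expr → Prog
  | t, var r => copy t r
  | t, lit k => .const t k
  | t, bin o a b => .seq (compile t a) (.seq (compile (t + 1) b) (.op o t t (t + 1)))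
  | t, arr i e => .seq (compile t e) (.load t i t)
  -- Register `t` accumulates, `t + 1` saves the bound register, `t + 2` to `t + 4` administer the
  -- loop, and the summand is evaluated from `t + 5` on.
  | t, sum r e => .seq (.const t 0) (.seq (copy (t + 1) r) (.seq (copy (t + 2) 0)
      (.seq (iterProg (t + 2) r (.seq (compile (t + 5) e) (.op .add t t (t + 5))))
        (copy r (t + 1)))))
  | t, sup r e => .seq (.const t 0) (.seq (copy (t + 1) r) (.seq (copy (t + 2) 0)
      (.seq (iterProg (t + 2) r (.seq (compile (t + 5) e)
        -- With truncated subtraction, `max a b = a + (b - a)`.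
        (.seq (.op .sub (t + 5) (t + 5) t) (.op .add t t (t + 5)))))
        (copy r (t + 1)))))

end Expr

/-- `P` leads from `σ` to `τ` in at most `T` steps. -/
def Runs (w : ℕ) (P : Prog) (σ τ : Store) (T : ℕ) : Prop := ∃ T' ≤ T, Exec w P σ τ T'

namespace Runs

variable {w : ℕ} {P P' : Prog} {σ τ υ : Store} {T T' : ℕ}

lemma mono (h : Runs w P σ τ T) (hT : T ≤ T') : Runs w P σ τ T' := by
  obtain ⟨S, hS, h⟩ := h
  exact ⟨S, hS.trans hT, h⟩

lemma seq (h : Runs w P σ τ T) (h' : Runs w P' τ υ T') : Runs w (.seq P P') σ υ (T + T') := by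
  obtain ⟨S, hS, h⟩ := h
  obtain ⟨S', hS', h'⟩ := h'
  exact ⟨S + S', by omega, .seq h h'⟩

lemma const (d k : ℕ) (h : k < 2 ^ w) : Runs w (.const d k) σ (σ.setReg d k) 1 :=
  ⟨1, le_rfl, .const σ d k h⟩

lemma op (o : Op) (d x y : ℕ) (h : o.eval (σ.reg x) (σ.reg y) < 2 ^ w) :
    Runs w (.op o d x y) σ (σ.setReg d (o.eval (σ.reg x) (σ.reg y))) 1 :=
  ⟨1, le_rfl, .op σ o d x y h⟩

lemma copy {d x : ℕ} (hne : x ≠ d) (h : σ.reg x < 2 ^ w) :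
    Runs w (copy d x) σ (σ.setReg d (σ.reg x)) 2 := by
  have h1 : Runs w (.const d 0) σ (σ.setReg d 0) 1 := const d 0 (by positivity)
  have h2 : Runs w (.op .add d d x) (σ.setReg d 0) _ 1 :=
    op .add d d x (by simpa [Op.eval, hne] using h)
  have := h1.seq h2
  simpa [WordRAM.copy, Op.eval, hne, Store.setReg] using this

end Runs

/-- `τ` agrees with `σ` on the arrays and on the registers below `t`. -/
structure Agree (t : ℕ) (σ τ : Store) : Prop where
  reg : ∀ r < t, τ.reg r = σ.reg r
  arr : τ.arr = σ.arr

lemma Agree.refl (t : ℕ) (σ : Store) : Agree t σ σ := ⟨fun _ _ => rfl, rfl⟩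

lemma Agree.trans {t : ℕ} {σ τ υ : Store} (h : Agree t σ τ) (h' : Agree t τ υ) : Agree t σ υ :=
  ⟨fun r hr => (h'.reg r hr).trans (h.reg r hr), h'.arr.trans h.arr⟩

lemma Agree.mono {t t' : ℕ} {σ τ : Store} (h : Agree t σ τ) (ht : t' ≤ t) : Agree t' σ τ :=
  ⟨fun r hr => h.reg r (hr.trans_le ht), h.arr⟩

/-- Rule for `iterProg`, with an invariant relating the number of finished iterations and the
store. -/
lemma runs_iterProg {w t r m Tb : ℕ} {body : Prog} {σ : Store} (Inv : ℕ → Store → Prop)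
    (hr : r < t) (hm : σ.reg t = m) (hmw : m < 2 ^ w) (hw : 1 < 2 ^ w)
    (hcongr : ∀ i σ τ, Agree t σ τ → Inv i σ → Inv i τ) (h0 : Inv 0 σ)
    (hb : ∀ i < m, ∀ σ, Inv i σ → ∃ τ, Runs w body (σ.setReg r i) τ Tb ∧ Inv (i + 1) τ ∧
      ∀ q, t ≤ q → q < t + 3 → τ.reg q = σ.reg q) :
    ∃ τ, Runs w (iterProg t r body) σ τ (m * (Tb + 6) + 2) ∧ Inv m τ := by
  -- Induction on the number `k` of remaining rounds. Besides the body, a round costs 2 steps for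
  -- the copy, 3 for the counters and 1 for the loop test.
  have key : ∀ k i σ, i + k = m → σ.reg t = k → σ.reg (t + 1) = i → Inv i σ →
      ∃ τ, Runs w (.loop t (.seq (copy r (t + 1)) (.seq body (.seq (.const (t + 2) 1)
        (.seq (.op .add (t + 1) (t + 1) (t + 2)) (.op .sub t t (t + 2))))))) σ τ
        (k * (Tb + 6) + 1) ∧ Inv m τ := by
    intro k
    induction k with
    | zero =>
      intro i σ hi hk _ hI
      refine ⟨σ, ⟨1, by omega, .loop_done hk⟩, ?_⟩
      rwa [← hi, Nat.add_zero]
    | succ k ih =>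
      intro i σ hi hk hc hI
      have hiw : i < 2 ^ w := by omega
      have r1 : Runs w (copy r (t + 1)) σ (σ.setReg r i) 2 := by
        have := Runs.copy (w := w) (σ := σ) (d := r) (x := t + 1) (by omega) (by omega)
        rwa [hc] at this
      obtain ⟨τ, r2, hI', hq⟩ := hb i (by omega) σ hI
      have e0 : τ.reg t = k + 1 := by rw [hq t le_rfl (by omega), hk]
      have e1 : τ.reg (t + 1) = i := by rw [hq (t + 1) (by omega) (by omega), hc]
      have r3 : Runs w (.const (t + 2) 1) τ (τ.setReg (t + 2) 1) 1 := Runs.const _ _ hw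
      have r4 : Runs w (.op .add (t + 1) (t + 1) (t + 2)) (τ.setReg (t + 2) 1) _ 1 :=
        Runs.op _ _ _ _ (by simp [Op.eval, e1]; omega)
      have r5 := Runs.op (w := w) (σ := ((τ.setReg (t + 2) 1).setReg (t + 1)
        (Op.add.eval ((τ.setReg (t + 2) 1).reg (t + 1)) ((τ.setReg (t + 2) 1).reg (t + 2)))))
        .sub t t (t + 2) (by simp [Op.eval, e0]; omega)
      set υ := (((τ.setReg (t + 2) 1).setReg (t + 1)
        (Op.add.eval ((τ.setReg (t + 2) 1).reg (t + 1))
          ((τ.setReg (t + 2) 1).reg (t + 2)))).setReg t _) with hυ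
      obtain ⟨ω, ⟨S, hS, r6⟩, hω⟩ := ih (i + 1) υ (by omega)
        (by simp [hυ, Op.eval, e0]) (by simp [hυ, Op.eval, e1])
        (hcongr _ τ υ ⟨fun q hq => by
          simp [hυ, hq.ne, show q ≠ t + 1 by omega, show q ≠ t + 2 by omega], rfl⟩ hI')
      obtain ⟨S', hS', r7⟩ := r1.seq (r2.seq (r3.seq (r4.seq r5)))
      refine ⟨ω, ⟨S' + S + 1, ?_, .loop_step (by omega) r7 r6⟩, hω⟩
      have : (k + 1) * (Tb + 6) = k * (Tb + 6) + (Tb + 6) := by ring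
      omega
  have r0 : Runs w (.const (t + 1) 0) σ (σ.setReg (t + 1) 0) 1 := Runs.const _ _ (by omega)
  obtain ⟨τ, r1, h⟩ := key m 0 (σ.setReg (t + 1) 0) (by omega) (by simpa using hm) (by simp)
    (hcongr _ σ _ ⟨fun q hq => by simp [show q ≠ t + 1 by omega], rfl⟩ h0)
  exact ⟨τ, (r0.seq r1).mono (by omega), h⟩

/-- All cells are at most `M`. -/
structure Store.Bdd (M : ℕ) (σ : Store) : Prop where
  reg : ∀ r, σ.reg r ≤ M
  arr : ∀ i j, σ.arr i j ≤ M

lemma Store.Bdd.setReg {M : ℕ} {σ : Store} (h : σ.Bdd M) (r : ℕ) {x : ℕ} (hx : x ≤ M) :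
    (σ.setReg r x).Bdd M :=
  ⟨fun q => by simp only [Store.setReg_reg]; split_ifs <;> [exact hx; exact h.reg q], h.arr⟩

lemma Store.Bdd.setArr {M : ℕ} {σ : Store} (h : σ.Bdd M) (i j : ℕ) {x : ℕ} (hx : x ≤ M) :
    (σ.setArr i j x).Bdd M := by
  refine ⟨h.reg, fun a b => ?_⟩
  simp only [Store.setArr_arr]
  split_ifs
  · rw [Function.update_apply]
    split_ifs <;> [exact hx; exact h.arr _ _]
  · exact h.arr _ _

namespace Expr

lemma one_le_deg (e : Expr) : 1 ≤ e.deg := by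
  induction e with
  | bin o a b iha ihb => cases o <;> simp only [deg] <;> omega
  | _ => simp_all [deg]

/-- An addition at most doubles and a sum has at most `M` terms, so each costs one factor `M`;
products add the exponents. -/
lemma eval_le {M t : ℕ} (hM : 4 ≤ M) (e : Expr) {σ : Store} (hσ : σ.Bdd M) (he : e.wf t) :
    e.eval σ ≤ M ^ e.deg := by
  have hM1 : 1 ≤ M := by omega
  have key : ∀ (r : ℕ) (e : Expr), (∀ {σ : Store}, σ.Bdd M → e.eval σ ≤ M ^ e.deg) →
      ∀ {σ : Store}, σ.Bdd M → ∀ i ∈ Finset.range (σ.reg 0),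
        e.eval (σ.setReg r i) ≤ M ^ e.deg := by
    intro r e ih σ hσ i hi
    have := hσ.reg 0
    exact ih (hσ.setReg r (by simp at hi; omega))
  induction e generalizing σ with
  | var r => simpa [deg, eval] using hσ.reg r
  | lit k => simp only [wf, decide_eq_true_eq] at he; simp [deg, eval]; omega
  | bin o a b iha ihb =>
    simp only [wf, Bool.and_eq_true] at he
    have ha := iha hσ he.1
    have hb := ihb hσ he.2
    have ha' := ha.trans (Nat.pow_le_pow_right hM1 (le_max_left a.deg b.deg))
    have hb' := hb.trans (Nat.pow_le_pow_right hM1 (le_max_right a.deg b.deg))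
    cases o with
    | add => simp only [eval, deg, Op.eval, pow_succ]; nlinarith
    | sub => simp only [eval, deg, Op.eval]; omega
    | mul => simp only [eval, deg, Op.eval, pow_add]; exact Nat.mul_le_mul ha hb
    | div => simp only [eval, deg, Op.eval]; exact (Nat.div_le_self _ _).trans ha'
  | arr i e ih =>
    simp only [eval, deg]
    exact (hσ.arr _ _).trans (Nat.le_self_pow (by have := one_le_deg e; omega) M)
  | sum r e ih =>
    simp only [wf, Bool.and_eq_true] at he
    simp only [eval, deg, pow_succ]
    refine (Finset.sum_le_sum (key r e (fun h => ih h he.2) hσ)).trans ?_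
    simp only [Finset.sum_const, Finset.card_range, smul_eq_mul]
    rw [mul_comm]
    exact Nat.mul_le_mul_left _ (hσ.reg 0)
  | sup r e ih =>
    simp only [wf, Bool.and_eq_true] at he
    simp only [eval, deg]
    exact (Finset.sup_le (key r e (fun h => ih h he.2) hσ)).trans
      (Nat.pow_le_pow_right hM1 (by omega))

/-- The code for a fold over the values of a bound register `r`. -/
lemma runs_fold {w t₀ t r N C : ℕ} {body upd : Prog} {σ σ' : Store} (F : ℕ → ℕ → ℕ)
    (f acc : ℕ → ℕ) (hr : r < t₀) (ht : t₀ ≤ t) (hA : Agree t₀ σ σ')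
    (hN : σ.reg 0 ≤ N) (hw : 1 < 2 ^ w) (hrw : σ.reg r < 2 ^ w) (h0w : σ.reg 0 < 2 ^ w)
    (hacc0 : acc 0 = 0) (hacc : ∀ i < σ.reg 0, acc (i + 1) = F (acc i) (f i))
    (hb : ∀ i < σ.reg 0, ∀ υ, Agree t₀ (σ.setReg r i) υ →
      ∃ τ, Runs w body υ τ C ∧ τ.reg (t + 5) = f i ∧ Agree (t + 5) υ τ)
    (hu : ∀ i < σ.reg 0, ∀ υ : Store, υ.reg t = acc i → υ.reg (t + 5) = f i →
      ∃ τ, Runs w upd υ τ 2 ∧ τ.reg t = F (acc i) (f i) ∧ (∀ q < t + 5, q ≠ t →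
        τ.reg q = υ.reg q) ∧ τ.arr = υ.arr) :
    ∃ τ, Runs w (.seq (.const t 0) (.seq (copy (t + 1) r) (.seq (copy (t + 2) 0)
      (.seq (iterProg (t + 2) r (.seq body upd)) (copy r (t + 1)))))) σ' τ (N * (C + 20) + 20) ∧
      τ.reg t = acc (σ.reg 0) ∧ Agree t σ' τ := by
  have hσr := hA.reg r hr
  have hσ0 := hA.reg 0 (by omega)
  have r1 : Runs w (.const t 0) σ' (σ'.setReg t 0) 1 := Runs.const _ _ (by omega)
  have r2 := Runs.copy (w := w) (σ := σ'.setReg t 0) (d := t + 1) (x := r) (by omega)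
    (by simp [show r ≠ t by omega, hσr, hrw])
  have r3 := Runs.copy (w := w) (σ := (σ'.setReg t 0).setReg (t + 1) ((σ'.setReg t 0).reg r))
    (d := t + 2) (x := 0) (by omega) (by simp [show 0 ≠ t by omega, hσ0, h0w])
  set ρ := (((σ'.setReg t 0).setReg (t + 1) ((σ'.setReg t 0).reg r)).setReg (t + 2) _) with hρ
  -- The bound register `r` is exempt from the frame condition; the final copy from `t + 1` restores
  -- it.
  let Inv : ℕ → Store → Prop := fun i υ => υ.reg t = acc i ∧ υ.reg (t + 1) = σ.reg r ∧
    (∀ q < t, q ≠ r → υ.reg q = σ'.reg q) ∧ υ.arr = σ'.arr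
  obtain ⟨τ, r4, h1, h2, h3, h4⟩ := runs_iterProg (w := w) (t := t + 2) (r := r) (m := σ.reg 0)
    (Tb := C + 2) (body := .seq body upd) (σ := ρ) Inv (by omega)
    (by simp [hρ, show 0 ≠ t by omega, hσ0]) h0w hw
    (fun i υ υ' h hI => ⟨by rw [h.reg _ (by omega), hI.1], by rw [h.reg _ (by omega), hI.2.1],
      fun q hq hqr => by rw [h.reg _ (by omega), hI.2.2.1 q hq hqr], by rw [h.arr, hI.2.2.2]⟩)
    ⟨by simp [hρ, hacc0], by simp [hρ, show r ≠ t by omega, hσr], fun q hq hqr => by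
      simp [hρ, show q ≠ t by omega, show q ≠ t + 1 by omega, show q ≠ t + 2 by omega], rfl⟩
    (fun i hi υ hI => by
      obtain ⟨τ, s1, hv, hA1⟩ := hb i hi (υ.setReg r i) ⟨fun q hq => by
        by_cases hqr : q = r
        · simp [hqr]
        · simp [hqr, hI.2.2.1 q (by omega) hqr, hA.reg q hq], by simp [hI.2.2.2, hA.arr]⟩
      obtain ⟨τ', s2, hv', hq', ha'⟩ := hu i hi τ
        (by rw [hA1.reg _ (by omega)]; simp [show t ≠ r by omega, hI.1]) hv
      have hreg : ∀ q < t + 5, q ≠ t → q ≠ r → τ'.reg q = υ.reg q := fun q hq hqt hqr => by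
        rw [hq' q hq hqt, hA1.reg q hq]; simp [hqr]
      refine ⟨τ', s1.seq s2, ⟨by rw [hv', hacc i hi], ?_, fun q hq hqr => ?_, ?_⟩, fun q h1 h2 => ?_⟩
      · rw [hreg _ (by omega) (by omega) (by omega), hI.2.1]
      · rw [hreg _ (by omega) (by omega) hqr, hI.2.2.1 q hq hqr]
      · rw [ha', hA1.arr]; simp [hI.2.2.2]
      · exact hreg _ (by omega) (by omega) (by omega))
  have r5 := Runs.copy (w := w) (σ := τ) (d := r) (x := t + 1) (by omega) (by omega)
  refine ⟨_, (r1.seq (r2.seq (r3.seq (r4.seq r5)))).mono ?_, ?_, fun q hq => ?_, by simp [h4]⟩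
  · have := Nat.mul_le_mul_right (C + 20) hN
    nlinarith
  · simp [show t ≠ r by omega, h1]
  · by_cases hqr : q = r
    · simp [hqr, h2, hσr]
    · simp [hqr, h3 q hq hqr]

-- The store `σ` gives the meaning, while `σ'` is the actual one, which may hold temporaries from
-- `t₀` on. Only agreement below `t₀` is needed, so the semantics never sees temporaries. `M ^ D < 2
-- ^ w` excludes overflow.
attribute [local simp] eval in
theorem runs_compile {w M N D t₀ : ℕ} (hM : 4 ≤ M) (hMw : M ^ D < 2 ^ w) (e : Expr) :
    ∀ {σ σ' : Store} {t : ℕ}, σ.Bdd M → e.wf t₀ → e.deg ≤ D → σ.reg 0 ≤ N → t₀ ≤ t →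
      Agree t₀ σ σ' →
      ∃ τ, Runs w (e.compile t) σ' τ (e.cost N) ∧ τ.reg t = e.eval σ ∧ Agree t σ' τ := by
  have hlt : ∀ (e : Expr) {σ : Store}, σ.Bdd M → e.wf t₀ → e.deg ≤ D → e.eval σ < 2 ^ w :=
    fun e σ hσ he hd => ((e.eval_le hM hσ he).trans
      (Nat.pow_le_pow_right (by omega) hd)).trans_lt hMw
  have hmem : ∀ (e : Expr) {x : ℕ}, e.deg ≤ D → x ≤ M → x < 2 ^ w := fun e x hd hx =>
    (hx.trans (Nat.le_self_pow (by have := e.one_le_deg; omega) M)).trans_lt hMw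
  induction e with
  | var r =>
    intro σ σ' t hσ he hd hN ht hA
    simp only [wf, decide_eq_true_eq] at he
    have hr := hA.reg r he
    refine ⟨_, Runs.copy (by omega) (by rw [hr]; exact hmem _ hd (hσ.reg r)), by simp [hr], ?_⟩
    exact ⟨fun q hq => by simp [hq.ne], rfl⟩
  | lit k =>
    intro σ σ' t hσ he hd hN ht hA
    exact ⟨_, Runs.const _ _ (hlt (.lit k) hσ he hd), by simp,
      fun q hq => by simp [hq.ne], rfl⟩
  | bin o a b iha ihb =>
    intro σ σ' t hσ he hd hN ht hA
    have hv := hlt _ hσ he hd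
    simp only [wf, Bool.and_eq_true] at he
    have hda : a.deg ≤ D ∧ b.deg ≤ D := by
      cases o <;> simp only [deg] at hd <;> omega
    obtain ⟨τ, r1, h1, A1⟩ := iha hσ he.1 hda.1 hN ht hA
    obtain ⟨τ', r2, h2, A2⟩ := ihb (t := t + 1) hσ he.2 hda.2 hN (by omega)
      (hA.trans (A1.mono ht))
    have h1' : τ'.reg t = a.eval σ := by rw [A2.reg t (by omega), h1]
    have r3 := Runs.op (w := w) (σ := τ') o t t (t + 1) (by rw [h1', h2]; exact hv)
    refine ⟨_, (r1.seq (r2.seq r3)).mono (by simp only [cost]; omega), by simp [h1', h2], ?_⟩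
    exact A1.trans ((A2.mono (by omega)).trans ⟨fun q hq => by simp [hq.ne], rfl⟩)
  | arr i e ih =>
    intro σ σ' t hσ he hd hN ht hA
    obtain ⟨τ, r1, h1, A1⟩ := ih hσ he hd hN ht hA
    refine ⟨_, r1.seq ⟨1, le_rfl, .load τ t i t⟩, by simp [h1, A1.arr, hA.arr], ?_⟩
    exact A1.trans ⟨fun q hq => by simp [hq.ne], rfl⟩
  | sum r e ih =>
    intro σ σ' t hσ he hd hN ht hA
    have hv := hlt _ hσ he hd
    simp only [wf, Bool.and_eq_true, decide_eq_true_eq] at he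
    simp only [deg] at hd
    simp only [eval] at hv
    refine runs_fold (fun a b => a + b) (fun i => e.eval (σ.setReg r i))
      (fun i => ∑ j ∈ Finset.range i, e.eval (σ.setReg r j)) he.1.1 ht hA hN
      (hmem e (by omega) (by omega)) (hmem e (by omega) (hσ.reg r)) (hmem e (by omega) (hσ.reg 0))
      (by simp) (fun i _ => Finset.sum_range_succ _ _) (fun i hi υ hυ => ?_)
      (fun i hi υ h1 h2 => ?_)
    · have h0 := hσ.reg 0
      exact ih (t := t + 5) (hσ.setReg r (by omega)) he.2 (by omega)
        (by simpa [Ne.symm he.1.2] using hN) (by omega) hυ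
    · refine ⟨_, (Runs.op .add t t (t + 5) ?_).mono (by omega), by simp [Op.eval, h1, h2],
        fun q _ hqt => by simp [hqt], rfl⟩
      -- Partial sums are bounded by the full sum, which fits into a word.
      rw [h1, h2, Op.eval, ← Finset.sum_range_succ]
      refine lt_of_le_of_lt (Finset.sum_le_sum_of_subset ?_) hv
      intro x; simp; omega
  | sup r e ih =>
    intro σ σ' t hσ he hd hN ht hA
    have hv := hlt _ hσ he hd
    simp only [wf, Bool.and_eq_true, decide_eq_true_eq] at he
    simp only [deg] at hd
    simp only [eval] at hv
    refine runs_fold (fun a b => max a b) (fun i => e.eval (σ.setReg r i))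
      (fun i => (Finset.range i).sup fun j => e.eval (σ.setReg r j)) he.1.1 ht hA hN
      (hmem e (by omega) (by omega)) (hmem e (by omega) (hσ.reg r)) (hmem e (by omega) (hσ.reg 0))
      (by simp) (fun i _ => ?_) (fun i hi υ hυ => ?_)
      (fun i hi υ h1 h2 => ?_)
    · rw [Finset.range_add_one, Finset.sup_insert, max_comm]
    · have h0 := hσ.reg 0
      exact ih (t := t + 5) (hσ.setReg r (by omega)) he.2 (by omega)
        (by simpa [Ne.symm he.1.2] using hN) (by omega) hυ
    · have hle : ∀ i < σ.reg 0, e.eval (σ.setReg r i) < 2 ^ w := fun i hi =>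
        hlt e (hσ.setReg r (hi.le.trans (hσ.reg 0))) he.2 (by omega)
      have hacc : ((Finset.range i).sup fun j => e.eval (σ.setReg r j)) < 2 ^ w := by
        refine lt_of_le_of_lt (Finset.sup_mono ?_) hv
        intro x; simp; omega
      have r1 := Runs.op (w := w) (σ := υ) .sub (t + 5) (t + 5) t
        (by rw [h1, h2, Op.eval]; have := hle i hi; omega)
      have r2 := Runs.op (w := w) (σ := υ.setReg (t + 5)
        (Op.sub.eval (υ.reg (t + 5)) (υ.reg t))) .add t t (t + 5)
        (by simp [Op.eval, h1, h2]; have := hle i hi; omega)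
      refine ⟨_, r1.seq r2, ?_, fun q hq hqt => by simp [hqt, hq.ne], rfl⟩
      simp [Op.eval, h1, h2]
      omega

end Expr
end WordRAM

/-! ### Statements, weakest preconditions and static cost bounds -/

namespace WordRAM

/-- Statements. `loop b r e s` runs `s` for the values `0, …, e - 1` of the register `r`; the flag
`b` tells whether the loop counts as a long one. -/
inductive Stmt where
  | skip
  | assign (r : ℕ) (e : Expr)
  | put (i : ℕ) (a b : Expr)
  | seq (a b : Stmt)
  | ite (e : Expr) (a b : Stmt)
  | loop (b : Bool) (r : ℕ) (e : Expr) (s : Stmt)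

namespace Stmt

def compile : ℕ → Stmt → Prog
  | _, skip => .skip
  | t, assign r e => .seq (e.compile t) (copy r t)
  | t, put i a b => .seq (a.compile t) (.seq (b.compile (t + 1)) (.store i t (t + 1)))
  | t, seq a b => .seq (a.compile t) (b.compile t)
  | t, ite e a b => .seq (e.compile t) (.ite t (a.compile t) (b.compile t))
  -- The body is compiled three registers higher, above the loop administration.
  | t, loop _ r e s => .seq (e.compile t) (iterProg t r (s.compile (t + 3)))

def wf (t : ℕ) : Stmt → Bool
  | skip => true
  | assign r e => r < t && r ≠ 0 && e.wf t
  | put _ a b => a.wf t && b.wf t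
  | seq a b => a.wf t && b.wf t
  | ite e a b => e.wf t && a.wf t && b.wf t
  | loop _ r e s => r < t && r ≠ 0 && e.wf t && s.wf t

/-- Degrees do not accumulate along a run: `wp` demands that every stored value is again at most
`M`, so only single expressions can exceed `M`. -/
def deg : Stmt → ℕ
  | skip => 1
  | assign _ e => e.deg
  | put _ a b => max a.deg b.deg
  | seq a b => max a.deg b.deg
  | ite e a b => max e.deg (max a.deg b.deg)
  | loop _ _ e s => max e.deg s.deg

/-- A bound on the running time, if short loops take at most `N` rounds and long ones at most
`K`. -/
def cost (N K : ℕ) : Stmt → ℕ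
  | skip => 1
  | assign _ e => e.cost N + 2
  | put _ a b => a.cost N + b.cost N + 1
  | seq a b => a.cost N K + b.cost N K
  | ite e a b => e.cost N + a.cost N K + b.cost N K + 1
  | loop b _ e s => e.cost N + cond b K N * (s.cost N K + 6) + 2

/-- The registers that may be changed. -/
def regs : Stmt → List ℕ
  | skip => []
  | assign r _ => [r]
  | put _ _ _ => []
  | seq a b => a.regs ++ b.regs
  | ite _ a b => a.regs ++ b.regs
  | loop _ r _ s => r :: s.regs

/-- The arrays that may be changed. -/
def arrs : Stmt → List ℕ
  | skip => []
  | assign _ _ => []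
  | put i _ _ => [i]
  | seq a b => a.arrs ++ b.arrs
  | ite _ a b => a.arrs ++ b.arrs
  | loop _ _ _ s => s.arrs

/-- `k` rounds of a loop with body transformer `W` and counter `r`, starting with the value `i`. -/
def wpIter (W : (Store → Prop) → Store → Prop) (r : ℕ) : ℕ → ℕ → (Store → Prop) → Store → Prop
  | 0, _, Q => Q
  | k + 1, i, Q => fun σ => W (wpIter W r k (i + 1) Q) (σ.setReg r i)

/-- Weakest precondition, including that all values stored are at most `M`, that short loops have
at most `N` rounds and long loops at most `K`. -/
def wp (M N K : ℕ) : Stmt → (Store → Prop) → Store → Prop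
  | skip, Q, σ => Q σ
  | assign r e, Q, σ => e.eval σ ≤ M ∧ Q (σ.setReg r (e.eval σ))
  | put i a b, Q, σ => b.eval σ ≤ M ∧ Q (σ.setArr i (a.eval σ) (b.eval σ))
  | seq a b, Q, σ => a.wp M N K (b.wp M N K Q) σ
  | ite e a b, Q, σ => (e.eval σ ≠ 0 → a.wp M N K Q σ) ∧ (e.eval σ = 0 → b.wp M N K Q σ)
  | loop b r e s, Q, σ => e.eval σ ≤ cond b K N ∧ wpIter (s.wp M N K) r (e.eval σ) 0 Q σ

/-- Only the registers and arrays that `s` assigns to differ in `σ` and `τ`. -/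
structure Frame (s : Stmt) (σ τ : Store) : Prop where
  reg : ∀ r ∉ s.regs, τ.reg r = σ.reg r
  arr : ∀ i ∉ s.arrs, τ.arr i = σ.arr i

variable {M N K : ℕ}

lemma wpIter_mono {W : (Store → Prop) → Store → Prop} {r : ℕ}
    (hW : ∀ {Q Q' : Store → Prop} {σ}, (∀ τ, Q τ → Q' τ) → W Q σ → W Q' σ) {k : ℕ} :
    ∀ {i : ℕ} {Q Q' : Store → Prop} {σ : Store}, (∀ τ, Q τ → Q' τ) → wpIter W r k i Q σ →
      wpIter W r k i Q' σ := by
  induction k with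
  | zero => exact fun h => h _
  | succ k ih => exact fun h => hW fun τ => ih h

lemma wp_mono {s : Stmt} : ∀ {Q Q' : Store → Prop} {σ : Store}, (∀ τ, Q τ → Q' τ) →
    s.wp M N K Q σ → s.wp M N K Q' σ := by
  induction s with
  | skip => exact fun h => h _
  | assign r e => exact fun h => And.imp_right (h _)
  | put i a b => exact fun h => And.imp_right (h _)
  | seq a b iha ihb => exact fun h => iha fun τ => ihb h
  | ite e a b iha ihb => exact fun h h' => ⟨fun h0 => iha h (h'.1 h0), fun h0 => ihb h (h'.2 h0)⟩
  | loop b r e s ih => exact fun h => And.imp_right (wpIter_mono (W := s.wp M N K) ih h)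

lemma wpIter_frame {s : Stmt} {r : ℕ} {l la : List ℕ} (hr : r ∈ l)
    (ih : ∀ {Q : Store → Prop} {σ}, s.wp M N K Q σ → s.wp M N K (fun τ => Q τ ∧
      (∀ r ∉ l, τ.reg r = σ.reg r) ∧ ∀ i ∉ la, τ.arr i = σ.arr i) σ) {k : ℕ} :
    ∀ {i : ℕ} {Q : Store → Prop} {σ : Store}, wpIter (s.wp M N K) r k i Q σ →
      wpIter (s.wp M N K) r k i (fun τ => Q τ ∧
      (∀ r ∉ l, τ.reg r = σ.reg r) ∧ ∀ i ∉ la, τ.arr i = σ.arr i) σ := by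
  induction k with
  | zero => exact fun h => ⟨h, fun _ _ => rfl, fun _ _ => rfl⟩
  | succ k ihk =>
    intro i Q σ h
    refine wp_mono ?_ (ih h)
    rintro τ ⟨h1, h2, h3⟩
    refine wpIter_mono (W := s.wp M N K) wp_mono ?_ (ihk h1)
    rintro υ ⟨h4, h5, h6⟩
    refine ⟨h4, fun q hq => ?_, fun q hq => ?_⟩
    · rw [h5 q hq, h2 q hq, Store.setReg_reg, if_neg]
      rintro rfl
      exact hq hr
    · rw [h6 q hq, h3 q hq, Store.setReg_arr]

/-- Arbitrary superlists `l`, `la` are allowed so that the induction hypotheses for the parts of a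
statement apply with the lists of the whole. -/
lemma wp_frame' {s : Stmt} : ∀ {l la : List ℕ}, s.regs ⊆ l → s.arrs ⊆ la →
    ∀ {Q : Store → Prop} {σ : Store}, s.wp M N K Q σ → s.wp M N K (fun τ => Q τ ∧
      (∀ r ∉ l, τ.reg r = σ.reg r) ∧ ∀ i ∉ la, τ.arr i = σ.arr i) σ := by
  induction s with
  | skip => exact fun _ _ _ _ h => ⟨h, fun _ _ => rfl, fun _ _ => rfl⟩
  | assign r e =>
    intro l la hl hla Q σ h
    refine ⟨h.1, h.2, fun q hq => ?_, fun _ _ => rfl⟩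
    rw [Store.setReg_reg, if_neg]
    rintro rfl
    exact hq (hl (by simp [regs]))
  | put i a b =>
    intro l la hl hla Q σ h
    refine ⟨h.1, h.2, fun _ _ => rfl, fun q hq => ?_⟩
    rw [Store.setArr_arr, if_neg]
    rintro rfl
    exact hq (hla (by simp [arrs]))
  | seq a b iha ihb =>
    intro l la hl hla Q σ h
    simp only [regs, arrs, List.append_subset] at hl hla
    refine wp_mono (s := a) (Q := fun τ => b.wp M N K Q τ ∧ _) ?_ (iha hl.1 hla.1 h)
    rintro τ ⟨h1, h2, h3⟩
    refine wp_mono ?_ (ihb hl.2 hla.2 h1)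
    rintro υ ⟨h4, h5, h6⟩
    exact ⟨h4, fun q hq => (h5 q hq).trans (h2 q hq), fun q hq => (h6 q hq).trans (h3 q hq)⟩
  | ite e a b iha ihb =>
    intro l la hl hla Q σ h
    simp only [regs, arrs, List.append_subset] at hl hla
    exact ⟨fun h0 => iha hl.1 hla.1 (h.1 h0), fun h0 => ihb hl.2 hla.2 (h.2 h0)⟩
  | loop b r e s ih =>
    intro l la hl hla Q σ h
    simp only [regs, arrs, List.cons_subset] at hl hla
    exact ⟨h.1, wpIter_frame hl.1 (ih hl.2 hla) h.2⟩

lemma wp_frame {s : Stmt} {Q : Store → Prop} {σ : Store} (h : s.wp M N K Q σ) :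
    s.wp M N K (fun τ => Frame s σ τ ∧ Q τ) σ :=
  wp_mono (fun _ h => ⟨⟨h.2.1, h.2.2⟩, h.1⟩)
    (wp_frame' (List.Subset.refl s.regs) (List.Subset.refl s.arrs) h)

/-- The rule for loops; in the invariant `Inv i` the number `i` is that of the finished rounds. -/
lemma wp_loop {b : Bool} {r : ℕ} {e : Expr} {s : Stmt} {Q : Store → Prop} {σ : Store}
    (Inv : ℕ → Store → Prop) (he : e.eval σ ≤ cond b K N) (h0 : Inv 0 σ)
    (hs : ∀ i < e.eval σ, ∀ τ, Frame (loop b r e s) σ τ → Inv i τ →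
      s.wp M N K (Inv (i + 1)) (τ.setReg r i))
    (hQ : ∀ τ, Frame (loop b r e s) σ τ → Inv (e.eval σ) τ → Q τ) :
    (loop b r e s).wp M N K Q σ := by
  refine ⟨he, ?_⟩
  have key : ∀ k i τ, i + k = e.eval σ → Frame (loop b r e s) σ τ → Inv i τ →
      wpIter (s.wp M N K) r k i Q τ := by
    intro k
    induction k with
    | zero => exact fun i τ hi hF hI => hQ τ hF (by rwa [← hi])
    | succ k ih =>
      intro i τ hi hF hI
      refine wp_mono ?_ (wp_frame (hs i (by omega) τ hF hI))
      rintro υ ⟨hF', hI'⟩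
      refine ih _ _ (by omega) ⟨fun q hq => ?_, fun q hq => ?_⟩ hI'
      · simp only [regs, List.mem_cons, not_or] at hq
        rw [hF'.reg q hq.2, Store.setReg_reg, if_neg hq.1,
          hF.reg q (by simp [regs, hq])]
      · rw [hF'.arr q hq, Store.setReg_arr, hF.arr q hq]
  exact key _ _ _ (by omega) ⟨fun _ _ => rfl, fun _ _ => rfl⟩ h0

/-- Soundness of `wp`: the actual final store `τ` is shadowed by a store `υ` without temporaries,
which satisfies `Q` and the bound `M`. The last clause protects the counters of enclosing loops,
which lie between `t₀` and `t`. -/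
theorem runs_compile {w D t₀ : ℕ} (hM : 4 ≤ M) (hMw : M ^ D < 2 ^ w) (hKM : K ≤ M)
    (hNM : N ≤ M) (s : Stmt) :
    ∀ {Q : Store → Prop} {σ σ' : Store} {t : ℕ}, σ.Bdd M → s.wf t₀ → s.deg ≤ D → σ.reg 0 ≤ N →
      t₀ ≤ t → Agree t₀ σ σ' → s.wp M N K Q σ →
      ∃ υ τ, Runs w (s.compile t) σ' τ (s.cost N K) ∧ Q υ ∧ Agree t₀ υ τ ∧ υ.Bdd M ∧
        υ.reg 0 = σ.reg 0 ∧ ∀ q, t₀ ≤ q → q < t → τ.reg q = σ'.reg q := by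
  have hw : 1 < 2 ^ w := (Nat.one_le_pow _ _ (by omega)).trans_lt hMw
  have hmem : ∀ {d x : ℕ}, 1 ≤ d → d ≤ D → x ≤ M → x < 2 ^ w := fun h1 hd hx =>
    (hx.trans (Nat.le_self_pow (by omega) M)).trans_lt hMw
  induction s with
  | skip =>
    intro Q σ σ' t hσ hs hd hN ht hA h
    exact ⟨σ, σ', ⟨1, by simp [cost], .skip σ'⟩, h, hA, hσ, rfl, fun _ _ _ => rfl⟩
  | assign r e =>
    intro Q σ σ' t hσ hs hd hN ht hA h
    simp only [wf, Bool.and_eq_true, decide_eq_true_eq] at hs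
    simp only [deg] at hd
    obtain ⟨τ, r1, hv, hA1⟩ := e.runs_compile hM hMw hσ hs.2 hd hN ht hA
    refine ⟨_, _, r1.seq (Runs.copy (by omega) ?_), h.2, ⟨fun q hq => ?_, ?_⟩, hσ.setReg r h.1,
      ?_, fun q h1 h2 => ?_⟩
    · rw [hv]
      exact hmem e.one_le_deg hd h.1
    · simp only [Store.setReg_reg, hv, hA1.reg q (by omega), hA.reg q hq]
    · simp [hA1.arr, hA.arr]
    · simp [Ne.symm hs.1.2]
    · simp [show q ≠ r by omega, hA1.reg q h2]
  | put i a b =>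
    intro Q σ σ' t hσ hs hd hN ht hA h
    simp only [wf, Bool.and_eq_true] at hs
    simp only [deg, max_le_iff] at hd
    obtain ⟨τ, r1, hv1, hA1⟩ := a.runs_compile hM hMw hσ hs.1 hd.1 hN ht hA
    obtain ⟨τ', r2, hv2, hA2⟩ := b.runs_compile (t := t + 1) hM hMw hσ hs.2 hd.2 hN (by omega)
      (hA.trans (hA1.mono ht))
    have hv1' : τ'.reg t = a.eval σ := by rw [hA2.reg t (by omega), hv1]
    refine ⟨_, _, (r1.seq (r2.seq ⟨1, le_rfl, .store τ' i t (t + 1)⟩)).mono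
      (by simp only [cost]; omega), h.2, ⟨fun q hq => ?_, ?_⟩, hσ.setArr i _ h.1, rfl,
      fun q h1 h2 => ?_⟩
    · rw [Store.setArr_reg, hA2.reg q (by omega), hA1.reg q (by omega), hA.reg q hq,
        Store.setArr_reg]
    · simp [Store.setArr, hv1', hv2, hA2.arr, hA1.arr, hA.arr]
    · rw [Store.setArr_reg, hA2.reg q (by omega), hA1.reg q h2]
  | seq a b iha ihb =>
    intro Q σ σ' t hσ hs hd hN ht hA h
    simp only [wf, Bool.and_eq_true] at hs
    simp only [deg, max_le_iff] at hd
    obtain ⟨υ, τ, r1, h1, hA1, hB1, h01, hq1⟩ := iha hσ hs.1 hd.1 hN ht hA h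
    obtain ⟨υ', τ', r2, h2, hA2, hB2, h02, hq2⟩ := ihb hB1 hs.2 hd.2 (by omega) ht hA1 h1
    exact ⟨υ', τ', r1.seq r2, h2, hA2, hB2, h02.trans h01,
      fun q h1 h2 => (hq2 q h1 h2).trans (hq1 q h1 h2)⟩
  | ite e a b iha ihb =>
    intro Q σ σ' t hσ hs hd hN ht hA h
    simp only [wf, Bool.and_eq_true] at hs
    simp only [deg, max_le_iff] at hd
    obtain ⟨τ, r1, hv, hA1⟩ := e.runs_compile hM hMw hσ hs.1.1 hd.1 hN ht hA
    have hA' := hA.trans (hA1.mono ht)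
    by_cases h0 : e.eval σ = 0
    · obtain ⟨υ, τ', ⟨S, hS, r2⟩, h1, hA2, hB, h00, hq⟩ := ihb hσ hs.2 hd.2.2 hN ht hA' (h.2 h0)
      refine ⟨υ, τ', (r1.seq ⟨S + 1, le_rfl, .ite_false (by rw [hv, h0]) r2⟩).mono ?_, h1, hA2, hB,
        h00, fun q h1 h2 => (hq q h1 h2).trans (hA1.reg q h2)⟩
      simp only [cost]; omega
    · obtain ⟨υ, τ', ⟨S, hS, r2⟩, h1, hA2, hB, h00, hq⟩ := iha hσ hs.1.2 hd.2.1 hN ht hA' (h.1 h0)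
      refine ⟨υ, τ', (r1.seq ⟨S + 1, le_rfl, .ite_true (by rwa [hv]) r2⟩).mono ?_, h1, hA2, hB,
        h00, fun q h1 h2 => (hq q h1 h2).trans (hA1.reg q h2)⟩
      simp only [cost]; omega
  | loop b r e s ih =>
    intro Q σ σ' t hσ hs hd hN ht hA h
    simp only [wf, Bool.and_eq_true, decide_eq_true_eq] at hs
    simp only [deg, max_le_iff] at hd
    obtain ⟨τ, r1, hv, hA1⟩ := e.runs_compile hM hMw hσ hs.1.2 hd.1 hN ht hA
    have hA' := hA.trans (hA1.mono ht)
    have hbM : cond b K N ≤ M := by cases b <;> assumption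
    -- The shadow store `υ` has the property that the remaining rounds lead to `Q`.
    let Inv : ℕ → Store → Prop := fun i τ' => ∃ υ, Agree t₀ υ τ' ∧ υ.Bdd M ∧
      υ.reg 0 = σ.reg 0 ∧ wpIter (s.wp M N K) r (e.eval σ - i) i Q υ ∧
      ∀ q, t₀ ≤ q → q < t → τ'.reg q = σ'.reg q
    obtain ⟨τ', r2, υ, h1, h2, h3, h4, h5⟩ := runs_iterProg (w := w) (t := t) (r := r)
      (m := e.eval σ) (Tb := s.cost N K) (body := s.compile (t + 3)) (σ := τ) Inv
      (by omega) hv (hmem e.one_le_deg hd.1 (h.1.trans hbM)) hw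
      (fun i τ₁ τ₂ h' ⟨υ, h1, h2, h3, h4, h5⟩ => ⟨υ, h1.trans (h'.mono ht), h2, h3, h4,
        fun q hq1 hq2 => (h'.reg q hq2).trans (h5 q hq1 hq2)⟩)
      ⟨σ, hA', hσ, rfl, by simpa using h.2, fun q _ hq => hA1.reg q hq⟩
      (fun i hi τ₁ ⟨υ, h1, h2, h3, h4, h5⟩ => by
        obtain ⟨k, hk⟩ : ∃ k, e.eval σ - i = k + 1 := ⟨e.eval σ - i - 1, by omega⟩
        rw [hk] at h4
        obtain ⟨υ', τ₂, s1, g1, g2, g3, g4, g5⟩ := ih (t := t + 3) (σ' := τ₁.setReg r i)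
          (h2.setReg r (show i ≤ M by have := h.1; omega)) hs.2 hd.2
          (by simpa [Ne.symm hs.1.1.2, h3] using hN) (by omega)
          ⟨fun q hq => by simp [h1.reg q hq], h1.arr⟩ h4
        refine ⟨τ₂, s1, ⟨υ', g2, g3, by simp [g4, Ne.symm hs.1.1.2, h3], ?_, fun q q1 q2 => ?_⟩,
          fun q q1 q2 => ?_⟩
        · rwa [show e.eval σ - (i + 1) = k by omega]
        · rw [g5 q q1 (by omega)]; simp [show q ≠ r by omega, h5 q q1 q2]
        · rw [g5 q (by omega) q2]; simp [show q ≠ r by omega])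
    rw [Nat.sub_self] at h4
    refine ⟨υ, τ', (r1.seq r2).mono ?_, h4, h1, h2, h3, h5⟩
    have := Nat.mul_le_mul_right (s.cost N K + 6) h.1
    simp only [cost]
    omega

/-- Static bounds for the running time: `coef * N ^ depth` for statements without long loops, and
`coef * K * N ^ depth` in general. -/
def _root_.WordRAM.Expr.coef : Expr → ℕ
  | .var _ => 2
  | .lit _ => 1
  | .bin _ a b => a.coef + b.coef + 1
  | .arr _ e => e.coef + 1
  | .sum _ e => e.coef + 40
  | .sup _ e => e.coef + 40

def _root_.WordRAM.Expr.depth : Expr → ℕ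
  | .var _ => 0
  | .lit _ => 0
  | .bin _ a b => a.depth + b.depth
  | .arr _ e => e.depth
  | .sum _ e => e.depth + 1
  | .sup _ e => e.depth + 1

lemma _root_.WordRAM.Expr.cost_le {N : ℕ} (hN : 1 ≤ N) (e : Expr) :
    e.cost N ≤ e.coef * N ^ e.depth := by
  have hp : ∀ k, 1 ≤ N ^ k := fun k => Nat.one_le_pow _ _ hN
  induction e with
  | var r => simp [Expr.cost, Expr.coef, Expr.depth]
  | lit k => simp [Expr.cost, Expr.coef, Expr.depth]
  | bin o a b iha ihb =>
    simp only [Expr.cost, Expr.coef, Expr.depth]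
    have h1 := Nat.mul_le_mul_left a.coef
      (Nat.pow_le_pow_right hN (Nat.le_add_right a.depth b.depth))
    have h2 := Nat.mul_le_mul_left b.coef
      (Nat.pow_le_pow_right hN (Nat.le_add_left b.depth a.depth))
    have := hp (a.depth + b.depth)
    nlinarith
  | arr i e ih =>
    simp only [Expr.cost, Expr.coef, Expr.depth]
    have := hp e.depth
    nlinarith
  | sum r e ih =>
    simp only [Expr.cost, Expr.coef, Expr.depth, pow_succ]
    have := hp e.depth
    have h1 := Nat.mul_le_mul_left N ih
    nlinarith [Nat.mul_le_mul hN this]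
  | sup r e ih =>
    simp only [Expr.cost, Expr.coef, Expr.depth, pow_succ]
    have := hp e.depth
    have h1 := Nat.mul_le_mul_left N ih
    nlinarith [Nat.mul_le_mul hN this]

def coef : Stmt → ℕ
  | skip => 1
  | assign _ e => e.coef + 2
  | put _ a b => a.coef + b.coef + 1
  | seq a b => a.coef + b.coef
  | ite e a b => e.coef + a.coef + b.coef + 1
  | loop _ _ e s => e.coef + s.coef + 8

def depth : Stmt → ℕ
  | skip => 0
  | assign _ e => e.depth
  | put _ a b => a.depth + b.depth
  | seq a b => a.depth + b.depth
  | ite e a b => e.depth + a.depth + b.depth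
  | loop b _ e s => e.depth + s.depth + cond b 0 1

/-- The nesting depth of long loops. -/
def long : Stmt → ℕ
  | skip => 0
  | assign _ _ => 0
  | put _ _ _ => 0
  | seq a b => max a.long b.long
  | ite _ a b => max a.long b.long
  | loop b _ _ s => s.long + cond b 1 0

/-- `coef`, `depth` and `long` depend on the program text alone, so for a fixed program this is
polynomial in `N`, and linear in `K` when `long` is `1`. -/
lemma cost_le (hN : 1 ≤ N) (hK : 1 ≤ K) (s : Stmt) :
    s.cost N K ≤ s.coef * (K ^ s.long * N ^ s.depth) := by
  have hp : ∀ k l, 1 ≤ K ^ k * N ^ l := fun k l =>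
    Nat.mul_pos (Nat.one_le_pow _ _ hK) (Nat.one_le_pow _ _ hN)
  have hm : ∀ {a b c d : ℕ}, a ≤ b → c ≤ d → K ^ a * N ^ c ≤ K ^ b * N ^ d := fun h h' =>
    Nat.mul_le_mul (Nat.pow_le_pow_right hK h) (Nat.pow_le_pow_right hN h')
  have he : ∀ (e : Expr) (a c : ℕ), e.depth ≤ c → e.cost N ≤ e.coef * (K ^ a * N ^ c) := by
    intro e a c h
    refine (e.cost_le hN).trans (Nat.mul_le_mul_left _ ?_)
    simpa using hm (Nat.zero_le a) h
  induction s with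
  | skip => simp [cost, coef, long, depth]
  | assign r e =>
    simp only [cost, coef, long, depth]
    have := he e 0 e.depth le_rfl
    have := hp 0 e.depth
    nlinarith
  | put i a b =>
    simp only [cost, coef, long, depth]
    have := he a 0 (a.depth + b.depth) (by omega)
    have := he b 0 (a.depth + b.depth) (by omega)
    have := hp 0 (a.depth + b.depth)
    nlinarith
  | seq a b iha ihb =>
    simp only [cost, coef, long, depth]
    have h1 := Nat.mul_le_mul_left a.coef
      (hm (le_max_left a.long b.long) (Nat.le_add_right a.depth b.depth))
    have h2 := Nat.mul_le_mul_left b.coef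
      (hm (le_max_right a.long b.long) (Nat.le_add_left b.depth a.depth))
    rw [add_mul]
    omega
  | ite e a b iha ihb =>
    simp only [cost, coef, long, depth]
    have h0 := he e (max a.long b.long) (e.depth + a.depth + b.depth) (by omega)
    have h1 := Nat.mul_le_mul_left a.coef
      (hm (le_max_left a.long b.long) (show a.depth ≤ e.depth + a.depth + b.depth by omega))
    have h2 := Nat.mul_le_mul_left b.coef
      (hm (le_max_right a.long b.long) (show b.depth ≤ e.depth + a.depth + b.depth by omega))
    have := hp (max a.long b.long) (e.depth + a.depth + b.depth)
    rw [add_mul, add_mul, add_mul]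
    omega
  | loop b r e s ih =>
    simp only [cost, coef, long, depth]
    have h0 := he e (s.long + cond b 1 0) (e.depth + s.depth + cond b 0 1) (by omega)
    have h2 := hp (s.long + cond b 1 0) (e.depth + s.depth + cond b 0 1)
    have h3 := hm (le_refl s.long) (show s.depth ≤ e.depth + s.depth by omega)
    have h1 : cond b K N * (s.cost N K + 6) ≤
        (s.coef + 6) * (K ^ (s.long + cond b 1 0) * N ^ (e.depth + s.depth + cond b 0 1)) := by
      have h4 : s.cost N K + 6 ≤ (s.coef + 6) * (K ^ s.long * N ^ (e.depth + s.depth)) := by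
        have := hp s.long (e.depth + s.depth)
        have := Nat.mul_le_mul_left s.coef h3
        rw [add_mul]
        omega
      refine (Nat.mul_le_mul_left _ h4).trans (le_of_eq ?_)
      cases b <;> simp only [cond_true, cond_false, pow_succ, add_zero] <;> ring
    nlinarith

end Stmt
end WordRAM

/-! ### Protocols from parents and stamps; elementary bounds on the broadcast time -/

namespace Telephone

section
variable {V : Type*} {G : SimpleGraph V} {s : V}

/-- Parents and time stamps for all vertices determine a broadcast protocol. -/
theorem exists_protocol [Finite V] {t : ℕ} (par : V → V) (st : V → ℕ)
    (hs : st s = 0) (hadj : ∀ v ≠ s, G.Adj (par v) v) (hlt : ∀ v ≠ s, st (par v) < st v)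
    (hle : ∀ v, st v ≤ t)
    (hinj : ∀ v w, v ≠ s → w ≠ s → v ≠ w → par v = par w → st v ≠ st w) :
    ∃ B : BroadcastProtocol G s t,
      ∀ u v, IsParent B.tree s u v → par v = u ∧ B.stamp s(u, v) = st v := by
  classical
  -- Stamps decrease towards the source, so the depth `d` can be defined by recursion on `st`. It
  -- will turn out to be the distance from `s` in the tree.
  obtain ⟨d, hd0, hd⟩ : ∃ d : V → ℕ, d s = 0 ∧ ∀ v ≠ s, d v = d (par v) + 1 := by
    let d : V → ℕ := (measure st).wf.fix fun v rec =>
      if h : v = s then 0 else rec (par v) (hlt v h) + 1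
    have hd : ∀ v, d v = if v = s then 0 else d (par v) + 1 := fun v => by
      change (measure st).wf.fix _ v = _
      rw [WellFounded.fix_eq]
      split_ifs <;> rfl
    exact ⟨d, by simp [hd s], fun v hv => by rw [hd v, if_neg hv]⟩
  let T : SimpleGraph V :=
    { Adj := fun u v => (v ≠ s ∧ par v = u) ∨ (u ≠ s ∧ par u = v)
      symm := ⟨fun u v h => h.symm⟩
      loopless := ⟨fun u h => by
        have h' : u ≠ s ∧ par u = u := by tauto
        have := hlt u h'.1
        rw [h'.2] at this
        exact this.false⟩ }
  have hTp : ∀ v ≠ s, T.Adj (par v) v := fun v hv => Or.inl ⟨hv, rfl⟩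
  have hle' : T ≤ G := fun u v h => by
    rcases h with ⟨h, rfl⟩ | ⟨h, rfl⟩
    exacts [hadj _ h, (hadj _ h).symm]
  have hwalk : ∀ k v, d v = k → ∃ p : T.Walk s v, p.length = k := by
    intro k
    induction k with
    | zero =>
      intro v hv
      have : v = s := by
        by_contra h
        have := hd v h
        omega
      subst this
      exact ⟨.nil, rfl⟩
    | succ k ih =>
      intro v hv
      have hvs : v ≠ s := by
        rintro rfl
        omega
      obtain ⟨p, hp⟩ := ih (par v) (by have := hd v hvs; omega)
      exact ⟨p.concat (hTp v hvs), by simp [hp]⟩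
  have hconn : T.Connected := by
    have : ∀ v, T.Reachable s v := fun v => (hwalk _ v rfl).elim fun p _ => ⟨p⟩
    exact { preconnected := fun u v => (this u).symm.trans (this v), nonempty := ⟨s⟩ }
  -- Along an edge `d` grows by at most one; hence `d` is a lower bound for the distance.
  have hlip : ∀ u v (p : T.Walk u v), d v ≤ d u + p.length := by
    intro u v p
    induction p with
    | nil => simp
    | @cons a b c h p ih =>
      have hb : d b ≤ d a + 1 := by
        rcases h with ⟨h, rfl⟩ | ⟨h, rfl⟩
        · exact (hd b h).le
        · have := hd a h; omega
      rw [SimpleGraph.Walk.length_cons]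
      omega
  have hdist : ∀ v, T.dist s v = d v := fun v => by
    refine le_antisymm ?_ ?_
    · obtain ⟨p, hp⟩ := hwalk _ v rfl
      rw [← hp]
      exact SimpleGraph.dist_le p
    · obtain ⟨p, hp⟩ := hconn.exists_walk_length_eq_dist s v
      have := hlip _ _ p
      omega
  have hpar : ∀ u v, IsParent T s u v → v ≠ s ∧ par v = u := by
    rintro u v ⟨h | h, h2⟩
    · exact h
    · have := hd u h.1
      rw [hdist, hdist, ← h.2] at h2
      omega
  have hedge : ∀ e ∈ T.edgeSet, ∃ v, v ≠ s ∧ e = s(par v, v) := by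
    intro e
    induction e using Sym2.ind with
    | h u v =>
      rw [SimpleGraph.mem_edgeSet]
      rintro (⟨h, rfl⟩ | ⟨h, rfl⟩)
      · exact ⟨v, h, rfl⟩
      · exact ⟨u, h, Sym2.eq_swap⟩
  have htree : T.IsTree := by
    -- A connected graph with at most `|V| - 1` edges is a tree; the edges are covered by the
    -- vertices `v ≠ s`, through the edge to the parent.
    refine SimpleGraph.isTree_iff_connected_and_card.2 ⟨hconn, le_antisymm ?_
      hconn.card_vert_le_card_edgeSet_add_one⟩
    have h1 : Nat.card T.edgeSet ≤ Nat.card {v : V // v ≠ s} := by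
      refine Nat.card_le_card_of_surjective
        (fun v : {v : V // v ≠ s} => (⟨s(par v, v), hTp v v.2⟩ : T.edgeSet)) ?_
      rintro ⟨e, he⟩
      obtain ⟨v, hv, rfl⟩ := hedge e he
      exact ⟨⟨v, hv⟩, rfl⟩
    have h2 : Nat.card {v : V // v ≠ s} + 1 = Nat.card V := by
      have := Fintype.ofFinite V
      have := Fintype.card_pos_iff.2 ⟨s⟩
      rw [Nat.card_eq_fintype_card, Nat.card_eq_fintype_card, Fintype.card_subtype_compl]
      simp
      omega
    omega
  let stamp : Sym2 V → ℕ := Sym2.lift ⟨fun u v => max (st u) (st v), fun u v => max_comm _ _⟩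
  have hstamp : ∀ v ≠ s, stamp s(par v, v) = st v := fun v hv => max_eq_right (hlt v hv).le
  refine ⟨⟨T, hle', htree, stamp, ?_, ?_, ?_⟩, fun u v h => ?_⟩
  · intro e he
    obtain ⟨v, hv, rfl⟩ := hedge e he
    rw [hstamp v hv]
    exact ⟨by have := hlt v hv; omega, hle v⟩
  · intro e he f hf hne hv
    obtain ⟨a, ha, rfl⟩ := hedge e he
    obtain ⟨b, hb, rfl⟩ := hedge f hf
    obtain ⟨v, h1, h2⟩ := hv
    have hab : a ≠ b := by rintro rfl; exact hne rfl
    rw [hstamp a ha, hstamp b hb]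
    rw [Sym2.mem_iff] at h1 h2
    have hla := hlt a ha
    have hlb := hlt b hb
    rcases h1 with rfl | rfl <;> rcases h2 with h2 | h2
    · exact hinj a b ha hb hab h2
    · rw [h2] at hla
      omega
    · rw [← h2] at hlb
      omega
    · exact absurd h2 hab
  · intro u v w h h'
    obtain ⟨hv, rfl⟩ := hpar u v h
    rw [hstamp v hv]
    rcases h' with ⟨hw, rfl⟩ | ⟨_, rfl⟩
    · rw [hstamp w hw]
      exact (hlt w hw).le
    · rw [Sym2.eq_swap, hstamp v hv]
  · obtain ⟨hv, rfl⟩ := hpar u v h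
    exact ⟨rfl, hstamp v hv⟩

/-- Each informed vertex informs at most one other per round, so the informed set at most doubles.
-/
lemma CanBroadcast.card_le [Finite V] {t : ℕ} (h : CanBroadcast G s t) : Nat.card V ≤ 2 ^ t := by
  obtain ⟨I, h0, hI, ht⟩ := h
  have key : ∀ i ≤ t, (I i).ncard ≤ 2 ^ i := by
    intro i
    induction i with
    | zero => simp [h0]
    | succ i ih =>
      intro hi
      obtain ⟨hsub, f, hf, hf'⟩ := hI i (by omega)
      have h1 : (I (i + 1) \ I i).ncard ≤ (I i).ncard :=
        Set.ncard_le_ncard_of_injOn f (fun v hv => (hf' v hv).1) hf (Set.toFinite _)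
      have h2 := Set.ncard_sdiff_add_ncard_of_subset hsub (Set.toFinite _)
      have := ih (by omega)
      rw [pow_succ]
      omega
  have := key t le_rfl
  rwa [ht, Set.ncard_univ] at this

lemma exists_adj_of_ne_univ (hG : G.Connected) {I : Set V} (hs : s ∈ I) (hI : I ≠ Set.univ) :
    ∃ u ∈ I, ∃ v ∉ I, G.Adj u v := by
  obtain ⟨v, hv⟩ := (Set.ne_univ_iff_exists_notMem I).1 hI
  obtain ⟨p⟩ := hG.preconnected s v
  obtain ⟨d, _, h1, h2⟩ := p.exists_boundary_dart I hs hv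
  exact ⟨_, h1, _, h2, d.adj⟩

/-- Connectivity always allows one more vertex to be informed. This makes the infimum in
`broadcastTime` attained, and gives `b(G,s) ≤ n`, so that `n` iterations suffice for tracing back.
-/
lemma exists_canBroadcast [Finite V] (hG : G.Connected) (s : V) :
    ∃ t ≤ Nat.card V, CanBroadcast G s t := by
  have key : ∀ k, ∃ I : ℕ → Set V, I 0 = {s} ∧ (∀ i < k, Round G (I i) (I (i + 1))) ∧
      s ∈ I k ∧ (I k = Set.univ ∨ k + 1 ≤ (I k).ncard) := by
    intro k
    induction k with
    | zero => exact ⟨fun _ => {s}, rfl, by simp, rfl, by simp⟩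
    | succ k ih =>
      obtain ⟨I, h0, hI, hsk, hk⟩ := ih
      have main : ∃ J, Round G (I k) J ∧ (J = Set.univ ∨ k + 1 + 1 ≤ J.ncard) := by
        by_cases hu : I k = Set.univ
        · exact ⟨I k, ⟨subset_rfl, id, by simp, by simp⟩, Or.inl hu⟩
        · obtain ⟨u, hu', v, hv, huv⟩ := exists_adj_of_ne_univ hG hsk hu
          refine ⟨insert v (I k), ⟨Set.subset_insert _ _, fun _ => u, ?_, ?_⟩, Or.inr ?_⟩
          · rintro a ⟨ha, ha'⟩ b ⟨hb, hb'⟩ _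
            rw [ha.resolve_right ha', hb.resolve_right hb']
          · rintro a ⟨rfl | ha, ha'⟩
            · exact ⟨hu', huv⟩
            · exact absurd ha ha'
          · rw [Set.ncard_insert_of_notMem hv (Set.toFinite _)]
            have := hk.resolve_left hu
            omega
      obtain ⟨J, hJ, hJ'⟩ := main
      refine ⟨fun i => if i ≤ k then I i else J, by simp [h0], fun i hi => ?_, ?_, ?_⟩
      · rcases (Nat.lt_succ_iff_lt_or_eq.1 hi) with h | rfl
        · simpa [h.le, Nat.succ_le_of_lt h] using hI i h
        · simpa using hJ
      · simpa using hJ.1 hsk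
      · beta_reduce
        rwa [if_neg (by omega)]
  obtain ⟨I, h0, hI, -, hk⟩ := key (Nat.card V)
  refine ⟨_, le_rfl, I, h0, hI, hk.resolve_right fun h => ?_⟩
  have := Set.ncard_le_card (I (Nat.card V))
  omega

lemma canBroadcast_broadcastTime [Finite V] (hG : G.Connected) (s : V) :
    CanBroadcast G s (broadcastTime G s) := by
  obtain ⟨t, -, ht⟩ := exists_canBroadcast hG s
  exact Nat.sInf_mem (s := {t | CanBroadcast G s t}) ⟨t, ht⟩

end
end Telephone

/-! ### Searches and tests as expressions -/

namespace WordRAM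

/-- The last `i < n` with `f i ≠ 0`, plus one; `0` if there is none. -/
def find (n : ℕ) (f : ℕ → ℕ) : ℕ := (Finset.range n).sup fun i => if f i ≠ 0 then i + 1 else 0

lemma find_cases (n : ℕ) (f : ℕ → ℕ) : (find n f = 0 ∧ ∀ i < n, f i = 0) ∨
    ∃ v < n, find n f = v + 1 ∧ f v ≠ 0 ∧ ∀ i < n, f i ≠ 0 → i ≤ v := by
  have hle : ∀ i < n, f i ≠ 0 → i + 1 ≤ find n f := fun i hi h => by
    have := Finset.le_sup (f := fun i => if f i ≠ 0 then i + 1 else 0) (Finset.mem_range.2 hi)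
    rwa [if_pos h] at this
  by_cases h0 : find n f = 0
  · refine Or.inl ⟨h0, fun i hi => ?_⟩
    by_contra h
    have := hle i hi h
    omega
  · right
    have hne : (Finset.range n).Nonempty := by
      by_contra h
      rw [Finset.not_nonempty_iff_eq_empty] at h
      simp [find, h] at h0
    obtain ⟨v, hv, he⟩ := Finset.exists_mem_eq_sup _ hne fun i => if f i ≠ 0 then i + 1 else 0
    change find n f = _ at he
    by_cases hf : f v = 0
    · simp [hf] at he
      exact absurd he h0
    · refine ⟨v, Finset.mem_range.1 hv, by simpa [hf] using he, hf, fun i hi h => ?_⟩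
      have := hle i hi h
      simp [hf] at he
      omega

lemma find_le (n : ℕ) (f : ℕ → ℕ) : find n f ≤ n := by
  rcases find_cases n f with h | ⟨v, hv, h, -⟩ <;> omega

lemma find_ne_zero {n i : ℕ} {f : ℕ → ℕ} (hi : i < n) (h : f i ≠ 0) : find n f ≠ 0 := by
  rcases find_cases n f with h' | ⟨v, hv, h', -⟩
  · exact absurd (h'.2 i hi) h
  · omega

lemma of_find_eq {n v : ℕ} {f : ℕ → ℕ} (h : find n f = v + 1) :
    v < n ∧ f v ≠ 0 ∧ ∀ i < n, f i ≠ 0 → i ≤ v := by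
  rcases find_cases n f with h' | ⟨u, hu, h', h2⟩
  · omega
  · obtain rfl : u = v := by omega
    exact ⟨hu, h2⟩

lemma of_find_ne_zero {n : ℕ} {f : ℕ → ℕ} (h : find n f ≠ 0) :
    ∃ v < n, find n f = v + 1 ∧ f v ≠ 0 := by
  obtain ⟨v, hv⟩ := Nat.exists_eq_succ_of_ne_zero h
  exact ⟨v, (of_find_eq hv).1, hv, (of_find_eq hv).2.1⟩

namespace Expr

instance : Add Expr := ⟨bin .add⟩
instance : Sub Expr := ⟨bin .sub⟩
instance : Mul Expr := ⟨bin .mul⟩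
instance : Div Expr := ⟨bin .div⟩
instance : OfNat Expr 1 := ⟨lit 1⟩
instance : OfNat Expr 2 := ⟨lit 2⟩
instance : OfNat Expr 3 := ⟨lit 3⟩

@[simp] lemma eval_var (r : ℕ) (σ : Store) : (var r).eval σ = σ.reg r := rfl
@[simp] lemma eval_arr (i : ℕ) (e : Expr) (σ : Store) :
    (arr i e).eval σ = σ.arr i (e.eval σ) := rfl
@[simp] lemma eval_sum (r : ℕ) (e : Expr) (σ : Store) :
    (sum r e).eval σ = ∑ i ∈ Finset.range (σ.reg 0), e.eval (σ.setReg r i) := rfl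
lemma eval_sup (r : ℕ) (e : Expr) (σ : Store) :
    (sup r e).eval σ = (Finset.range (σ.reg 0)).sup fun i => e.eval (σ.setReg r i) := rfl
@[simp] lemma eval_add (a b : Expr) (σ : Store) : (a + b).eval σ = a.eval σ + b.eval σ := rfl
@[simp] lemma eval_sub (a b : Expr) (σ : Store) : (a - b).eval σ = a.eval σ - b.eval σ := rfl
@[simp] lemma eval_mul (a b : Expr) (σ : Store) : (a * b).eval σ = a.eval σ * b.eval σ := rfl
@[simp] lemma eval_div (a b : Expr) (σ : Store) : (a / b).eval σ = a.eval σ / b.eval σ := rfl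
@[simp] lemma eval_one (σ : Store) : (1 : Expr).eval σ = 1 := rfl
@[simp] lemma eval_two (σ : Store) : (2 : Expr).eval σ = 2 := rfl
@[simp] lemma eval_three (σ : Store) : (3 : Expr).eval σ = 3 := rfl

/-- `1` if `a ≠ 0`, and `0` otherwise. -/
def pos (a : Expr) : Expr := 1 - (1 - a)

/-- `1` if `a = b`, and `0` otherwise. -/
def eq (a b : Expr) : Expr := 1 - ((a - b) + (b - a))

@[simp] lemma eval_pos (a : Expr) (σ : Store) :
    a.pos.eval σ = if a.eval σ ≠ 0 then 1 else 0 := by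
  simp only [pos, eval_sub, eval_one]
  split_ifs <;> omega

@[simp] lemma eval_eq (a b : Expr) (σ : Store) :
    (a.eq b).eval σ = if a.eval σ = b.eval σ then 1 else 0 := by
  simp only [eq, eval_sub, eval_add, eval_one]
  split_ifs <;> omega

/-- The last value of the bound register `r` for which `e` is not `0`, plus one. -/
def seek (r : ℕ) (e : Expr) : Expr := sup r (e.pos * (var r + 1))

@[simp] lemma eval_seek (r : ℕ) (e : Expr) (σ : Store) :
    (e.seek r).eval σ = WordRAM.find (σ.reg 0) fun i => e.eval (σ.setReg r i) := by
  simp only [seek, eval_sup, eval_var, eval_mul, eval_pos, eval_add, eval_one, WordRAM.find,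
    Store.setReg_reg, if_true]
  congr 1
  ext i
  split_ifs <;> simp

end Expr

/-! ### Ternary words -/

/-- The digit `i` of `x` in base `3`. -/
def dig (x i : ℕ) : ℕ := x / 3 ^ i % 3

/-- Intended reading of a word: digit `2` for a vertex informed before a round, `1` for one informed
in it, `0` for one not yet informed. A set is coded by digits `0` and `2`; a round leads from `low`
to `high`. -/
def enc (n : ℕ) (f : ℕ → ℕ) : ℕ := ∑ i ∈ Finset.range n, f i * 3 ^ i

lemma dig_lt (x i : ℕ) : dig x i < 3 := Nat.mod_lt _ (by norm_num)

lemma enc_succ (n : ℕ) (f : ℕ → ℕ) : enc (n + 1) f = enc n f + f n * 3 ^ n :=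
  Finset.sum_range_succ _ _

lemma enc_congr {n : ℕ} {f g : ℕ → ℕ} (h : ∀ i < n, f i = g i) : enc n f = enc n g :=
  Finset.sum_congr rfl fun i hi => by rw [h i (Finset.mem_range.1 hi)]

lemma enc_mono {n : ℕ} {f g : ℕ → ℕ} (h : ∀ i < n, f i ≤ g i) : enc n f ≤ enc n g :=
  Finset.sum_le_sum fun i hi => Nat.mul_le_mul_right _ (h i (Finset.mem_range.1 hi))

lemma enc_lt_enc {n : ℕ} {f g : ℕ → ℕ} (h : ∀ i < n, f i ≤ g i) {i : ℕ} (hi : i < n)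
    (hlt : f i < g i) : enc n f < enc n g :=
  Finset.sum_lt_sum (fun i hi => Nat.mul_le_mul_right _ (h i (Finset.mem_range.1 hi)))
    ⟨i, Finset.mem_range.2 hi, Nat.mul_lt_mul_of_pos_right hlt (by positivity)⟩

lemma enc_lt {n : ℕ} {f : ℕ → ℕ} (h : ∀ i < n, f i < 3) : enc n f < 3 ^ n := by
  induction n with
  | zero => simp [enc]
  | succ n ih =>
    rw [enc_succ, pow_succ]
    have := ih fun i hi => h i (by omega)
    have := Nat.mul_le_mul_right (3 ^ n) (show f n ≤ 2 by have := h n (by omega); omega)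
    omega

lemma dig_enc {n : ℕ} {f : ℕ → ℕ} (h : ∀ i < n, f i < 3) {i : ℕ} (hi : i < n) :
    dig (enc n f) i = f i := by
  induction n with
  | zero => omega
  | succ n ih =>
    rw [enc_succ, dig]
    rcases Nat.lt_succ_iff_lt_or_eq.1 hi with h' | rfl
    · obtain ⟨k, rfl⟩ : ∃ k, n = i + 1 + k := ⟨n - i - 1, by omega⟩
      have e : f (i + 1 + k) * 3 ^ (i + 1 + k) = 3 ^ i * (3 * (f (i + 1 + k) * 3 ^ k)) := by ring
      rw [e, Nat.add_mul_div_left _ _ (by positivity), Nat.add_mul_mod_self_left]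
      exact ih (fun j hj => h j (by omega)) h'
    · rw [Nat.add_mul_div_right _ _ (by positivity),
        Nat.div_eq_of_lt (enc_lt fun j hj => h j (by omega)), zero_add]
      exact Nat.mod_eq_of_lt (h i (by omega))

lemma enc_dig {n x : ℕ} (hx : x < 3 ^ n) : enc n (dig x) = x := by
  have key : ∀ m, enc m (dig x) = x % 3 ^ m := by
    intro m
    induction m with
    | zero => simp [enc, Nat.mod_one]
    | succ m ih => rw [enc_succ, ih, Nat.mod_pow_succ, dig, mul_comm]
  rw [key, Nat.mod_eq_of_lt hx]

/-- The digits `1`, the newly informed vertices, are erased. -/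
def low (n x : ℕ) : ℕ := enc n fun i => if dig x i = 2 then 2 else 0

/-- The digits `1` are turned into `2`. -/
def high (n x : ℕ) : ℕ := enc n fun i => if dig x i ≠ 0 then 2 else 0

/-- The last digit `1`. -/
def top (n x : ℕ) : ℕ := find n fun i => if dig x i = 1 then 1 else 0

lemma low_lt (n x : ℕ) : low n x < 3 ^ n := enc_lt fun i _ => by split_ifs <;> omega

lemma high_lt (n x : ℕ) : high n x < 3 ^ n := enc_lt fun i _ => by split_ifs <;> omega

lemma dig_low {n i : ℕ} (x : ℕ) (hi : i < n) :
    dig (low n x) i = if dig x i = 2 then 2 else 0 :=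
  dig_enc (fun i _ => by split_ifs <;> omega) hi

lemma dig_high {n i : ℕ} (x : ℕ) (hi : i < n) :
    dig (high n x) i = if dig x i ≠ 0 then 2 else 0 :=
  dig_enc (fun i _ => by split_ifs <;> omega) hi

lemma low_le {n x : ℕ} (hx : x < 3 ^ n) : low n x ≤ x := by
  conv_rhs => rw [← enc_dig hx]
  exact enc_mono fun i _ => by split_ifs <;> omega

lemma of_top_eq {n x v : ℕ} (h : top n x = v + 1) :
    v < n ∧ dig x v = 1 ∧ ∀ i < n, dig x i = 1 → i ≤ v := by
  obtain ⟨h1, h2, h3⟩ := of_find_eq h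
  exact ⟨h1, by simpa using h2, fun i hi hd => h3 i hi (by simp [hd])⟩

lemma of_top_eq_zero {n x : ℕ} (h : top n x = 0) {i : ℕ} (hi : i < n) : dig x i ≠ 1 := fun hd =>
  find_ne_zero (f := fun i => if dig x i = 1 then 1 else 0) hi (by simp [hd]) h

/-- Together with `low_le` this gives `low n x ≤ x < high n x`, which is why increasing order works
for the table of rounds. -/
lemma lt_high {n x : ℕ} (hx : x < 3 ^ n) (h : top n x ≠ 0) : x < high n x := by
  conv_lhs => rw [← enc_dig hx]
  obtain ⟨v, hv⟩ := Nat.exists_eq_succ_of_ne_zero h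
  obtain ⟨h1, h2, -⟩ := of_top_eq hv
  refine enc_lt_enc (fun i _ => ?_) h1 (by simp [h2])
  have := dig_lt x i
  split_ifs <;> omega

/-- The pair of a newly informed vertex `v` and of its sender `u` is removed. -/
def peel (x u v : ℕ) : ℕ := x - 3 ^ v - 2 * 3 ^ u

/-- Erasing two nonzero digits makes the word smaller, so the matching recurrence only looks at
earlier entries. -/
lemma peel_spec {n x u v : ℕ} (hx : x < 3 ^ n) (hu : u < n) (hv : v < n) (hdu : dig x u = 2)
    (hdv : dig x v = 1) : peel x u v < x ∧
      ∀ i < n, dig (peel x u v) i = if i = u ∨ i = v then 0 else dig x i := by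
  have h3 : ∀ i < n, (if i = u ∨ i = v then 0 else dig x i) < 3 := fun i _ => by
    have := dig_lt x i
    split_ifs <;> omega
  have hne : u ≠ v := by rintro rfl; omega
  -- The erased digits are genuine summands of `x`, so the subtractions in `peel` are not truncated.
  have key : x = enc n (fun i => if i = u ∨ i = v then 0 else dig x i) + 3 ^ v + 2 * 3 ^ u := by
    conv_lhs => rw [← enc_dig hx]
    have e : ∀ i ∈ Finset.range n, dig x i * 3 ^ i =
        (if i = u ∨ i = v then 0 else dig x i) * 3 ^ i + (if i = v then 3 ^ v else 0) +
          (if i = u then 2 * 3 ^ u else 0) := by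
      intro i _
      by_cases h1 : i = u
      · subst h1; simp [hdu, hne]
      · by_cases h2 : i = v
        · subst h2; simp [hdv, h1]
        · simp [h1, h2]
    rw [enc, Finset.sum_congr rfl e, Finset.sum_add_distrib, Finset.sum_add_distrib,
      Finset.sum_ite_eq', Finset.sum_ite_eq', if_pos (Finset.mem_range.2 hv),
      if_pos (Finset.mem_range.2 hu), enc]
  have hp : peel x u v = enc n (fun i => if i = u ∨ i = v then 0 else dig x i) := by
    rw [peel]
    omega
  have : 0 < 3 ^ v := by positivity
  refine ⟨by omega, fun i hi => ?_⟩
  rw [hp, dig_enc h3 hi]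

end WordRAM

namespace WordRAM

/-! ### The tables of the exact algorithm -/

section
variable {n s X : ℕ} {a : ℕ → ℕ → Prop} {M D P : ℕ → ℕ}

/-- `M y ≠ 0` means that the digits `1` of `y` can be matched with neighbours of digit `2`; then
`M y` names the partner of the last digit `1`. This is the recurrence for the entry `y`. -/
def MatchEntry (n : ℕ) (a : ℕ → ℕ → Prop) (M : ℕ → ℕ) (y : ℕ) : Prop :=
  (top n y = 0 → M y ≠ 0) ∧ ∀ v, top n y = v + 1 →
    (∀ u < n, dig y u = 2 → a u v → M (peel y u v) ≠ 0 → M y ≠ 0) ∧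
    (M y ≠ 0 → ∃ u < n, M y = u + 1 ∧ dig y u = 2 ∧ a u v ∧ M (peel y u v) ≠ 0)

/-- `D y` is one more than the number of rounds that lead to the set of the digits `2` of `y`, and
`P y` is the last of these rounds, where the rounds with numbers below `X` have been considered. -/
structure TimeTable (n s X : ℕ) (M D P : ℕ → ℕ) : Prop where
  start : D (2 * 3 ^ s) = 1
  -- Keeps the stored numbers within the bound for memory cells.
  le : ∀ y, D y ≤ y + 1
  sound : ∀ y, D y ≠ 0 → (y = 2 * 3 ^ s ∧ D y = 1) ∨
    (P y < X ∧ top n (P y) ≠ 0 ∧ M (P y) ≠ 0 ∧ high n (P y) = y ∧ D (low n (P y)) ≠ 0 ∧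
      D y = D (low n (P y)) + 1)
  complete : ∀ x < X, top n x ≠ 0 → M x ≠ 0 → D (low n x) ≠ 0 →
    D (high n x) ≠ 0 ∧ D (high n x) ≤ D (low n x) + 1

/-- The recurrence for `y` refers to `y` and smaller words only. -/
lemma MatchEntry.congr {y : ℕ} {M' : ℕ → ℕ} (hy : y < 3 ^ n) (h : ∀ z ≤ y, M' z = M z)
    (hM : MatchEntry n a M y) : MatchEntry n a M' y := by
  have hp : ∀ u v, u < n → top n y = v + 1 → dig y u = 2 → M' (peel y u v) = M (peel y u v) :=
    fun u v hu hv hd => h _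
      (peel_spec hy hu (of_top_eq hv).1 hd (of_top_eq hv).2.1).1.le
  rw [MatchEntry, h y le_rfl]
  refine ⟨hM.1, fun v hv => ⟨fun u hu hd ha hm => ?_, fun hm => ?_⟩⟩
  · rw [hp u v hu hv hd] at hm
    exact (hM.2 v hv).1 u hu hd ha hm
  · obtain ⟨u, hu, h1, h2, h3, h4⟩ := (hM.2 v hv).2 hm
    exact ⟨u, hu, h1, h2, h3, by rwa [hp u v hu hv h2]⟩

lemma matchEntry_step (hX : X < 3 ^ n) (hM : ∀ y < X, MatchEntry n a M y) {m : ℕ}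
    (h0 : top n X = 0 → m ≠ 0) (h1 : ∀ v, top n X = v + 1 → ∃ f, m = find n f ∧
      ∀ u < n, f u ≠ 0 ↔ dig X u = 2 ∧ a u v ∧ M (peel X u v) ≠ 0) :
    ∀ y < X + 1, MatchEntry n a (Function.update M X m) y := by
  intro y hy
  rcases Nat.lt_succ_iff_lt_or_eq.1 hy with h | rfl
  · exact (hM y h).congr (h.trans hX) fun z hz => Function.update_of_ne (by omega) _ _
  · have hp : ∀ u v, u < n → top n y = v + 1 → dig y u = 2 →
        Function.update M y m (peel y u v) = M (peel y u v) := fun u v hu hv hd =>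
      Function.update_of_ne
        (peel_spec hX hu (of_top_eq hv).1 hd (of_top_eq hv).2.1).1.ne _ _
    rw [MatchEntry, Function.update_self]
    refine ⟨h0, fun v hv => ?_⟩
    obtain ⟨f, rfl, hf⟩ := h1 v hv
    refine ⟨fun u hu hd ha hm => ?_, fun hm => ?_⟩
    · rw [hp u v hu hv hd] at hm
      exact find_ne_zero hu ((hf u hu).2 ⟨hd, ha, hm⟩)
    · obtain ⟨u, hu, he, hfu⟩ := of_find_ne_zero hm
      obtain ⟨h2, h3, h4⟩ := (hf u hu).1 hfu
      exact ⟨u, hu, he, h2, h3, by rwa [hp u v hu hv h2]⟩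

lemma TimeTable.step_skip (h : TimeTable n s X M D P) {m : ℕ}
    (hC : top n X ≠ 0 → m ≠ 0 → D (low n X) ≠ 0 →
      D (high n X) ≠ 0 ∧ D (high n X) ≤ D (low n X) + 1) :
    TimeTable n s (X + 1) (Function.update M X m) D P where
  start := h.start
  le := h.le
  sound y hy := by
    rcases h.sound y hy with h' | ⟨h1, h2, h3, h4⟩
    · exact Or.inl h'
    · exact Or.inr ⟨by omega, h2, by rwa [Function.update_of_ne h1.ne], h4⟩
  complete x hx h1 h2 h3 := by
    rcases Nat.lt_succ_iff_lt_or_eq.1 hx with h' | rfl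
    · rw [Function.update_of_ne h'.ne] at h2
      exact h.complete x h' h1 h2 h3
    · rw [Function.update_self] at h2
      exact hC h1 h2 h3

lemma TimeTable.step_update (h : TimeTable n s X M D P) (hX : X < 3 ^ n) {m : ℕ}
    (h1 : top n X ≠ 0) (h2 : m ≠ 0) (h3 : D (low n X) ≠ 0)
    (h4 : D (high n X) = 0 ∨ D (low n X) + 1 < D (high n X)) :
    TimeTable n s (X + 1) (Function.update M X m)
      (Function.update D (high n X) (D (low n X) + 1)) (Function.update P (high n X) X) := by
  have hlt := lt_high hX h1
  -- `low n x ≤ x ≤ X < high n X`: the entry written now is not one that has been read for a word up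
  -- to `X`, so the equations in `sound` persist.
  have hlow : ∀ x ≤ X, low n x ≠ high n X := fun x hx => by
    have := low_le (hx.trans_lt hX)
    omega
  refine ⟨?_, fun y => ?_, fun y hy => ?_, fun x hx g1 g2 g3 => ?_⟩
  -- The entry of the source set has value `1` and cannot be improved.
  · have := h.start
    rw [Function.update_of_ne, this]
    intro he
    rw [← he] at h4
    omega
  · rw [Function.update_apply]
    split_ifs with he
    · have := h.le (low n X)
      have := low_le hX
      omega
    · exact h.le y
  · by_cases he : y = high n X
    · subst he
      rw [Function.update_self, Function.update_self, Function.update_self,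
        Function.update_of_ne (hlow X le_rfl)]
      exact Or.inr ⟨by omega, h1, h2, rfl, h3, rfl⟩
    · rw [Function.update_of_ne he] at hy ⊢
      rw [Function.update_of_ne he]
      rcases h.sound y hy with h' | ⟨g1, g2, g3, g4, g5, g6⟩
      · exact Or.inl h'
      · rw [Function.update_of_ne g1.ne, Function.update_of_ne (hlow _ g1.le)]
        exact Or.inr ⟨by omega, g2, g3, g4, g5, g6⟩
  · rw [Function.update_of_ne (hlow x (by omega))] at g3 ⊢
    rcases Nat.lt_succ_iff_lt_or_eq.1 hx with h' | rfl
    · rw [Function.update_of_ne h'.ne] at g2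
      obtain ⟨e1, e2⟩ := h.complete x h' g1 g2 g3
      rw [Function.update_apply]
      split_ifs with he
      · rw [he] at e1 e2
        omega
      · exact ⟨e1, e2⟩
    · rw [Function.update_self]
      omega

/-- Given a matching `g`, remove the last digit `1` and its partner: by injectivity the rest of `g`
still matches the smaller word, and the recurrence lifts the result. -/
lemma ne_zero_of_matching (hM : ∀ y < 3 ^ n, MatchEntry n a M y) (x : ℕ) (hx : x < 3 ^ n)
    (g : ℕ → ℕ) (hg : ∀ i < n, dig x i = 1 → g i < n ∧ dig x (g i) = 2 ∧ a (g i) i)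
    (hinj : ∀ i < n, ∀ j < n, dig x i = 1 → dig x j = 1 → g i = g j → i = j) : M x ≠ 0 := by
  induction x using Nat.strong_induction_on with
  | _ x ih =>
    by_cases h0 : top n x = 0
    · exact (hM x hx).1 h0
    · obtain ⟨v, hv⟩ := Nat.exists_eq_succ_of_ne_zero h0
      obtain ⟨h1, h2, -⟩ := of_top_eq hv
      obtain ⟨h3, h4, h5⟩ := hg v h1 h2
      obtain ⟨hlt, hd⟩ := peel_spec hx h3 h1 h4 h2
      refine ((hM x hx).2 v hv).1 _ h3 h4 h5 (ih _ hlt (hlt.trans hx) ?_ ?_)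
      · intro i hi hi1
        rw [hd i hi] at hi1
        split_ifs at hi1 with hc
        obtain ⟨e1, e2, e3⟩ := hg i hi hi1
        refine ⟨e1, ?_, e3⟩
        rw [hd _ e1, if_neg, e2]
        rintro (h | h)
        · exact hc (Or.inr (hinj i hi v h1 hi1 h2 h))
        · rw [h, h2] at e2
          omega
      · intro i hi j hj hi1 hj1 hij
        rw [hd i hi] at hi1
        rw [hd j hj] at hj1
        split_ifs at hi1 hj1
        exact hinj i hi j hj hi1 hj1 hij

/-- The parents `par v` and stamps `st v` of the vertices `v ∉ I` are final; they are at most `t`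
and at least `k`, and the vertices of `U` are those which send in round `k`. -/
def Done (n : ℕ) (a : ℕ → ℕ → Prop) (t : ℕ) (par st : ℕ → ℕ) (I U : ℕ → Prop) (k : ℕ) : Prop :=
  ∀ v < n, ¬ I v → par v < n ∧ a (par v) v ∧ k ≤ st v ∧ st v ≤ t ∧
    (I (par v) ∨ st (par v) < st v) ∧ (st v = k → U (par v)) ∧
    ∀ w < n, ¬ I w → w ≠ v → par w = par v → st w ≠ st v

/-- Rounds are traced backwards: `I` shrinks from all vertices to the source. Here `v` leaves `I`
with parent `u` and stamp `k`; that `u` is not in `U` keeps the stamps of its children distinct. -/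
lemma Done.insert {t k u v : ℕ} {par st : ℕ → ℕ} {I U I' U' : ℕ → Prop}
    (h : Done n a t par st I U k) (hv : I v) (hvU : ¬ U v) (hu : I u) (huU : ¬ U u)
    (hne : u ≠ v) (hun : u < n) (ha : a u v) (hk : k ≤ t)
    (hI' : ∀ i < n, I' i ↔ I i ∧ i ≠ v) (hU' : ∀ i < n, U' i ↔ U i ∨ i = u) :
    Done n a t (Function.update par v u) (Function.update st v k) I' U' k := by
  intro w hw hIw
  rw [hI' w hw, not_and_or, not_not] at hIw
  by_cases hwv : w = v
  · subst hwv
    simp only [Function.update_self]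
    refine ⟨hun, ha, le_rfl, hk, Or.inl ((hI' u hun).2 ⟨hu, hne⟩),
      fun _ => (hU' u hun).2 (Or.inr rfl), fun x hx hIx hxw hp hs => ?_⟩
    rw [Function.update_of_ne hxw] at hp hs
    rw [hI' x hx] at hIx
    have := (h x hx (by tauto)).2.2.2.2.2.1 hs
    rw [hp] at this
    exact huU this
  · have hIw' : ¬ I w := by tauto
    obtain ⟨h1, h2, h3, h4, h5, h6, h7⟩ := h w hw hIw'
    simp only [Function.update_of_ne hwv]
    refine ⟨h1, h2, h3, h4, ?_, fun hs => (hU' _ h1).2 (Or.inl (h6 hs)),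
      fun x hx hIx hxw hp hs => ?_⟩
    -- A child `w` of `v` has a stamp larger than `k`, because `v` does not send in round `k`.
    · by_cases hpv : par w = v
      · right
        rw [hpv, Function.update_self]
        rcases h3.lt_or_eq with h | h
        · exact h
        · exact absurd (hpv ▸ h6 h.symm) hvU
      · rw [Function.update_of_ne hpv, hI' _ h1]
        tauto
    · by_cases hxv : x = v
      · subst hxv
        rw [Function.update_self] at hp hs
        exact huU (hp ▸ h6 hs.symm)
      · rw [Function.update_of_ne hxv] at hp hs
        rw [hI' x hx] at hIx
        exact h7 x hx (by tauto) hxw hp hs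

/-- All stamps exceed `k`, so nobody has been recorded as a sender of round `k` and `U'` is
arbitrary. -/
lemma Done.next {t k : ℕ} {par st : ℕ → ℕ} {I U I' U' : ℕ → Prop}
    (h : Done n a t par st I U (k + 1)) (hI' : ∀ i < n, I' i ↔ I i) :
    Done n a t par st I' U' k := by
  intro v hv hIv
  rw [hI' v hv] at hIv
  obtain ⟨h1, h2, h3, h4, h5, h6, h7⟩ := h v hv hIv
  refine ⟨h1, h2, by omega, h4, by rwa [hI' _ h1], by omega, fun w hw hIw => ?_⟩
  rw [hI' w hw] at hIw
  exact h7 w hw hIw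

lemma Done.congr {t k : ℕ} {par st : ℕ → ℕ} {I U I' U' : ℕ → Prop}
    (h : Done n a t par st I U k) (hI : ∀ i < n, I' i ↔ I i) (hU : ∀ i < n, U' i ↔ U i) :
    Done n a t par st I' U' k := by
  intro v hv hIv
  rw [hI v hv] at hIv
  obtain ⟨h1, h2, h3, h4, h5, h6, h7⟩ := h v hv hIv
  refine ⟨h1, h2, h3, h4, by rwa [hI _ h1], by rwa [hU _ h1], fun w hw hIw => ?_⟩
  rw [hI w hw] at hIw
  exact h7 w hw hIw

lemma enc_two (n : ℕ) : enc n (fun _ => 2) = 3 ^ n - 1 := by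
  have : enc n (fun _ => 2) + 1 = 3 ^ n := by
    induction n with
    | zero => simp [enc]
    | succ n ih => rw [enc_succ, pow_succ]; omega
  omega

lemma enc_single {s : ℕ} (hs : s < n) : enc n (fun i => if i = s then 2 else 0) = 2 * 3 ^ s := by
  simp [enc, Finset.sum_ite_eq', hs]

open Classical in
/-- The code of a set of vertices. -/
noncomputable def setCode {n : ℕ} (I : Set (Fin n)) : ℕ :=
  enc n fun i => if ∃ h : i < n, ⟨i, h⟩ ∈ I then 2 else 0

-- Optimality of the table: each effective round of a given broadcast is a word that passes the
-- matching test, so `complete` bounds the value of the informed set after it.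
open Telephone in
theorem TimeTable.le_of_canBroadcast {n : ℕ} {G : SimpleGraph (Fin n)} {s : Fin n}
    {M D P : ℕ → ℕ} (ha : ∀ u v : Fin n, G.Adj u v → a u v)
    (hM : ∀ y < 3 ^ n, MatchEntry n a M y) (hD : TimeTable n s (3 ^ n) M D P) {t : ℕ}
    (h : CanBroadcast G s t) : D (3 ^ n - 1) ≠ 0 ∧ D (3 ^ n - 1) ≤ t + 1 := by
  classical
  obtain ⟨I, h0, hI, ht⟩ := h
  have key : ∀ i ≤ t, D (setCode (I i)) ≠ 0 ∧ D (setCode (I i)) ≤ i + 1 := by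
    intro i
    induction i with
    | zero =>
      have : setCode (I 0) = 2 * 3 ^ (s : ℕ) := by
        rw [← enc_single s.2, setCode]
        refine enc_congr fun i hi => ?_
        simp [h0, Fin.ext_iff, hi]
      rw [this, hD.start]
      simp
    | succ i ih =>
      intro hi
      obtain ⟨h1, h2⟩ := ih (by omega)
      obtain ⟨hsub, f, hinj, hf⟩ := hI i (by omega)
      -- Rounds without new vertices have no word in the table; they only weaken the bound.
      by_cases heq : I (i + 1) = I i
      · rw [heq]
        omega
      · let c : ℕ → ℕ := fun j => if ∃ h : j < n, ⟨j, h⟩ ∈ I i then 2 else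
          if ∃ h : j < n, ⟨j, h⟩ ∈ I (i + 1) then 1 else 0
        have hc : ∀ j < n, c j < 3 := fun j _ => by
          simp only [c]
          split_ifs <;> omega
        have hx : enc n c < 3 ^ n := enc_lt hc
        have hlow : low n (enc n c) = setCode (I i) := enc_congr fun j hj => by
          rw [dig_enc hc hj]
          simp only [c]
          split_ifs <;> simp_all
        have hhigh : high n (enc n c) = setCode (I (i + 1)) := enc_congr fun j hj => by
          rw [dig_enc hc hj]
          have : (∃ h : j < n, ⟨j, h⟩ ∈ I i) → ∃ h : j < n, ⟨j, h⟩ ∈ I (i + 1) :=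
            fun ⟨h, h'⟩ => ⟨h, hsub h'⟩
          simp only [c]
          split_ifs <;> simp_all
        have hone : ∀ j (hj : j < n), dig (enc n c) j = 1 ↔ ⟨j, hj⟩ ∈ I (i + 1) \ I i := by
          intro j hj
          rw [dig_enc hc hj]
          simp only [c, hj, exists_true_left, Set.mem_sdiff]
          split_ifs <;> simp_all
        have htop : top n (enc n c) ≠ 0 := fun h => heq <| by
          refine Set.Subset.antisymm (fun v hv => ?_) hsub
          by_contra hv'
          exact of_top_eq_zero h v.2 ((hone v v.2).2 ⟨hv, hv'⟩)
        have hm : M (enc n c) ≠ 0 := by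
          refine ne_zero_of_matching hM _ hx (fun j => if h : j < n then f ⟨j, h⟩ else 0) ?_ ?_
          · intro j hj hj1
            rw [hone j hj] at hj1
            obtain ⟨g1, g2⟩ := hf _ hj1
            simp only [hj, dif_pos]
            refine ⟨(f ⟨j, hj⟩).2, ?_, ha _ ⟨j, hj⟩ g2⟩
            rw [dig_enc hc (f ⟨j, hj⟩).2]
            simp [c, g1]
          · intro j hj k hk hj1 hk1 he
            rw [hone j hj] at hj1
            rw [hone k hk] at hk1
            simp only [hj, hk, dif_pos] at he
            simpa using hinj hj1 hk1 (Fin.ext he)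
        have := hD.complete _ hx htop hm (by rwa [hlow])
        rw [hlow, hhigh] at this
        omega
  have := key t le_rfl
  rwa [ht, show setCode (Set.univ : Set (Fin n)) = 3 ^ n - 1 by
    rw [← enc_two, setCode]
    exact enc_congr fun i hi => by simp [hi]] at this

end
end WordRAM

namespace WordRAM

namespace Stmt
variable {M N K : ℕ} {Q : Store → Prop} {σ : Store}

/-- The value `x` is a separate variable, so that the store is updated with its mathematical
description instead of an unevaluated expression. -/
lemma wp_assign {r x : ℕ} {e : Expr} (hx : e.eval σ = x) (hle : x ≤ M) (h : Q (σ.setReg r x)) :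
    (assign r e).wp M N K Q σ := by
  subst hx
  exact ⟨hle, h⟩

lemma wp_put {i j x : ℕ} {e e' : Expr} (hj : e.eval σ = j) (hx : e'.eval σ = x) (hle : x ≤ M)
    (h : Q (σ.setArr i j x)) : (put i e e').wp M N K Q σ := by
  subst hx hj
  exact ⟨hle, h⟩

lemma wp_seq {a b : Stmt} (h : a.wp M N K (b.wp M N K Q) σ) : (seq a b).wp M N K Q σ := h

lemma wp_ite {a b : Stmt} {x : ℕ} {e : Expr} (hx : e.eval σ = x) (ha : x ≠ 0 → a.wp M N K Q σ)
    (hb : x = 0 → b.wp M N K Q σ) : (ite e a b).wp M N K Q σ := by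
  subst hx
  exact ⟨ha, hb⟩

end Stmt

/-! ### The exact algorithm -/

/-- The adjacency matrix of the graph and the powers of `3` are in their places. -/
structure Env (n : ℕ) (a : ℕ → ℕ → Prop) (σ : Store) : Prop where
  size : σ.reg 0 = n
  adj : ∀ u < n, ∀ v < n, σ.arr 0 (u * n + v) ≠ 0 ↔ a u v
  pow : ∀ i < n, σ.arr 4 i = 3 ^ i

lemma Env.setReg {n : ℕ} {a : ℕ → ℕ → Prop} {σ : Store} (h : Env n a σ) {r x : ℕ} (hr : 0 ≠ r) :
    Env n a (σ.setReg r x) := ⟨by simp [hr, h.size], h.adj, h.pow⟩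

lemma Env.setArr {n : ℕ} {a : ℕ → ℕ → Prop} {σ : Store} (h : Env n a σ) {i j x : ℕ} (h0 : 0 ≠ i)
    (h4 : 4 ≠ i) : Env n a (σ.setArr i j x) :=
  ⟨h.size, by simpa [h0] using h.adj, by simpa [h4] using h.pow⟩

lemma Env.frame {n : ℕ} {a : ℕ → ℕ → Prop} {σ τ : Store} {s : Stmt} (h : Env n a σ)
    (hF : s.Frame σ τ) (hr : 0 ∉ s.regs) (h0 : 0 ∉ s.arrs) (h4 : 4 ∉ s.arrs) : Env n a τ :=
  ⟨by rw [hF.reg 0 hr, h.size], by rw [hF.arr 0 h0]; exact h.adj,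
    by rw [hF.arr 4 h4]; exact h.pow⟩

namespace Expr

/-- Array `4` holds the powers of `3`; in the absence of a remainder instruction, `y % 3` is `y - y
/ 3 * 3`. -/
def dig (x i : Expr) : Expr := x / arr 4 i - x / arr 4 i / 3 * 3

def top (r : ℕ) : Expr := seek 10 ((dig (var r) (var 10)).eq 1)

def low (r : ℕ) : Expr := sum 10 ((dig (var r) (var 10)).eq 2 * 2 * arr 4 (var 10))

def high (r : ℕ) : Expr := sum 10 ((dig (var r) (var 10)).pos * 2 * arr 4 (var 10))

variable {n : ℕ} {a : ℕ → ℕ → Prop} {σ : Store}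

lemma eval_dig {x i : Expr} (h : σ.arr 4 (i.eval σ) = 3 ^ i.eval σ) :
    (dig x i).eval σ = WordRAM.dig (x.eval σ) (i.eval σ) := by
  simp only [dig, WordRAM.dig, eval_sub, eval_div, eval_arr, eval_mul, eval_three, h]
  omega

lemma eval_dig_var (h : Env n a σ) {r i : ℕ} (hr : r ≠ 10) (hi : i < n) :
    (dig (var r) (var 10)).eval (σ.setReg 10 i) = WordRAM.dig (σ.reg r) i := by
  rw [eval_dig (by simpa using h.pow i hi)]
  simp [hr]

lemma eval_dig_eq_two (h : Env n a σ) {r i : ℕ} (hr : r ≠ 10) (hi : i < n) :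
    ((dig (var r) (var 10)).eq 2).eval (σ.setReg 10 i) =
      if WordRAM.dig (σ.reg r) i = 2 then 1 else 0 := by
  rw [eval_eq, eval_dig_var h hr hi]
  rfl

lemma find_congr {f g : ℕ → ℕ} (h : ∀ i < n, f i = g i) :
    WordRAM.find n f = WordRAM.find n g :=
  Finset.sup_congr rfl fun i hi => by rw [h i (Finset.mem_range.1 hi)]

lemma eval_top (h : Env n a σ) {r : ℕ} (hr : r ≠ 10) :
    (top r).eval σ = WordRAM.top n (σ.reg r) := by
  simp only [top, WordRAM.top, eval_seek, h.size]
  exact find_congr fun i hi => by rw [eval_eq, eval_dig_var h hr hi, eval_one]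

lemma eval_low (h : Env n a σ) {r : ℕ} (hr : r ≠ 10) :
    (low r).eval σ = WordRAM.low n (σ.reg r) := by
  simp only [low, WordRAM.low, eval_sum, h.size, enc]
  refine Finset.sum_congr rfl fun i hi => ?_
  rw [Finset.mem_range] at hi
  rw [eval_mul, eval_mul, eval_dig_eq_two h hr hi]
  simp only [eval_two, eval_arr, eval_var, Store.setReg_arr, Store.setReg_reg, if_true, h.pow i hi]
  split_ifs <;> simp

lemma eval_high (h : Env n a σ) {r : ℕ} (hr : r ≠ 10) :
    (high r).eval σ = WordRAM.high n (σ.reg r) := by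
  simp only [high, WordRAM.high, eval_sum, h.size, enc]
  refine Finset.sum_congr rfl fun i hi => ?_
  rw [Finset.mem_range] at hi
  rw [eval_mul, eval_mul, eval_pos, eval_dig_var h hr hi]
  simp only [eval_two, eval_arr, eval_var, Store.setReg_arr, Store.setReg_reg, if_true, h.pow i hi]
  split_ifs <;> simp

/-- The partner of the last digit `1`, plus one. -/
def partner : Expr :=
  seek 10 ((dig (var 9) (var 10)).eq 2 * arr 0 (var 10 * var 0 + (var 14 - 1)) *
    arr 6 (var 9 - arr 4 (var 14 - 1) - 2 * arr 4 (var 10)))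

lemma eval_partner (h : Env n a σ) {v : ℕ} (hv : σ.reg 14 = v + 1) (hvn : v < n) :
    ∃ f, partner.eval σ = WordRAM.find n f ∧ ∀ u < n, f u ≠ 0 ↔
      WordRAM.dig (σ.reg 9) u = 2 ∧ a u v ∧ σ.arr 6 (peel (σ.reg 9) u v) ≠ 0 := by
  refine ⟨_, by rw [partner, eval_seek, h.size], fun u hu => ?_⟩
  rw [eval_mul, eval_mul, eval_dig_eq_two h (by norm_num) hu, ← h.adj u hu v hvn]
  simp [hv, h.pow u hu, h.pow v hvn, h.size, peel]

end Expr

open WordRAM.Expr WordRAM.Stmt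

/-- One entry of the tables. -/
def tableBody : Stmt :=
  .seq (assign 14 (Expr.top 9)) <|
  .seq (ite (var 14) (assign 15 partner) (assign 15 1)) <|
  -- Arrays `6`, `7`, `8` hold the tables `M`, `D`, `P`.
  .seq (put 6 (var 9) (var 15)) <|
  .seq (assign 16 (Expr.low 9)) <|
  .seq (assign 17 (Expr.high 9)) <|
  -- Nonzero exactly if the round informs somebody, can be matched, starts from a reachable set, and
  -- the entry of its target is empty or larger than the new value.
  ite (var 14 * var 15 * arr 7 (var 16) *
      ((1 - arr 7 (var 17)) + (arr 7 (var 17) - (arr 7 (var 16) + 1))))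
    (.seq (put 7 (var 17) (arr 7 (var 16) + 1)) (put 8 (var 17) (var 9))) .skip

/-- Records the sender of the last digit `1` and removes the pair. -/
def peelBody : Stmt :=
  .seq (assign 14 (Expr.top 9)) <|
  ite (var 14)
    (.seq (assign 15 (arr 6 (var 9) - 1)) <|
      .seq (put 2 (var 14 - 1) (var 15)) <|
      .seq (put 3 (var 14 - 1) (var 19)) <|
      assign 9 (var 9 - arr 4 (var 14 - 1) - 2 * arr 4 (var 15)))
    .skip

/-- Traces back one round. -/
def traceBody : Stmt :=
  .seq (assign 19 (arr 7 (var 18) - 1)) <|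
  ite (var 19)
    (.seq (assign 9 (arr 8 (var 18))) <|
      .seq (assign 18 (Expr.low 9)) <|
      loop false 20 (var 0) peelBody)
    .skip

/-- Register `6` holds `3 ^ n`, so `3 ^ n - 1` is the word with all digits `2`, the full vertex set.
The loop over all words is the only long one. Surplus iterations of the last loop do nothing. -/
def exactProg : Stmt :=
  .seq (put 7 (2 * arr 4 (var 1)) 1) <|
  .seq (loop true 9 (var 6) tableBody) <|
  .seq (assign 18 (var 6 - 1)) <|
  loop false 5 (var 0) traceBody

section
variable {n s X Mx K : ℕ} {a : ℕ → ℕ → Prop} {σ : Store}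

lemma wp_tableBody (hE : Env n a σ) (h9 : σ.reg 9 = X) (hX : X < 3 ^ n) (hMx : 3 ^ n + 1 ≤ Mx)
    (hM : ∀ y < X, MatchEntry n a (σ.arr 6) y)
    (hD : TimeTable n s X (σ.arr 6) (σ.arr 7) (σ.arr 8)) :
    tableBody.wp Mx n K (fun τ => (∀ y < X + 1, MatchEntry n a (τ.arr 6) y) ∧
      TimeTable n s (X + 1) (τ.arr 6) (τ.arr 7) (τ.arr 8)) σ := by
  have hn3 : n < 3 ^ n := Nat.lt_pow_self (by norm_num)
  have htop : top n X ≤ n := find_le _ _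
  have hlow := low_lt n X
  have hhigh := high_lt n X
  refine wp_seq (wp_assign (eval_top hE (by norm_num)) (by rw [h9]; omega) ?_)
  rw [h9]
  have hE1 : Env n a (σ.setReg 14 (top n X)) := hE.setReg (by norm_num)
  set σ1 := σ.setReg 14 (top n X) with hσ1
  -- The common rest of the body, for whichever value `m` the branch has found for the matching
  -- entry.
  have main : ∀ m ≤ n + 1, (top n X = 0 → m ≠ 0) → (∀ v, top n X = v + 1 → ∃ f, m = find n f ∧
      ∀ u < n, f u ≠ 0 ↔ dig X u = 2 ∧ a u v ∧ σ.arr 6 (peel X u v) ≠ 0) →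
      (Stmt.seq (put 6 (var 9) (var 15)) <| .seq (assign 16 (Expr.low 9)) <|
        .seq (assign 17 (Expr.high 9)) <| ite (var 14 * var 15 * arr 7 (var 16) *
        ((1 - arr 7 (var 17)) + (arr 7 (var 17) - (arr 7 (var 16) + 1))))
        (.seq (put 7 (var 17) (arr 7 (var 16) + 1)) (put 8 (var 17) (var 9))) .skip).wp Mx n K
        (fun τ => (∀ y < X + 1, MatchEntry n a (τ.arr 6) y) ∧
          TimeTable n s (X + 1) (τ.arr 6) (τ.arr 7) (τ.arr 8)) (σ1.setReg 15 m) := by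
    intro m hm h0 h1
    have hM' := matchEntry_step hX hM h0 h1
    refine wp_seq (wp_put (j := X) (x := m) (by simp [hσ1, h9]) (by simp) (by omega) ?_)
    have hE2 : Env n a ((σ1.setReg 15 m).setArr 6 X m) :=
      (hE1.setReg (by norm_num)).setArr (by norm_num) (by norm_num)
    refine wp_seq (wp_assign (x := low n X)
      (by rw [eval_low hE2 (by norm_num)]; simp [hσ1, h9]) (by omega) ?_)
    refine wp_seq (wp_assign (x := high n X)
      (by rw [eval_high (hE2.setReg (by norm_num)) (by norm_num)]; simp [hσ1, h9]) (by omega) ?_)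
    refine wp_ite (x := top n X * m * σ.arr 7 (low n X) * ((1 - σ.arr 7 (high n X)) +
      (σ.arr 7 (high n X) - (σ.arr 7 (low n X) + 1)))) (by simp [hσ1]) (fun h => ?_) fun h => ?_
    · simp only [mul_ne_zero_iff] at h
      have hle := hD.le (low n X)
      refine wp_seq (wp_put (j := high n X) (x := σ.arr 7 (low n X) + 1) (by simp)
        (by simp [hσ1]) (by omega) ?_)
      refine wp_put (j := high n X) (x := X) (by simp) (by simp [hσ1, h9]) (by omega) ?_
      have := hD.step_update (m := m) hX h.1.1.1 h.1.1.2 h.1.2 (by omega)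
      exact ⟨by simpa [hσ1] using hM', by simpa [hσ1] using this⟩
    · have := hD.step_skip (m := m) fun g1 g2 g3 => by
        simp only [mul_eq_zero, g1, g2, g3, false_or] at h
        omega
      exact ⟨by simpa [hσ1] using hM', by simpa [hσ1] using this⟩
  refine wp_seq (wp_ite (x := top n X) (by simp [hσ1]) (fun h => ?_) fun h => ?_)
  · obtain ⟨v, hv⟩ := Nat.exists_eq_succ_of_ne_zero h
    obtain ⟨f, hf, hf'⟩ := eval_partner hE1 (v := v) (by simp [hσ1, hv]) (of_top_eq hv).1
    have hle := find_le n f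
    refine wp_assign hf (by omega) (main _ (by omega) (fun h' => absurd h' h) fun w hw => ?_)
    obtain rfl : v = w := by omega
    exact ⟨f, rfl, by simpa [hσ1, h9] using hf'⟩
  · exact wp_assign (x := 1) (by simp) (by omega)
      (main 1 (by omega) (fun _ => one_ne_zero) fun v hv => by omega)

/-- The state within a round that is traced back. -/
structure PeelInv (n : ℕ) (a : ℕ → ℕ → Prop) (t c k j : ℕ) (σ : Store) : Prop where
  lt : σ.reg 9 < 3 ^ n
  ne : σ.arr 6 (σ.reg 9) ≠ 0
  -- The last digit `1` is removed each time, so after `j` removals the remaining ones lie below `n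
  -- - j`, and after `n` none is left.
  ones : ∀ i < n, dig (σ.reg 9) i = 1 → i + j < n ∧ dig c i ≠ 2
  twos : ∀ i < n, dig (σ.reg 9) i = 2 → dig c i = 2
  -- `c` codes the set before the round. The senders so far are the members of that set whose digit
  -- `2` has been erased.
  done : Done n a t (σ.arr 2) (σ.arr 3) (fun i => dig c i = 2 ∨ dig (σ.reg 9) i = 1)
    (fun i => dig c i = 2 ∧ dig (σ.reg 9) i ≠ 2) k

lemma wp_peelBody {t c k j : ℕ} (hE : Env n a σ) (h19 : σ.reg 19 = k) (hkt : k ≤ t)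
    (htM : t ≤ Mx) (hMx : 3 ^ n + 1 ≤ Mx) (hM : ∀ y < 3 ^ n, MatchEntry n a (σ.arr 6) y)
    (hI : PeelInv n a t c k j σ) : peelBody.wp Mx n K (PeelInv n a t c k (j + 1)) σ := by
  have hn3 : n < 3 ^ n := Nat.lt_pow_self (by norm_num)
  have htop : top n (σ.reg 9) ≤ n := find_le _ _
  refine wp_seq (wp_assign (eval_top hE (by norm_num)) (by omega) ?_)
  refine wp_ite (x := top n (σ.reg 9)) (by simp) (fun h => ?_) fun h => ?_
  · obtain ⟨v, hv⟩ := Nat.exists_eq_succ_of_ne_zero h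
    obtain ⟨h1, h2, h3⟩ := of_top_eq hv
    obtain ⟨u, hu, he, hd, ha, hne⟩ := ((hM _ hI.lt).2 v hv).2 hI.ne
    obtain ⟨hlt, hdig⟩ := peel_spec hI.lt hu h1 hd h2
    have huv : u ≠ v := by rintro rfl; omega
    have hlt3 := hI.lt
    rw [hv]
    refine wp_seq (wp_assign (x := u) (by simp [he]) (by omega) ?_)
    refine wp_seq (wp_put (j := v) (x := u) (by simp) (by simp) (by omega) ?_)
    refine wp_seq (wp_put (j := v) (x := k) (by simp) (by simp [h19]) (by omega) ?_)
    refine wp_assign (x := peel (σ.reg 9) u v)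
      (by simp [hE.pow u hu, hE.pow v h1, peel]) (by omega) ?_
    constructor
    · simpa using hlt.trans hI.lt
    · simpa using hne
    · simp only [Store.setReg_reg, if_true]
      intro i hi hi1
      rw [hdig i hi] at hi1
      split_ifs at hi1 with hc
      have := h3 i hi hi1
      have := (hI.ones v h1 h2).1
      exact ⟨by omega, (hI.ones i hi hi1).2⟩
    · simp only [Store.setReg_reg, if_true]
      intro i hi hi2
      rw [hdig i hi] at hi2
      split_ifs at hi2 with hc
      exact hI.twos i hi hi2
    · have hcv := (hI.ones v h1 h2).2
      have hcu := hI.twos u hu hd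
      have := hI.done.insert (u := u) (v := v) (Or.inr h2) (by tauto) (Or.inl hcu) (by tauto) huv hu
        ha hkt (I' := fun i => dig c i = 2 ∨ dig (peel (σ.reg 9) u v) i = 1)
        (U' := fun i => dig c i = 2 ∧ dig (peel (σ.reg 9) u v) i ≠ 2)
        (fun i hi => by
          rw [hdig i hi]
          by_cases g1 : i = u
          · subst g1; simp [hcu, huv]
          · by_cases g2 : i = v
            · subst g2; simp [hcv]
            · simp [g1, g2])
        (fun i hi => by
          rw [hdig i hi]
          by_cases g1 : i = u
          · subst g1; simp [hcu]
          · by_cases g2 : i = v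
            · subst g2; simp [hcv, g1]
            · simp [g1, g2])
      simpa using this
  · have h' : ∀ i < n, dig (σ.reg 9) i ≠ 1 := fun i hi => of_top_eq_zero h hi
    exact ⟨by simpa using hI.lt, by simpa using hI.ne,
      fun i hi hi1 => absurd (by simpa using hi1) (h' i hi), by simpa using hI.twos,
      by simpa using hI.done⟩

/-- The state between the rounds that are traced back. -/
structure TraceInv (n s : ℕ) (a : ℕ → ℕ → Prop) (t i : ℕ) (σ : Store) : Prop where
  lt : σ.reg 18 < 3 ^ n
  ne : σ.arr 7 (σ.reg 18) ≠ 0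
  le : σ.arr 7 (σ.reg 18) - 1 ≤ t
  -- Forces the number of rounds still to be traced to be `0` after `n` iterations.
  fuel : σ.arr 7 (σ.reg 18) - 1 ≤ n - i
  done : Done n a t (σ.arr 2) (σ.arr 3) (fun i => dig (σ.reg 18) i = 2) (fun _ => False)
    (σ.arr 7 (σ.reg 18) - 1)

lemma wp_traceBody {t i : ℕ} (hE : Env n a σ) (htM : t ≤ Mx) (hMx : 3 ^ n + 1 ≤ Mx)
    (hM : ∀ y < 3 ^ n, MatchEntry n a (σ.arr 6) y)
    (hD : TimeTable n s (3 ^ n) (σ.arr 6) (σ.arr 7) (σ.arr 8)) (hi : i < n)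
    (hI : TraceInv n s a t i σ) : traceBody.wp Mx n K (TraceInv n s a t (i + 1)) σ := by
  have hle := hI.le
  refine wp_seq (wp_assign (x := σ.arr 7 (σ.reg 18) - 1) (by simp) (by omega) ?_)
  refine wp_ite (x := σ.arr 7 (σ.reg 18) - 1) (by simp) (fun h => ?_) fun h => ?_
  · rcases hD.sound _ hI.ne with h' | ⟨h1, h2, h3, h4, h5, h6⟩
    · omega
    set x := σ.arr 8 (σ.reg 18) with hx
    have hlow := low_lt n x
    refine wp_seq (wp_assign (x := x) (by simp [hx]) (by omega) ?_)
    refine wp_seq (wp_assign (x := low n x)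
      (by rw [eval_low ((hE.setReg (by norm_num)).setReg (by norm_num)) (by norm_num)]; simp)
      (by omega) ?_)
    set k := σ.arr 7 (σ.reg 18) - 1 with hk
    set σ1 := ((σ.setReg 19 k).setReg 9 x).setReg 18 (low n x) with hσ1
    have hE1 : Env n a σ1 :=
      ((hE.setReg (by norm_num)).setReg (by norm_num)).setReg (by norm_num)
    have hs1 : σ1.reg 0 = n := hE1.size
    refine wp_loop (PeelInv n a t (low n x) k) (by simp [hs1]) ⟨?_, ?_, ?_, ?_, ?_⟩ ?_ ?_
    · simpa [hσ1] using h1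
    · simpa [hσ1] using h3
    · intro j hj hd
      simp only [hσ1, Store.setReg_reg] at hd
      simp at hd
      rw [dig_low x hj, hd]
      exact ⟨by omega, by simp⟩
    · intro j hj hd
      simp only [hσ1, Store.setReg_reg] at hd
      simp at hd
      rw [dig_low x hj, hd]
      simp
    · simp only [hσ1, Store.setReg_reg, Store.setReg_arr]
      refine hI.done.congr (fun j hj => ?_) fun j hj => ?_
      · have := dig_lt x j
        rw [← h4, dig_high x hj, dig_low x hj]
        simp
        constructor <;> intro <;> omega
      · rw [dig_low x hj]
        simp
    · intro j hj τ hF hP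
      refine wp_peelBody (hE1.frame hF (by decide) (by decide) (by decide) |>.setReg (by norm_num))
        (by simp [hF.reg 19 (by decide), hσ1]) hle htM hMx ?_
        ⟨by simpa using hP.lt, by simpa using hP.ne, by simpa using hP.ones,
          by simpa using hP.twos, by simpa using hP.done⟩
      simpa [hF.arr 6 (by decide), hσ1] using hM
    · intro τ hF hP
      have e18 : τ.reg 18 = low n x := by simp [hF.reg 18 (by decide), hσ1]
      have e7 : τ.arr 7 = σ.arr 7 := by simp [hF.arr 7 (by decide), hσ1]
      have ek : k = σ.arr 7 (low n x) - 1 + 1 := by omega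
      have hfuel := hI.fuel
      simp only [eval_var, hs1] at hP
      constructor
      · rwa [e18]
      · rwa [e18, e7]
      · rw [e18, e7]
        omega
      · rw [e18, e7]
        omega
      · rw [e18, e7]
        have := hP.done
        rw [ek] at this
        refine this.next fun j hj => ?_
        constructor
        · exact Or.inl
        · rintro (h | h)
          · exact h
          · have := (hP.ones j hj h).1
            omega
  · constructor
    · simpa using hI.lt
    · simpa using hI.ne
    · simpa using hI.le
    · simp
      omega
    · simpa using hI.done

theorem wp_exactProg {t : ℕ} {Q : Store → Prop} (hE : Env n a σ) (h1 : σ.reg 1 = s) (hs : s < n)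
    (h6 : σ.reg 6 = 3 ^ n) (h7 : ∀ j, σ.arr 7 j = 0) (hMx : 3 ^ n + 1 ≤ Mx) (htn : t ≤ n)
    (ht : ∀ M D P, (∀ y < 3 ^ n, MatchEntry n a M y) → TimeTable n s (3 ^ n) M D P →
      D (3 ^ n - 1) ≠ 0 ∧ D (3 ^ n - 1) ≤ t + 1)
    (hQ : ∀ τ : Store, Done n a t (τ.arr 2) (τ.arr 3) (fun i => i = s) (fun _ => False) 0 → Q τ) :
    exactProg.wp Mx n (3 ^ n) Q σ := by
  have hn3 : n < 3 ^ n := Nat.lt_pow_self (by norm_num)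
  refine wp_seq (wp_put (j := 2 * 3 ^ s) (x := 1) (by simp [h1, hE.pow s hs]) (by simp)
    (by omega) ?_)
  set σ1 := σ.setArr 7 (2 * 3 ^ s) 1 with hσ1
  have hE1 : Env n a σ1 := hE.setArr (by norm_num) (by norm_num)
  have h6' : σ1.reg 6 = 3 ^ n := h6
  refine wp_seq (wp_loop (fun X τ => (∀ y < X, MatchEntry n a (τ.arr 6) y) ∧
      TimeTable n s X (τ.arr 6) (τ.arr 7) (τ.arr 8)) (by simp [h6']) ⟨by simp, ?_⟩ ?_ ?_)
  · have e : σ1.arr 7 = Function.update (σ.arr 7) (2 * 3 ^ s) 1 := by simp [hσ1]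
    constructor
    · simp [e]
    · intro y
      rw [e, Function.update_apply, h7]
      split_ifs <;> omega
    · intro y hy
      rw [e, Function.update_apply, h7] at hy
      left
      split_ifs at hy with hc
      · subst hc
        simp [e]
      · omega
    · intro x hx
      omega
  · intro X hX τ hF hI
    simp only [eval_var, h6'] at hX
    exact wp_tableBody ((hE1.frame hF (by decide) (by decide) (by decide)).setReg (by norm_num))
      (by simp) hX hMx hI.1 hI.2
  · rintro τ hF ⟨hM, hD⟩
    simp only [eval_var, h6'] at hM hD
    have hE2 := hE1.frame hF (by decide) (by decide) (by decide)
    have e6 : τ.reg 6 = 3 ^ n := by rw [hF.reg 6 (by decide), h6']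
    refine wp_seq (wp_assign (x := 3 ^ n - 1) (by simp [e6]) (by omega) ?_)
    obtain ⟨g1, g2⟩ := ht _ _ _ hM hD
    have hs2 : (τ.setReg 18 (3 ^ n - 1)).reg 0 = n := (hE2.setReg (by norm_num)).size
    refine wp_loop (TraceInv n s a t) (by rw [eval_var, hs2]; rfl) ?_ ?_ ?_
    · constructor
      · simp
      · simpa using g1
      · simp
        omega
      · simp
        omega
      · intro v hv hIv
        refine absurd ?_ hIv
        simp only [Store.setReg_reg, if_true]
        rw [← enc_two, dig_enc (fun _ _ => by norm_num) hv]
    · intro i hi υ hF' hI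
      have e7 := hF'.arr 7 (by decide)
      have e8 := hF'.arr 8 (by decide)
      have e6 := hF'.arr 6 (by decide)
      simp only [eval_var, hs2] at hi
      refine wp_traceBody
        (((hE2.setReg (by norm_num)).frame hF' (by decide) (by decide) (by decide)).setReg
        (by norm_num)) (by omega) hMx ?_ ?_ hi
        ⟨by simpa using hI.lt, by simpa using hI.ne, by simpa using hI.le,
          by simpa using hI.fuel, by simpa using hI.done⟩
      · simpa [e6] using hM
      · simpa [e6, e7, e8] using hD
    · intro υ hF' hI
      simp only [eval_var, hs2] at hI
      have e7 := hF'.arr 7 (by decide)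
      have e8 := hF'.arr 8 (by decide)
      have e6 := hF'.arr 6 (by decide)
      simp only [Store.setReg_arr] at e6 e7 e8
      have hfuel := hI.fuel
      have hne := hI.ne
      rw [e7] at hfuel hne
      -- The value is now `1`, whereas a set with a predecessor has value at least `2`; so the set
      -- reached is that of the source.
      rcases hD.sound _ hne with ⟨h', -⟩ | h'
      · refine hQ υ ?_
        have hdone := hI.done
        rw [show υ.arr 7 (υ.reg 18) - 1 = 0 by rw [e7]; omega] at hdone
        refine hdone.congr (fun j hj => ?_) fun _ _ => Iff.rfl
        rw [h', ← enc_single hs, dig_enc (fun i _ => by split_ifs <;> omega) hj]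
        split_ifs <;> simp_all
      · omega

end
end WordRAM

namespace WordRAM

/-! ### The approximation algorithm -/

section
variable {n s t T : ℕ} {a : ℕ → ℕ → Prop} {par st inf C : ℕ → ℕ}

/-- The vertices with `inf v ≠ 0` are informed before the round `T`, one at a time. -/
structure Partial (n s : ℕ) (a : ℕ → ℕ → Prop) (par st inf : ℕ → ℕ) (T : ℕ) : Prop where
  src : inf s ≠ 0
  st_src : st s = 0
  par : ∀ v < n, inf v ≠ 0 → v ≠ s →
    par v < n ∧ a (par v) v ∧ inf (par v) ≠ 0 ∧ st (par v) < st v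
  lt : ∀ v < n, inf v ≠ 0 → st v < T
  inj : ∀ v < n, ∀ w < n, inf v ≠ 0 → inf w ≠ 0 → v ≠ w → st v ≠ st w

lemma Partial.inform (h : Partial n s a par st inf T) {u v : ℕ} (hun : u < n) (hu : inf u ≠ 0)
    (hv : inf v = 0) (ha : a u v) :
    Partial n s a (Function.update par v u) (Function.update st v T) (Function.update inf v 1)
      (T + 1) := by
  have hs : s ≠ v := by rintro rfl; exact h.src hv
  have huv : u ≠ v := by rintro rfl; exact hu hv
  constructor
  · rw [Function.update_of_ne hs]
    exact h.src
  · rw [Function.update_of_ne hs]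
    exact h.st_src
  · intro w hw hiw hws
    by_cases hwv : w = v
    · subst hwv
      simp only [Function.update_self, Function.update_of_ne huv]
      exact ⟨hun, ha, hu, h.lt u hun hu⟩
    · simp only [Function.update_of_ne hwv] at hiw ⊢
      obtain ⟨h1, h2, h3, h4⟩ := h.par w hw hiw hws
      have : par w ≠ v := by intro he; rw [he] at h3; exact h3 hv
      simp only [Function.update_of_ne this]
      exact ⟨h1, h2, h3, h4⟩
  · intro w hw hiw
    by_cases hwv : w = v
    · subst hwv
      simp
    · simp only [Function.update_of_ne hwv] at hiw ⊢
      have := h.lt w hw hiw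
      omega
  · intro w hw x hx hiw hix hne
    by_cases hwv : w = v
    · subst hwv
      rw [Function.update_of_ne hne.symm] at hix ⊢
      rw [Function.update_self]
      exact (h.lt x hx hix).ne'
    · rw [Function.update_of_ne hwv] at hiw ⊢
      by_cases hxv : x = v
      · subst hxv
        rw [Function.update_self]
        exact (h.lt w hw hiw).ne
      · rw [Function.update_of_ne hxv] at hix ⊢
        exact h.inj w hw x hx hiw hix hne

/-- The classes that contain informed vertices. -/
def covered (n : ℕ) (C inf : ℕ → ℕ) : Finset ℕ :=
  ((Finset.range n).filter fun w => inf w ≠ 0).image C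

lemma mem_covered {c : ℕ} : c ∈ covered n C inf ↔ ∃ w < n, C w = c ∧ inf w ≠ 0 := by
  simp only [covered, Finset.mem_image, Finset.mem_filter, Finset.mem_range]
  tauto

lemma covered_update {v : ℕ} (hv : v < n) :
    covered n C (Function.update inf v 1) = insert (C v) (covered n C inf) := by
  ext c
  rw [Finset.mem_insert, mem_covered, mem_covered]
  constructor
  · rintro ⟨w, hw, h1, h2⟩
    by_cases hwv : w = v
    · subst hwv
      exact Or.inl h1.symm
    · rw [Function.update_of_ne hwv] at h2
      exact Or.inr ⟨w, hw, h1, h2⟩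
  · rintro (rfl | ⟨w, hw, h1, h2⟩)
    · exact ⟨v, hv, rfl, by simp⟩
    · refine ⟨w, hw, h1, ?_⟩
      rw [Function.update_apply]
      split_ifs <;> simp [h2]

lemma covered_card_le : (covered n C inf).card ≤ n :=
  Finset.card_image_le.trans ((Finset.card_filter_le _ _).trans (by simp))

/-- The position of `v` in `A`, starting with `1`. -/
def rankIn (A : Finset ℕ) (v : ℕ) : ℕ := (A.filter (· ≤ v)).card

lemma rankIn_pos {A : Finset ℕ} {v : ℕ} (hv : v ∈ A) : 1 ≤ rankIn A v :=
  Finset.card_pos.2 ⟨v, by simp [hv]⟩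

lemma rankIn_le (A : Finset ℕ) (v : ℕ) : rankIn A v ≤ A.card := Finset.card_filter_le _ _

lemma rankIn_lt {A : Finset ℕ} {v w : ℕ} (hw : w ∈ A) (h : v < w) : rankIn A v < rankIn A w := by
  refine Finset.card_lt_card ((Finset.ssubset_iff_of_subset ?_).2 ⟨w, by simp [hw], by simp [h]⟩)
  intro x
  simp only [Finset.mem_filter]
  exact fun hx => ⟨hx.1, by omega⟩

lemma rankIn_injOn (A : Finset ℕ) : Set.InjOn (rankIn A) A := by
  intro v hv w hw h
  rcases lt_trichotomy v w with h' | h' | h'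
  · exact absurd h (rankIn_lt hw h').ne
  · exact h'
  · exact absurd h (rankIn_lt hv h').ne'

lemma exists_rankIn_eq {A : Finset ℕ} {q : ℕ} (h1 : 1 ≤ q) (h2 : q ≤ A.card) :
    ∃ w ∈ A, rankIn A w = q := by
  have : A.image (rankIn A) = Finset.Icc 1 A.card := by
    refine Finset.eq_of_subset_of_card_le (fun x hx => ?_) ?_
    · obtain ⟨w, hw, rfl⟩ := Finset.mem_image.1 hx
      exact Finset.mem_Icc.2 ⟨rankIn_pos hw, rankIn_le A w⟩
    · rw [Finset.card_image_of_injOn (rankIn_injOn A)]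
      simp
  have hq : q ∈ A.image (rankIn A) := by rw [this]; exact Finset.mem_Icc.2 ⟨h1, h2⟩
  simpa using hq

/-- The uninformed vertices of a class. -/
def pending (n : ℕ) (C inf : ℕ → ℕ) (c : ℕ) : Finset ℕ :=
  (Finset.range n).filter fun w => C w = c ∧ inf w = 0

lemma mem_pending {c w : ℕ} : w ∈ pending n C inf c ↔ w < n ∧ C w = c ∧ inf w = 0 := by
  simp [pending]

lemma pending_card_lt {c : ℕ} (h : c ∈ covered n C inf) : (pending n C inf c).card < n := by
  obtain ⟨w, hw, h1, h2⟩ := mem_covered.1 h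
  conv_rhs => rw [← Finset.card_range n]
  refine Finset.card_lt_card ((Finset.ssubset_iff_of_subset (Finset.filter_subset _ _)).2
    ⟨w, by simpa using hw, by simp [h2]⟩)

/-- The parent `u` and the stamp `x` of the pending vertex `v`, when each class is informed by
doubling from the round `T` on. -/
def Doubling (n : ℕ) (C inf : ℕ → ℕ) (T v u x : ℕ) : Prop :=
  ∃ l q, rankIn (pending n C inf (C v)) v = 2 ^ l + q ∧ q < 2 ^ l ∧ x = T + l ∧ u < n ∧ C u = C v ∧
    ((q = 0 ∧ inf u ≠ 0) ∨ (q ≠ 0 ∧ inf u = 0 ∧ rankIn (pending n C inf (C v)) u = q))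

/-- Number the pending vertices of a class `1, 2, …`. The vertex with rank `2 ^ l + q`, `q < 2 ^ l`,
hears in round `T + l` from the one with rank `q`, or from an informed vertex if `q = 0`. Edges
exist because classes are cliques. -/
lemma Partial.done {L : ℕ} {par' st' : ℕ → ℕ} (h : Partial n s a par st inf T) (hs : s < n)
    (hC : ∀ u < n, ∀ v < n, C u = C v → u ≠ v → a u v)
    (hcov : ∀ v < n, C v ∈ covered n C inf) (hL : n ≤ 2 ^ L) (ht : T + L ≤ t + 1)
    (hold : ∀ v < n, inf v ≠ 0 → par' v = par v ∧ st' v = st v)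
    (hnew : ∀ v < n, inf v = 0 → Doubling n C inf T v (par' v) (st' v)) :
    Done n a t par' st' (fun i => i = s) (fun _ => False) 0 := by
  have hT : 1 ≤ T := by
    have := h.lt s hs h.src
    omega
  -- A covered class has an informed vertex, so ranks are below `n ≤ 2 ^ L`.
  have hlog : ∀ {l q v : ℕ}, v < n → rankIn (pending n C inf (C v)) v = 2 ^ l + q → l < L := by
    intro l q v hv hr
    have h1 := rankIn_le (pending n C inf (C v)) v
    have h2 := pending_card_lt (hcov v hv)
    exact (Nat.pow_lt_pow_iff_right (a := 2) (by norm_num)).1 (by omega)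
  have hge : ∀ v < n, inf v = 0 → T ≤ st' v := by
    intro v hv hi
    obtain ⟨l, q, -, -, hx, -⟩ := hnew v hv hi
    omega
  intro v hv hvs
  by_cases hi : inf v = 0
  · obtain ⟨l, q, hr, hq, hx, hu, hCu, hu'⟩ := hnew v hv hi
    have hl := hlog hv hr
    have huv : par' v ≠ v := by
      intro he
      rw [he] at hu'
      rcases hu' with h1 | h1
      · exact h1.2 hi
      · have : 0 < 2 ^ l := by positivity
        omega
    refine ⟨hu, hC _ hu _ hv hCu huv, by omega, by omega, Or.inr ?_, by omega,
      fun w hw hws hwv hp hst => ?_⟩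
    · rcases hu' with ⟨-, h1⟩ | ⟨hq0, h1, h2⟩
      · have := h.lt _ hu h1
        rw [(hold _ hu h1).2]
        omega
      · obtain ⟨l', q', hr', -, hx', -⟩ := hnew _ hu h1
        rw [hCu, h2] at hr'
        -- The parent has rank `q`, and `2 ^ l' ≤ q < 2 ^ l`.
        have : l' < l := (Nat.pow_lt_pow_iff_right (a := 2) (by norm_num)).1 (by omega)
        omega
    · by_cases hiw : inf w = 0
      · obtain ⟨l', q', hr', hq', hx', hu2, hCu', hu2'⟩ := hnew w hw hiw
        rw [hp] at hu2' hCu'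
        have hCC : C w = C v := by rw [← hCu', hCu]
        have hll : l' = l := by omega
        subst hll
        rw [hCC] at hr' hu2'
        -- Siblings with equal stamps lie in the same class and have equal `l`; the parent
        -- determines `q`, so their ranks coincide.
        refine hwv (rankIn_injOn (pending n C inf (C v)) (mem_pending.2 ⟨hw, hCC, hiw⟩)
          (mem_pending.2 ⟨hv, rfl, hi⟩) ?_)
        rw [hr', hr]
        rcases hu' with ⟨g1, g2⟩ | ⟨g1, g2, g3⟩ <;> rcases hu2' with ⟨k1, k2⟩ | ⟨k1, k2, k3⟩ <;> omega
      · have := h.lt w hw hiw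
        have := (hold w hw hiw).2
        omega
  · obtain ⟨h1, h2, h3, h4⟩ := h.par v hv hi hvs
    have hlt := h.lt v hv hi
    obtain ⟨e1, e2⟩ := hold v hv hi
    have hL1 : 1 ≤ L := by
      by_contra hL0
      have : L = 0 := by omega
      subst this
      omega
    rw [e1, e2, (hold _ h1 h3).2]
    refine ⟨h1, h2, by omega, by omega, Or.inr h4, by omega, fun w hw hws hwv hp hst => ?_⟩
    by_cases hiw : inf w = 0
    · have := hge w hw hiw
      omega
    · rw [(hold w hw hiw).2] at hst
      exact h.inj w hw v hv hiw hi hwv hst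

end
end WordRAM

namespace WordRAM

namespace Expr

/-- An informed vertex in the class of the vertex in the register `r`, plus one. -/
def informant (r : ℕ) : Expr := seek 12 ((arr 9 (var 12)).eq (arr 9 (var r)) * arr 10 (var 12))

/-- Tests for an edge from the vertex in the register `r`, with a covered class, to the vertex in
the register `11`, with a class that is not covered. -/
def leaving (r : ℕ) : Expr :=
  arr 0 (var r * var 0 + var 11) * informant r * (1 - informant 11)

/-- The rank of the vertex in the register `5` among the uninformed vertices of its class. -/
def rank : Expr :=
  sum 12 ((1 - (var 12 - var 5)) * (arr 9 (var 12)).eq (arr 9 (var 5)) * (1 - arr 10 (var 12)))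

/-- The uninformed vertex in the class of the vertex in the register `5` whose rank is in the
register `23`, plus one. -/
def ofRank : Expr :=
  seek 12 ((arr 9 (var 12)).eq (arr 9 (var 5)) * (1 - arr 10 (var 12)) *
    (arr 11 (var 12)).eq (var 23))

variable {n : ℕ} {a : ℕ → ℕ → Prop} {σ : Store}

lemma informant_ne_zero (h0 : σ.reg 0 = n) {r : ℕ} (hr : r ≠ 12) :
    (informant r).eval σ ≠ 0 ↔ σ.arr 9 (σ.reg r) ∈ covered n (σ.arr 9) (σ.arr 10) := by
  rw [mem_covered, informant, eval_seek, h0]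
  constructor
  · intro h
    obtain ⟨w, hw, -, h⟩ := of_find_ne_zero h
    rw [eval_mul, eval_eq] at h
    simp [hr] at h
    exact ⟨w, hw, h⟩
  · rintro ⟨w, hw, h1, h2⟩
    refine find_ne_zero hw ?_
    rw [eval_mul, eval_eq]
    simp [hr, h1, h2]

lemma exists_informant (h0 : σ.reg 0 = n) {r : ℕ} (hr : r ≠ 12)
    (h : σ.arr 9 (σ.reg r) ∈ covered n (σ.arr 9) (σ.arr 10)) : ∃ w < n,
      (informant r).eval σ = w + 1 ∧ σ.arr 9 w = σ.arr 9 (σ.reg r) ∧ σ.arr 10 w ≠ 0 := by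
  have h := (informant_ne_zero h0 hr).2 h
  rw [informant, eval_seek, h0] at h ⊢
  obtain ⟨w, hw, he, h⟩ := of_find_ne_zero h
  rw [eval_mul, eval_eq] at h
  simp [hr] at h
  exact ⟨w, hw, he, h⟩

lemma leaving_ne_zero (hE : Env n a σ) {r : ℕ} (hr : r ≠ 12) (hu : σ.reg r < n)
    (hv : σ.reg 11 < n) : (leaving r).eval σ ≠ 0 ↔ a (σ.reg r) (σ.reg 11) ∧
      σ.arr 9 (σ.reg r) ∈ covered n (σ.arr 9) (σ.arr 10) ∧
      σ.arr 9 (σ.reg 11) ∉ covered n (σ.arr 9) (σ.arr 10) := by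
  have e : ∀ x : ℕ, 1 - x ≠ 0 ↔ ¬ x ≠ 0 := fun x => by omega
  rw [leaving, eval_mul, eval_mul, eval_sub, eval_one, mul_ne_zero_iff, mul_ne_zero_iff,
    e, informant_ne_zero hE.size hr, informant_ne_zero hE.size (by norm_num), eval_arr, eval_add,
    eval_mul, eval_var, eval_var, eval_var, hE.size, hE.adj _ hu _ hv, and_assoc]

lemma eval_rank (h0 : σ.reg 0 = n) :
    rank.eval σ = rankIn (pending n (σ.arr 9) (σ.arr 10) (σ.arr 9 (σ.reg 5))) (σ.reg 5) := by
  rw [rank, eval_sum, h0, rankIn, pending, Finset.filter_filter, Finset.card_filter]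
  refine Finset.sum_congr rfl fun w _ => ?_
  rw [eval_mul, eval_mul, eval_eq]
  simp
  split_ifs <;> simp_all
  all_goals omega

lemma exists_ofRank (h0 : σ.reg 0 = n) (h : ∃ w < n, σ.arr 9 w = σ.arr 9 (σ.reg 5) ∧
    σ.arr 10 w = 0 ∧ σ.arr 11 w = σ.reg 23) : ∃ w < n, ofRank.eval σ = w + 1 ∧
      σ.arr 9 w = σ.arr 9 (σ.reg 5) ∧ σ.arr 10 w = 0 ∧ σ.arr 11 w = σ.reg 23 := by
  have key : ∀ w, ((arr 9 (var 12)).eq (arr 9 (var 5)) * (1 - arr 10 (var 12)) *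
      (arr 11 (var 12)).eq (var 23)).eval (σ.setReg 12 w) ≠ 0 ↔
      σ.arr 9 w = σ.arr 9 (σ.reg 5) ∧ σ.arr 10 w = 0 ∧ σ.arr 11 w = σ.reg 23 := by
    intro w
    have e : ∀ x : ℕ, 1 - x ≠ 0 ↔ x = 0 := fun x => by omega
    rw [eval_mul, eval_mul, eval_eq, eval_eq, eval_sub, eval_one, mul_ne_zero_iff,
      mul_ne_zero_iff, e]
    simp [and_assoc]
  obtain ⟨w, hw, h⟩ := h
  obtain ⟨v, hv, he, h'⟩ := of_find_ne_zero (find_ne_zero (f := fun w => ((arr 9 (var 12)).eq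
    (arr 9 (var 5)) * (1 - arr 10 (var 12)) * (arr 11 (var 12)).eq (var 23)).eval
    (σ.setReg 12 w)) hw ((key w).2 h))
  refine ⟨v, hv, ?_, (key v).1 h'⟩
  rw [ofRank, eval_seek, h0, he]

end Expr

open WordRAM.Expr WordRAM.Stmt

/-- The vertex in the register `v` is informed by the one in the register `u`. -/
def inform (v u : ℕ) : Stmt :=
  .seq (put 2 (var v) (var u)) <|
  .seq (put 3 (var v) (var 21)) <|
  .seq (put 10 (var v) 1) <|
  assign 21 (var 21 + 1)

/-- Covers one more class. -/
def growBody : Stmt :=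
  .seq (assign 22 (seek 10 (seek 11 (leaving 10)))) <|
  ite (var 22)
    (.seq (assign 22 (var 22 - 1)) <|
      .seq (assign 23 (seek 11 (leaving 22) - 1)) <|
      -- The tail of the edge lies in a covered class but may itself be uninformed; then a member of
      -- its clique informs it first. This makes two rounds per new class.
      .seq (ite (arr 10 (var 22)) .skip (.seq (assign 24 (informant 22 - 1)) (inform 22 24))) <|
      inform 23 22)
    .skip

/-- Determines the parent and the stamp of a vertex in the doubling phase. -/
def doubleBody : Stmt :=
  ite (arr 10 (var 5)) .skip <|
  -- The largest `l` with `2 ^ l` at most the rank; array `5` holds the powers of `2`.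
  .seq (assign 22 (seek 12 (1 - (arr 5 (var 12) - arr 11 (var 5))) - 1)) <|
  .seq (assign 23 (arr 11 (var 5) - arr 5 (var 22))) <|
  .seq (ite (var 23) (assign 24 (ofRank - 1)) (assign 24 (informant 5 - 1))) <|
  .seq (put 2 (var 5) (var 24)) <|
  put 3 (var 5) (var 21 + var 22)

/-- Array `9` holds the class of each vertex (its clique index plus one), array `10` the marks of
informed vertices, array `11` the ranks; register `21` is the next round. -/
def approxProg : Stmt :=
  .seq (loop false 5 (var 0) (put 9 (var 5) (seek 11 (arr 1 (var 11 * var 0 + var 5))))) <|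
  .seq (put 10 (var 1) 1) <|
  .seq (assign 21 1) <|
  .seq (loop false 5 (var 0) growBody) <|
  .seq (loop false 5 (var 0) (put 11 (var 5) rank)) <|
  loop false 5 (var 0) doubleBody

section
variable {n s Mx K : ℕ} {a : ℕ → ℕ → Prop} {σ : Store}

lemma wp_inform {v u : ℕ} (hP : Partial n s a (σ.arr 2) (σ.arr 3) (σ.arr 10) (σ.reg 21))
    (hMn : n ≤ Mx) (hMT : σ.reg 21 + 1 ≤ Mx) (hu : σ.reg u < n) (hiu : σ.arr 10 (σ.reg u) ≠ 0)
    (hiv : σ.arr 10 (σ.reg v) = 0) (ha : a (σ.reg u) (σ.reg v)) :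
    (inform v u).wp Mx n K (fun τ => (inform v u).Frame σ τ ∧
      Partial n s a (τ.arr 2) (τ.arr 3) (τ.arr 10) (τ.reg 21) ∧
      τ.arr 10 = Function.update (σ.arr 10) (σ.reg v) 1 ∧ τ.reg 21 = σ.reg 21 + 1) σ := by
  refine wp_frame ?_
  refine wp_seq (wp_put (j := σ.reg v) (x := σ.reg u) rfl rfl (by omega) ?_)
  refine wp_seq (wp_put (j := σ.reg v) (x := σ.reg 21) rfl rfl (by omega) ?_)
  refine wp_seq (wp_put (j := σ.reg v) (x := 1) rfl rfl (by omega) ?_)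
  refine wp_assign (x := σ.reg 21 + 1) rfl hMT ?_
  have := hP.inform hu hiu hiv ha
  simpa using this

/-- The state of the phase that covers all classes. -/
structure GrowInv (n s : ℕ) (a : ℕ → ℕ → Prop) (i : ℕ) (σ : Store) : Prop where
  part : Partial n s a (σ.arr 2) (σ.arr 3) (σ.arr 10) (σ.reg 21)
  -- Equality holds at the start, with round `1` and one covered class; each further class takes at
  -- most two rounds.
  time : σ.reg 21 + 1 ≤ 2 * (covered n (σ.arr 9) (σ.arr 10)).card
  -- There are at most `n` classes, so the first alternative is impossible after `n` iterations.
  grow : i + 1 ≤ (covered n (σ.arr 9) (σ.arr 10)).card ∨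
    ∀ v < n, σ.arr 9 v ∈ covered n (σ.arr 9) (σ.arr 10)

lemma wp_growBody {i : ℕ} (hE : Env n a σ) (hs : s < n) (hMx : 4 * n + 1 ≤ Mx)
    (hC : ∀ u < n, ∀ v < n, σ.arr 9 u = σ.arr 9 v → u ≠ v → a u v)
    (hconn : ∀ S : ℕ → Prop, S s → (∃ v < n, ¬ S v) → ∃ u < n, ∃ v < n, S u ∧ ¬ S v ∧ a u v)
    (hI : GrowInv n s a i σ) : growBody.wp Mx n K (GrowInv n s a (i + 1)) σ := by
  have hcard : (covered n (σ.arr 9) (σ.arr 10)).card ≤ n := covered_card_le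
  have hT := hI.time
  have e1 : (seek 10 (seek 11 (leaving 10))).eval σ = WordRAM.find n fun u =>
      (seek 11 (leaving 10)).eval (σ.setReg 10 u) := by rw [eval_seek, hE.size]
  have e2 : ∀ u, (seek 11 (leaving 10)).eval (σ.setReg 10 u) = WordRAM.find n fun v =>
      (leaving 10).eval ((σ.setReg 10 u).setReg 11 v) := fun u => by
    rw [eval_seek, (hE.setReg (by norm_num)).size]
  have e3 : ∀ u < n, ∀ v < n, (leaving 10).eval ((σ.setReg 10 u).setReg 11 v) ≠ 0 ↔ a u v ∧
      σ.arr 9 u ∈ covered n (σ.arr 9) (σ.arr 10) ∧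
      σ.arr 9 v ∉ covered n (σ.arr 9) (σ.arr 10) := by
    intro u hu v hv
    rw [leaving_ne_zero ((hE.setReg (by norm_num)).setReg (by norm_num)) (by norm_num)
      (by simpa using hu) (by simpa using hv)]
    simp
  have hle := find_le n fun u => (seek 11 (leaving 10)).eval (σ.setReg 10 u)
  refine wp_seq (wp_assign e1 (by omega) ?_)
  set m := WordRAM.find n fun u => (seek 11 (leaving 10)).eval (σ.setReg 10 u) with hm
  refine wp_ite (x := m) (by simp) (fun h => ?_) fun h => ?_
  · obtain ⟨u, hu, he, h'⟩ := of_find_ne_zero h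
    rw [e2] at h'
    obtain ⟨v, hv, -, h'⟩ := of_find_ne_zero h'
    rw [e3 u hu v hv] at h'
    refine wp_seq (wp_assign (x := u) (by
      simp only [eval_sub, eval_var, Store.setReg_reg, if_true, eval_one]; omega) (by omega) ?_)
    set σ1 := (σ.setReg 22 m).setReg 22 u with hσ1
    have hE1 : Env n a σ1 := (hE.setReg (by norm_num)).setReg (by norm_num)
    have e4 : ∀ v < n, (leaving 22).eval (σ1.setReg 11 v) ≠ 0 ↔ a u v ∧
        σ.arr 9 u ∈ covered n (σ.arr 9) (σ.arr 10) ∧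
        σ.arr 9 v ∉ covered n (σ.arr 9) (σ.arr 10) := by
      intro v hv
      rw [leaving_ne_zero (hE1.setReg (by norm_num)) (by norm_num)
        (by simpa [hσ1] using hu) (by simpa using hv)]
      simp [hσ1]
    obtain ⟨v, hv, he', h'⟩ := of_find_ne_zero (find_ne_zero
      (f := fun v => (leaving 22).eval (σ1.setReg 11 v)) hv ((e4 v hv).2 h'))
    obtain ⟨hauv, hu1, hv1⟩ := (e4 v hv).1 h'
    have e5 : (seek 11 (leaving 22)).eval σ1 = v + 1 := by rw [eval_seek, hE1.size, he']
    refine wp_seq (wp_assign (x := v) (by rw [eval_sub, e5]; simp) (by omega) ?_)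
    set σ2 := σ1.setReg 23 v with hσ2
    have hE2 : Env n a σ2 := hE1.setReg (by norm_num)
    have hiv : σ.arr 10 v = 0 := by
      by_contra h
      exact hv1 (mem_covered.2 ⟨v, hv, rfl, h⟩)
    -- The final transmission across the edge, from a store in which `u` is informed and at most one
    -- extra round has been spent.
    have main : ∀ τ : Store, τ.reg 22 = u → τ.reg 23 = v → τ.arr 9 = σ.arr 9 →
        τ.arr 10 u ≠ 0 → τ.arr 10 v = 0 → covered n (σ.arr 9) (τ.arr 10) =
        covered n (σ.arr 9) (σ.arr 10) → τ.reg 21 ≤ σ.reg 21 + 1 →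
        Partial n s a (τ.arr 2) (τ.arr 3) (τ.arr 10) (τ.reg 21) →
        (inform 23 22).wp Mx n K (GrowInv n s a (i + 1)) τ := by
      intro τ t1 t2 t3 t4 t5 t6 t7 t8
      refine wp_mono ?_ (wp_inform t8 (by omega) (by omega) (by rwa [t1]) (by rwa [t1])
        (by rwa [t2]) (by rwa [t1, t2]))
      rintro υ ⟨hF, h1, h2, h3⟩
      have h9 : υ.arr 9 = σ.arr 9 := by rw [hF.arr 9 (by decide), t3]
      have hcov : covered n (υ.arr 9) (υ.arr 10) =
          insert (σ.arr 9 v) (covered n (σ.arr 9) (σ.arr 10)) := by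
        rw [h9, h2, t2, covered_update hv, t6]
      have hcc := Finset.card_insert_of_notMem hv1
      refine ⟨h1, ?_, ?_⟩
      · rw [hcov]
        omega
      · rw [hcov]
        rcases hI.grow with g | g
        · left
          omega
        · exact absurd (g v hv) hv1
    refine wp_seq (wp_ite (x := σ.arr 10 u) (by simp [hσ2, hσ1]) (fun h => ?_) fun h => ?_)
    · exact main σ2 (by simp [hσ2, hσ1]) (by simp [hσ2]) rfl h hiv rfl
        (by simp [hσ2, hσ1]) (by simpa [hσ2, hσ1] using hI.part)
    · obtain ⟨w, hw, hew, hwC, hiw⟩ := exists_informant (r := 22) hE2.size (by norm_num)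
        (show σ2.arr 9 (σ2.reg 22) ∈ covered n (σ2.arr 9) (σ2.arr 10) by
          simpa [hσ2, hσ1] using hu1)
      have hwu : w ≠ u := by
        rintro rfl
        exact hiw h
      refine wp_seq (wp_assign (x := w) (by rw [eval_sub, hew]; simp) (by omega) ?_)
      refine wp_mono ?_ (wp_inform (s := s) (a := a) (by simpa [hσ2, hσ1] using hI.part) (by omega)
        (by simp [hσ2, hσ1]; omega) (by simpa using hw) (by simpa using hiw)
        (by simpa [hσ2, hσ1] using h)
        (by simpa [hσ2, hσ1] using hC w hw u hu (by simpa [hσ2, hσ1] using hwC) hwu))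
      rintro υ ⟨hF, h1, h2, h3⟩
      have h2' : υ.arr 10 = Function.update (σ.arr 10) u 1 := by simpa [hσ2, hσ1] using h2
      have hvu : v ≠ u := by
        rintro rfl
        exact hv1 hu1
      refine main υ (by simp [hF.reg 22 (by decide), hσ2, hσ1])
        (by simp [hF.reg 23 (by decide), hσ2]) (by simp [hF.arr 9 (by decide), hσ2, hσ1])
        (by simp [h2']) (by simp [h2', hvu, hiv]) ?_ (by simp [h3, hσ2, hσ1]) h1
      rw [h2', covered_update hu, Finset.insert_eq_of_mem hu1]
  -- If no edge leaves the covered classes, connectivity shows that they contain every vertex.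
  · have hall : ∀ v < n, σ.arr 9 v ∈ covered n (σ.arr 9) (σ.arr 10) := by
      by_contra! hcon
      obtain ⟨u, hu, v, hv, h1, h2, h3⟩ := hconn
        (fun v => σ.arr 9 v ∈ covered n (σ.arr 9) (σ.arr 10))
        (mem_covered.2 ⟨s, hs, rfl, hI.part.src⟩) hcon
      refine find_ne_zero hu ?_ h
      rw [e2]
      exact find_ne_zero hv ((e3 u hu v hv).2 ⟨h3, h1, h2⟩)
    exact ⟨by simpa using hI.part, by simpa using hT, Or.inr (by simpa using hall)⟩

/-- The state of the doubling phase. -/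
structure DoubleInv (n T : ℕ) (C inf par st : ℕ → ℕ) (i : ℕ) (σ : Store) : Prop where
  new : ∀ v < i, inf v = 0 → Doubling n C inf T v (σ.arr 2 v) (σ.arr 3 v)
  old : ∀ v < n, inf v ≠ 0 → σ.arr 2 v = par v ∧ σ.arr 3 v = st v

lemma wp_doubleBody {T i : ℕ} {C inf par st : ℕ → ℕ} (h0 : σ.reg 0 = n) (hi : i < n)
    (h5 : σ.reg 5 = i) (h21 : σ.reg 21 = T) (hMx : 4 * n + 1 ≤ Mx) (hT : T ≤ 2 * n)
    (hC : σ.arr 9 = C) (hinf : σ.arr 10 = inf) (hcov : C i ∈ covered n C inf)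
    (hrank : ∀ v < n, σ.arr 11 v = rankIn (pending n C inf (C v)) v)
    (hpow : ∀ j < n, σ.arr 5 j = 2 ^ j) (hI : DoubleInv n T C inf par st i σ) :
    doubleBody.wp Mx n K (DoubleInv n T C inf par st (i + 1)) σ := by
  refine wp_ite (x := inf i) (by simp [h5, hinf]) (fun h => ?_) fun h => ?_
  · refine ⟨fun v hv hv0 => ?_, hI.old⟩
    rcases Nat.lt_succ_iff_lt_or_eq.1 hv with h' | rfl
    · exact hI.new v h' hv0
    · exact absurd hv0 h
  · have hmem : i ∈ pending n C inf (C i) := mem_pending.2 ⟨hi, rfl, h⟩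
    have hr1 := rankIn_pos hmem
    have hrn : rankIn (pending n C inf (C i)) i < n :=
      (rankIn_le _ _).trans_lt (pending_card_lt hcov)
    set j := rankIn (pending n C inf (C i)) i with hj
    have e1 : (seek 12 (1 - (arr 5 (var 12) - arr 11 (var 5)))).eval σ =
        WordRAM.find n fun l => 1 - (σ.arr 5 l - j) := by
      rw [eval_seek, h0]
      simp [h5, hrank i hi, hj]
    obtain ⟨l, hl, he, hl1⟩ := of_find_ne_zero (find_ne_zero (n := n) (i := 0)
      (f := fun l => 1 - (σ.arr 5 l - j)) (by omega) (by rw [hpow 0 (by omega), pow_zero]; omega))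
    have hmax := (of_find_eq he).2.2
    rw [hpow l hl] at hl1
    -- Maximality of `l` only speaks of indices below `n`; for `l + 1 = n` the bound `j < n < 2 ^ n`
    -- takes over.
    have hlt : j < 2 ^ (l + 1) := by
      by_cases hl' : l + 1 < n
      · by_contra hcon
        have := hmax (l + 1) hl' (by rw [hpow _ hl']; omega)
        omega
      · have h1 : n < 2 ^ n := Nat.lt_two_pow_self
        rw [show l + 1 = n by omega]
        omega
    rw [pow_succ] at hlt
    refine wp_seq (wp_assign (x := l) (by rw [eval_sub, e1, he]; simp) (by omega) ?_)
    refine wp_seq (wp_assign (x := j - 2 ^ l) (by simp [h5, hrank i hi, hpow l hl, hj])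
      (by omega) ?_)
    set σ1 := (σ.setReg 22 l).setReg 23 (j - 2 ^ l) with hσ1
    have main : ∀ u, Doubling n C inf T i u (T + l) →
        (Stmt.seq (put 2 (var 5) (var 24)) (put 3 (var 5) (var 21 + var 22))).wp Mx n K
          (DoubleInv n T C inf par st (i + 1)) (σ1.setReg 24 u) := by
      intro u hD
      have hun : u < n := by
        obtain ⟨_, _, _, _, _, hu, _⟩ := hD
        exact hu
      refine wp_seq (wp_put (j := i) (x := u) (by simp [hσ1, h5]) (by simp) (by omega) ?_)
      refine wp_put (j := i) (x := T + l) (by simp [hσ1, h5]) (by simp [hσ1, h21]) (by omega) ?_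
      constructor
      · intro v hv hv0
        by_cases hvi : v = i
        · subst hvi
          simpa using hD
        · simpa [hvi, hσ1] using hI.new v (by omega) hv0
      · intro v hv hv0
        have hvi : v ≠ i := by
          rintro rfl
          exact hv0 h
        simpa [hvi, hσ1] using hI.old v hv hv0
    refine wp_seq (wp_ite (x := j - 2 ^ l) (by simp [hσ1]) (fun hq => ?_) fun hq => ?_)
    · obtain ⟨w, hw, hwr⟩ := exists_rankIn_eq (A := pending n C inf (C i)) (q := j - 2 ^ l)
        (by omega) (by have := rankIn_le (pending n C inf (C i)) i; omega)
      obtain ⟨hwn, hwC, hw0⟩ := mem_pending.1 hw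
      obtain ⟨w, hwn, hwe, hwC, hw0, hwr⟩ := exists_ofRank (n := n) (σ := σ1) (by simp [hσ1, h0])
        ⟨w, hwn, by simp [hσ1, hC, h5, hwC], by simp [hσ1, hinf, hw0], by
          simp [hσ1, hrank w hwn, hwC, hwr]⟩
      simp [hσ1, hC, h5] at hwC
      simp [hσ1, hinf] at hw0
      simp [hσ1, hrank w hwn, hwC] at hwr
      exact wp_assign (x := w) (by rw [eval_sub, hwe]; simp) (by omega) (main w
        ⟨l, j - 2 ^ l, by omega, by omega, rfl, hwn, hwC, Or.inr ⟨hq, hw0, hwr⟩⟩)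
    · obtain ⟨w, hwn, hwe, hwC, hw0⟩ := exists_informant (n := n) (σ := σ1) (r := 5)
        (by simp [hσ1, h0]) (by norm_num) (by simpa [hσ1, hC, hinf, h5] using hcov)
      simp [hσ1, hC, h5] at hwC
      simp [hσ1, hinf] at hw0
      exact wp_assign (x := w) (by rw [eval_sub, hwe]; simp) (by omega) (main w
        ⟨l, j - 2 ^ l, by omega, by omega, rfl, hwn, hwC, Or.inl ⟨hq, hw0⟩⟩)

theorem wp_approxProg {p L t : ℕ} {Q : Store → Prop} {C : ℕ → ℕ} (hE : Env n a σ)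
    (h1 : σ.reg 1 = s) (hs : s < n) (hpow : ∀ j < n, σ.arr 5 j = 2 ^ j)
    (h3 : ∀ j, σ.arr 3 j = 0) (h10 : ∀ j, σ.arr 10 j = 0) (hMx : 4 * n + 1 ≤ Mx)
    (hQC : ∀ v < n, find n (fun i => σ.arr 1 (i * n + v)) = C v)
    (hC : ∀ u < n, ∀ v < n, C u = C v → u ≠ v → a u v)
    (hp : ∀ inf : ℕ → ℕ, (covered n C inf).card ≤ p)
    (hconn : ∀ S : ℕ → Prop, S s → (∃ v < n, ¬ S v) → ∃ u < n, ∃ v < n, S u ∧ ¬ S v ∧ a u v)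
    (hL : n ≤ 2 ^ L) (ht : 2 * (p - 1) + L ≤ t)
    (hQ : ∀ τ : Store, Done n a t (τ.arr 2) (τ.arr 3) (fun i => i = s) (fun _ => False) 0 → Q τ) :
    approxProg.wp Mx n K Q σ := by
  have h0 := hE.size
  refine wp_seq (wp_loop (fun i τ => ∀ v < i, τ.arr 9 v = C v) (by rw [eval_var, h0]; rfl)
    (by simp) ?_ ?_)
  · intro i hi τ hF hI
    simp only [eval_var, h0] at hi
    have e0 : τ.reg 0 = n := by rw [hF.reg 0 (by decide), h0]
    have e1 := hF.arr 1 (by decide)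
    have hle := find_le n (fun j => σ.arr 1 (j * n + i))
    refine wp_put (j := i) (x := C i) (by simp) ?_ (by rw [← hQC i hi]; omega) ?_
    · rw [eval_seek]
      simp [e0, e1, hQC i hi]
    · intro v hv
      by_cases hvi : v = i
      · simp [hvi]
      · simpa [hvi] using hI v (by omega)
  intro τ hF hI
  simp only [eval_var, h0] at hI
  have hE1 := hE.frame hF (by decide) (by decide) (by decide)
  refine wp_seq (wp_put (j := s) (x := 1) (by simp [hF.reg 1 (by decide), h1]) (by simp)
    (by omega) ?_)
  refine wp_seq (wp_assign (x := 1) (by simp) (by omega) ?_)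
  set σ1 := (τ.setArr 10 s 1).setReg 21 1 with hσ1
  have hE2 : Env n a σ1 := (hE1.setArr (by norm_num) (by norm_num)).setReg (by norm_num)
  have hC1 : ∀ v < n, σ1.arr 9 v = C v := by simpa [hσ1] using hI
  have hcl : ∀ u < n, ∀ v < n, σ1.arr 9 u = σ1.arr 9 v → u ≠ v → a u v :=
    fun u hu v hv h => hC u hu v hv (by rwa [← hC1 u hu, ← hC1 v hv])
  have hi1 : ∀ v, σ1.arr 10 v ≠ 0 ↔ v = s := by
    intro v
    simp only [hσ1, Store.setReg_arr, Store.setArr_arr, if_true, hF.arr 10 (by decide)]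
    rw [Function.update_apply, h10]
    simp
  refine wp_seq (wp_loop (GrowInv n s a) (by rw [eval_var, hE2.size]; rfl) ⟨?_, ?_, ?_⟩ ?_ ?_)
  · refine ⟨(hi1 s).2 rfl, ?_, fun v _ hv hvs => absurd ((hi1 v).1 hv) hvs, fun v _ hv => ?_,
      fun v _ w _ hv hw hne => absurd (((hi1 v).1 hv).trans ((hi1 w).1 hw).symm) hne⟩
    · simp [hσ1, hF.arr 3 (by decide), h3]
    · simp [hσ1, hF.arr 3 (by decide), h3]
  · have : 0 < (covered n (σ1.arr 9) (σ1.arr 10)).card :=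
      Finset.card_pos.2 ⟨_, mem_covered.2 ⟨s, hs, rfl, (hi1 s).2 rfl⟩⟩
    simp only [hσ1, Store.setReg_reg, if_true] at this ⊢
    omega
  · left
    exact Finset.card_pos.2 ⟨_, mem_covered.2 ⟨s, hs, rfl, (hi1 s).2 rfl⟩⟩
  · intro i hi υ hF' hG
    have e9 := hF'.arr 9 (by decide)
    refine wp_growBody ((hE2.frame hF' (by decide) (by decide) (by decide)).setReg (by norm_num))
      hs hMx ?_ hconn ⟨by simpa using hG.part, by simpa using hG.time, by simpa using hG.grow⟩
    simpa [e9] using hcl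
  intro υ hF' hG
  rw [eval_var, hE2.size] at hG
  have e9 := hF'.arr 9 (by decide)
  have hE3 := hE2.frame hF' (by decide) (by decide) (by decide)
  set C' := υ.arr 9 with hC'
  set inf := υ.arr 10 with hinf
  set T := υ.reg 21 with hT
  have hCC : ∀ v < n, C' v = C v := fun v hv => by rw [e9, hC1 v hv]
  have hcov : ∀ v < n, C' v ∈ covered n C' inf := by
    refine hG.grow.resolve_left fun (h : n + 1 ≤ (covered n C' inf).card) => ?_
    have : (covered n C' inf).card ≤ n := covered_card_le
    omega
  have hcp : (covered n C' inf).card ≤ p := by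
    have : covered n C' inf = covered n C inf := by
      ext c
      simp only [mem_covered]
      exact exists_congr fun w => and_congr_right fun hw => by rw [hCC w hw]
    rw [this]
    exact hp inf
  -- Hence `T ≤ 2 * p - 1`, and the last doubling round `T + L - 1` is at most `2 * (p - 1) + L`.
  have htime : T + 1 ≤ 2 * (covered n C' inf).card := hG.time
  have hcn : (covered n C' inf).card ≤ n := covered_card_le
  refine wp_seq (wp_loop (fun i ω => ∀ v < i, ω.arr 11 v = rankIn (pending n C' inf (C' v)) v)
    (by rw [eval_var, hE3.size]; rfl) (by simp) ?_ ?_)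
  · intro i hi ω hF'' hR
    rw [eval_var, hE3.size] at hi
    have e9 : ω.arr 9 = C' := hF''.arr 9 (by decide)
    have e10 : ω.arr 10 = inf := hF''.arr 10 (by decide)
    have hE4 := (hE3.frame hF'' (by decide) (by decide) (by decide)).setReg (r := 5) (x := i)
      (by norm_num)
    have hle := (rankIn_le (pending n C' inf (C' i)) i).trans_lt (pending_card_lt (hcov i hi))
    refine wp_put (j := i) (x := rankIn (pending n C' inf (C' i)) i) (by simp)
      (by rw [eval_rank hE4.size]; simp [e9, e10]) (by omega) ?_
    intro v hv
    by_cases hvi : v = i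
    · simp [hvi]
    · simpa [hvi] using hR v (by omega)
  intro ω hF'' hR
  rw [eval_var, hE3.size] at hR
  have hE4 := hE3.frame hF'' (by decide) (by decide) (by decide)
  have g5 : ω.arr 5 = σ.arr 5 := by
    rw [hF''.arr 5 (by decide), hF'.arr 5 (by decide)]
    simp [hσ1, hF.arr 5 (by decide)]
  have g9 : ω.arr 9 = C' := hF''.arr 9 (by decide)
  have g10 : ω.arr 10 = inf := hF''.arr 10 (by decide)
  have g21 : ω.reg 21 = T := hF''.reg 21 (by decide)
  refine wp_loop (DoubleInv n T C' inf (υ.arr 2) (υ.arr 3)) (by rw [eval_var, hE4.size]; rfl)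
    ⟨by simp, fun v _ _ => ⟨by rw [hF''.arr 2 (by decide)], by rw [hF''.arr 3 (by decide)]⟩⟩ ?_ ?_
  · intro i hi ρ hFr hD
    rw [eval_var, hE4.size] at hi
    have hE5 := (hE4.frame hFr (by decide) (by decide) (by decide)).setReg (r := 5) (x := i)
      (by norm_num)
    refine wp_doubleBody hE5.size hi (by simp) (by simp [hFr.reg 21 (by decide), g21]) hMx
      (by omega) (by simp [hFr.arr 9 (by decide), g9]) (by simp [hFr.arr 10 (by decide), g10])
      (hcov i hi) ?_ ?_ ⟨by simpa using hD.new, by simpa using hD.old⟩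
    · simpa [hFr.arr 11 (by decide)] using hR
    · simpa [hFr.arr 5 (by decide), g5] using hpow
  · intro ρ hFr hD
    rw [eval_var, hE4.size] at hD
    refine hQ ρ (hG.part.done hs (fun u hu v hv h => hC u hu v hv (by rwa [← hCC u hu, ← hCC v hv]))
      hcov hL (by omega) hD.old hD.new)

end
end WordRAM

/-! ### The complete program -/

namespace WordRAM

open WordRAM.Expr WordRAM.Stmt

/-- Tables of the powers of `3` and `2`, and the logarithm of the number of vertices. -/
def prepProg : Stmt :=
  .seq (assign 6 1) <|
  .seq (assign 7 1) <|
  .seq (loop false 5 (var 0) <|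
    .seq (put 4 (var 5) (var 6)) <|
    .seq (put 5 (var 5) (var 7)) <|
    .seq (assign 6 (var 6 * 3)) <|
    assign 7 (var 7 * 2)) <|
  assign 8 (sum 10 (pos (var 0 - arr 5 (var 10))))

/-- With denominators cleared, the test says `2 (p - 1) > ε * clog n`, in which case `n` is small
enough for the exact algorithm. -/
def mainProg : Stmt :=
  .seq prepProg <|
  ite (2 * (var 2 - 1) * var 4 - var 3 * var 8) exactProg approxProg

/-- The logarithm counts the `i` with `2 ^ i < n`, and all of these are below `n`. -/
lemma sum_pos_eq_clog (n : ℕ) :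
    ∑ i ∈ Finset.range n, (if n - 2 ^ i ≠ 0 then 1 else 0) = Nat.clog 2 n := by
  rw [← Finset.card_filter]
  conv_rhs => rw [← Finset.card_range (Nat.clog 2 n)]
  congr 1
  ext i
  have h1 : i < Nat.clog 2 n ↔ 2 ^ i < n := Nat.lt_clog_iff_pow_lt (by norm_num)
  have h2 : i < 2 ^ i := Nat.lt_two_pow_self
  simp only [Finset.mem_filter, Finset.mem_range, h1]
  omega

lemma wp_prepProg {n M K : ℕ} {σ : Store} (h0 : σ.reg 0 = n) (hM : 3 ^ n + 1 ≤ M) :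
    prepProg.wp M n K (fun τ => prepProg.Frame σ τ ∧ (∀ i < n, τ.arr 4 i = 3 ^ i) ∧
      (∀ i < n, τ.arr 5 i = 2 ^ i) ∧ τ.reg 6 = 3 ^ n ∧ τ.reg 8 = Nat.clog 2 n) σ := by
  have hn3 : n < 3 ^ n := Nat.lt_pow_self (by norm_num)
  have h3 : ∀ i ≤ n, 3 ^ i ≤ 3 ^ n := fun i hi => Nat.pow_le_pow_right (by norm_num) hi
  have h2 : ∀ i ≤ n, 2 ^ i ≤ 3 ^ n := fun i hi =>
    (Nat.pow_le_pow_left (by norm_num) i).trans (h3 i hi)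
  refine wp_frame ?_
  refine wp_seq (wp_assign (x := 1) rfl (by omega) ?_)
  refine wp_seq (wp_assign (x := 1) rfl (by omega) ?_)
  set σ1 := (σ.setReg 6 1).setReg 7 1 with hσ1
  have h1 : σ1.reg 0 = n := by simp [hσ1, h0]
  refine wp_seq (wp_loop (fun i τ => (∀ j < i, τ.arr 4 j = 3 ^ j) ∧ (∀ j < i, τ.arr 5 j = 2 ^ j) ∧
    τ.reg 6 = 3 ^ i ∧ τ.reg 7 = 2 ^ i) (by rw [eval_var, h1]; rfl) (by simp [hσ1]) ?_ ?_)
  · rintro i hi τ - ⟨g1, g2, g3, g4⟩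
    rw [eval_var, h1] at hi
    have e3 := h3 (i + 1) hi
    have e2 := h2 (i + 1) hi
    rw [pow_succ] at e2 e3
    refine wp_seq (wp_put (j := i) (x := 3 ^ i) (by simp) (by simp [g3]) (by omega) ?_)
    refine wp_seq (wp_put (j := i) (x := 2 ^ i) (by simp) (by simp [g4]) (by omega) ?_)
    refine wp_seq (wp_assign (x := 3 ^ i * 3) (by simp [g3]) (by omega) ?_)
    refine wp_assign (x := 2 ^ i * 2) (by simp [g4]) (by omega) ⟨?_, ?_, ?_, ?_⟩
    · intro j hj
      by_cases hji : j = i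
      · simp [hji]
      · simpa [hji] using g1 j (by omega)
    · intro j hj
      by_cases hji : j = i
      · simp [hji]
      · simpa [hji] using g2 j (by omega)
    · simp [pow_succ]
    · simp [pow_succ]
  · rintro τ hF ⟨g1, g2, g3, g4⟩
    rw [eval_var, h1] at g1 g2 g3 g4
    have e0 : τ.reg 0 = n := by rw [hF.reg 0 (by decide), h1]
    have hlog : Nat.clog 2 n ≤ n := by
      rw [← sum_pos_eq_clog]
      refine (Finset.sum_le_sum (g := fun _ => 1) fun i _ => ?_).trans (by simp)
      split_ifs <;> simp
    refine wp_assign (x := Nat.clog 2 n) ?_ (by omega) ?_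
    · rw [← sum_pos_eq_clog, eval_sum, e0]
      refine Finset.sum_congr rfl fun i hi => ?_
      rw [eval_pos]
      simp [e0, g2 i (Finset.mem_range.1 hi)]
    · exact ⟨by simpa using g1, by simpa using g2, by simpa using g3, by simp⟩

end WordRAM

/-! ### From stores to graphs and protocols; the main theorem -/

namespace Telephone

open WordRAM

variable {n p : ℕ} {G : SimpleGraph (Fin n)} {s : Fin n} {Q : Fin p → Set (Fin n)} {ε : ℚ}

/-- Adjacency of numbers. -/
def NatAdj (G : SimpleGraph (Fin n)) (u v : ℕ) : Prop :=
  ∃ (hu : u < n) (hv : v < n), G.Adj ⟨u, hu⟩ ⟨v, hv⟩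

lemma natAdj_iff (u v : Fin n) : NatAdj G u v ↔ G.Adj u v := by
  simp [NatAdj]

theorem exists_protocol_of_done {t : ℕ} {par st : ℕ → ℕ}
    (h : Done n (NatAdj G) t par st (fun i => i = s) (fun _ => False) 0) :
    ∃ B : BroadcastProtocol G s t, ∀ u v : Fin n, IsParent B.tree s u v →
      par v = u ∧ st v = B.stamp s(u, v) := by
  classical
  -- `Done` says nothing about the cells of the source, so its stamp is reset to `0` and its parent
  -- is irrelevant.
  let par' : Fin n → Fin n := fun v => if h : par v < n then ⟨par v, h⟩ else s
  let st' : Fin n → ℕ := fun v => if v = s then 0 else st v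
  have hne : ∀ {v : Fin n}, v ≠ s → (v : ℕ) ≠ s := fun h h' => h (Fin.ext h')
  have hpar : ∀ v ≠ s, (par' v : ℕ) = par v := fun v hv => by
    simp [par', (h v v.2 (hne hv)).1]
  have hst : ∀ v ≠ s, st' v = st v := fun v hv => by simp [st', hv]
  obtain ⟨B, hB⟩ := exists_protocol (G := G) (s := s) (t := t) par' st' (by simp [st'])
    (fun v hv => by
      rw [← natAdj_iff, hpar v hv]
      exact (h v v.2 (hne hv)).2.1)
    (fun v hv => by
      obtain ⟨h1, h2, h3, h4, h5, h6, h7⟩ := h v v.2 (hne hv)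
      rw [hst v hv]
      by_cases hp : par' v = s
      · simp only [st', hp, if_true]
        exact Nat.pos_of_ne_zero h6
      · rw [hst _ hp, hpar v hv]
        refine h5.resolve_left fun h' => hp (Fin.ext ?_)
        rw [hpar v hv, h'])
    (fun v => by
      by_cases hv : v = s
      · simp [st', hv]
      · rw [hst v hv]
        exact (h v v.2 (hne hv)).2.2.2.1)
    (fun v w hv hw hvw hp => by
      rw [hst v hv, hst w hw]
      refine (h w w.2 (hne hw)).2.2.2.2.2.2 v v.2 (hne hv) (fun h' => hvw (Fin.ext h')) ?_
      rw [← hpar v hv, ← hpar w hw, hp])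
  refine ⟨B, fun u v huv => ?_⟩
  have hv : v ≠ s := by
    rintro rfl
    have := huv.2
    simp at this
  obtain ⟨h1, h2⟩ := hB u v huv
  rw [← hpar v hv, ← hst v hv, h1, h2]
  exact ⟨rfl, rfl⟩

lemma mul_add_inj {n a b u v : ℕ} (hu : u < n) (hv : v < n) (h : a * n + u = b * n + v) :
    a = b ∧ u = v := by
  have h1 := congrArg (· % n) h
  simp only [Nat.mul_add_mod', Nat.mod_eq_of_lt hu, Nat.mod_eq_of_lt hv] at h1
  subst h1
  exact ⟨Nat.eq_of_mul_eq_mul_right (m := n) (by omega) (by omega), rfl⟩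

lemma inputStore_adj (G : SimpleGraph (Fin n)) (s : Fin n) (Q : Fin p → Set (Fin n)) (ε : ℚ)
    {u v : ℕ} (hu : u < n) (hv : v < n) :
    (inputStore G s Q ε).arr 0 (u * n + v) ≠ 0 ↔ NatAdj G u v := by
  classical
  simp only [inputStore, NatAdj]
  rw [ite_ne_right_iff]
  constructor
  · rintro ⟨⟨u', v', h, h'⟩, -⟩
    obtain ⟨rfl, rfl⟩ := mul_add_inj hv v'.2 h
    exact ⟨hu, hv, h'⟩
  · rintro ⟨hu, hv, h⟩
    exact ⟨⟨_, _, rfl, h⟩, one_ne_zero⟩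

lemma inputStore_mem (G : SimpleGraph (Fin n)) (s : Fin n) (Q : Fin p → Set (Fin n)) (ε : ℚ)
    {i : ℕ} (v : Fin n) :
    (inputStore G s Q ε).arr 1 (i * n + v) ≠ 0 ↔ ∃ hi : i < p, v ∈ Q ⟨i, hi⟩ := by
  classical
  simp only [inputStore]
  rw [ite_ne_right_iff]
  constructor
  · rintro ⟨⟨i', v', h, h'⟩, -⟩
    obtain ⟨rfl, h2⟩ := mul_add_inj v.2 v'.2 h
    rw [Fin.ext h2]
    exact ⟨i'.2, h'⟩
  · rintro ⟨hi, h⟩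
    exact ⟨⟨_, _, rfl, h⟩, one_ne_zero⟩

lemma inputStore_bdd (G : SimpleGraph (Fin n)) (s : Fin n) (Q : Fin p → Set (Fin n)) {M : ℕ}
    (hn : n ≤ M) (hp : p ≤ M) (hnum : ε.num.toNat ≤ M) (hden : ε.den ≤ M) :
    (inputStore G s Q ε).Bdd M := by
  have h1 : 1 ≤ M := by have := s.2; omega
  constructor
  · intro r
    match r with
    | 0 => exact hn
    | 1 => exact s.2.le.trans hn
    | 2 => exact hp
    | 3 => exact hnum
    | 4 => exact hden
    | _ + 5 => exact Nat.zero_le _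
  · intro i j
    match i with
    | 0 => simp only [inputStore]; split_ifs <;> omega
    | 1 => simp only [inputStore]; split_ifs <;> omega
    | _ + 2 => exact Nat.zero_le _

/-- Representatives of the disjoint cliques are distinct. Hence a search over `0, …, n - 1` reaches
every row of the membership matrix. -/
lemma IsCliqueCover.le (h : IsCliqueCover G Q) : p ≤ n := by
  choose f hf using h.nonempty
  have : Function.Injective f := by
    intro i j hij
    by_contra hne
    exact (Set.disjoint_left.1 (h.disjoint hne) (hf i)) (hij ▸ hf j)
  simpa using Fintype.card_le_of_injective f this

/-- By disjointness the search can only find the one clique containing `v`, so `C` takes values in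
`1, …, p` and its fibres are cliques. -/
lemma IsCliqueCover.exists_class (h : IsCliqueCover G Q) (s : Fin n) (ε : ℚ) :
    ∃ C : ℕ → ℕ, (∀ v < n, find n (fun i => (inputStore G s Q ε).arr 1 (i * n + v)) = C v) ∧
      (∀ u < n, ∀ v < n, C u = C v → u ≠ v → NatAdj G u v) ∧
      ∀ inf : ℕ → ℕ, (covered n C inf).card ≤ p := by
  choose q hq using h.cover
  have hC : ∀ v : Fin n,
      find n (fun i => (inputStore G s Q ε).arr 1 (i * n + v)) = q v + 1 := by
    intro v
    have hmem := (inputStore_mem G s Q ε v).2 ⟨(q v).2, hq v⟩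
    obtain ⟨i, hi, he, h'⟩ := of_find_ne_zero (find_ne_zero
      (f := fun i => (inputStore G s Q ε).arr 1 (i * n + v)) ((q v).2.trans_le h.le) hmem)
    obtain ⟨hip, hiv⟩ := (inputStore_mem G s Q ε v).1 h'
    rw [he]
    by_contra hne
    refine Set.disjoint_left.1 (h.disjoint (i := ⟨i, hip⟩) (j := q v) ?_) hiv (hq v)
    rintro h'
    exact hne (by rw [← h'])
  refine ⟨fun v => find n (fun i => (inputStore G s Q ε).arr 1 (i * n + v)), fun _ _ => rfl,
    fun u hu v hv huv hne => ?_, fun inf => ?_⟩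
  · have e := (hC ⟨u, hu⟩).symm.trans (huv.trans (hC ⟨v, hv⟩))
    have e' : q ⟨u, hu⟩ = q ⟨v, hv⟩ := Fin.ext (by omega)
    exact ⟨hu, hv, h.isClique _ (hq ⟨u, hu⟩) (e' ▸ hq ⟨v, hv⟩) fun h => hne (by simpa using h)⟩
  · have : covered n (fun v => find n (fun i => (inputStore G s Q ε).arr 1 (i * n + v))) inf ⊆
        Finset.Icc 1 p := by
      intro c hc
      obtain ⟨w, hw, rfl, -⟩ := mem_covered.1 hc
      have := hC ⟨w, hw⟩
      have := (q ⟨w, hw⟩).2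
      simp only [Finset.mem_Icc] at *
      omega
    simpa using Finset.card_le_card this

lemma natAdj_leaving (hG : G.Connected) (s : Fin n) (S : ℕ → Prop) (hs : S s)
    (h : ∃ v < n, ¬ S v) : ∃ u < n, ∃ v < n, S u ∧ ¬ S v ∧ NatAdj G u v := by
  obtain ⟨v, hv, hSv⟩ := h
  obtain ⟨x, hx, y, hy, hxy⟩ := exists_adj_of_ne_univ (I := {v : Fin n | S v}) hG hs
    (fun h => hSv (by simpa using (Set.eq_univ_iff_forall.1 h ⟨v, hv⟩)))
  exact ⟨x, x.2, y, y.2, hx, hy, (natAdj_iff x y).2 hxy⟩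

/-- The program works within the bounds `M` for the numbers and `K` for the long loops. -/
theorem wp_mainProg {M : ℕ} (hG : G.Connected) (hQ : IsCliqueCover G Q) (hM : 3 ^ n + 1 ≤ M)
    (hM' : 4 * n + 1 ≤ M) : ∃ t K : ℕ,
      mainProg.wp M n K (fun τ => Done n (NatAdj G) t (τ.arr 2) (τ.arr 3) (fun i => i = s)
        (fun _ => False) 0) (inputStore G s Q ε) ∧
      ((K = 1 ∧ t = 2 * (p - 1) + Nat.clog 2 n ∧
          2 * (p - 1) * ε.den ≤ ε.num.toNat * Nat.clog 2 n) ∨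
        (K = 3 ^ n ∧ t = broadcastTime G s ∧
          ε.num.toNat * Nat.clog 2 n < 2 * (p - 1) * ε.den)) := by
  obtain ⟨C, hC1, hC2, hC3⟩ := hQ.exists_class s ε
  set σ := inputStore G s Q ε with hσ
  have main : ∀ t K : ℕ,
      (∀ τ : Store, Stmt.Frame prepProg σ τ → (∀ i < n, τ.arr 4 i = 3 ^ i) →
        (∀ i < n, τ.arr 5 i = 2 ^ i) → τ.reg 6 = 3 ^ n → τ.reg 8 = Nat.clog 2 n →
        (Stmt.ite (2 * (.var 2 - 1) * .var 4 - .var 3 * .var 8) exactProg approxProg).wp M n K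
          (fun τ => Done n (NatAdj G) t (τ.arr 2) (τ.arr 3) (fun i => i = s) (fun _ => False) 0)
          τ) →
      mainProg.wp M n K (fun τ => Done n (NatAdj G) t (τ.arr 2) (τ.arr 3) (fun i => i = s)
        (fun _ => False) 0) σ := by
    intro t K h
    refine Stmt.wp_seq (Stmt.wp_mono ?_ (wp_prepProg (n := n) rfl hM))
    rintro τ ⟨hF, h1, h2, h3, h4⟩
    exact h τ hF h1 h2 h3 h4
  have hEnv : ∀ τ : Store, Stmt.Frame prepProg σ τ → (∀ i < n, τ.arr 4 i = 3 ^ i) →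
      Env n (NatAdj G) τ := fun τ hF h => by
    refine ⟨by rw [hF.reg 0 (by decide)]; rfl, fun u hu v hv => ?_, h⟩
    rw [hF.arr 0 (by decide)]
    exact inputStore_adj G s Q ε hu hv
  have htest : ∀ τ : Store, Stmt.Frame prepProg σ τ → τ.reg 8 = Nat.clog 2 n →
      (2 * (.var 2 - 1) * .var 4 - .var 3 * .var 8 : Expr).eval τ =
        2 * (p - 1) * ε.den - ε.num.toNat * Nat.clog 2 n := fun τ hF h => by
    simp only [Expr.eval_sub, Expr.eval_mul, Expr.eval_two, Expr.eval_one, Expr.eval_var, h,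
      hF.reg 2 (by decide), hF.reg 3 (by decide), hF.reg 4 (by decide)]
    rfl
  by_cases hcase : 2 * (p - 1) * ε.den ≤ ε.num.toNat * Nat.clog 2 n
  -- The long loop is not entered, so `K = 1` is admissible.
  · refine ⟨_, 1, main _ _ fun τ hF h4 h5 h6 h8 => ?_, Or.inl ⟨rfl, rfl, hcase⟩⟩
    refine Stmt.wp_ite (htest τ hF h8) (fun h => absurd hcase (by omega)) fun _ => ?_
    refine wp_approxProg (s := s) (p := p) (L := Nat.clog 2 n) (hEnv τ hF h4)
      (by rw [hF.reg 1 (by decide)]; rfl) s.2 h5 (fun j => by rw [hF.arr 3 (by decide)]; rfl)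
      (fun j => by rw [hF.arr 10 (by decide)]; rfl) hM' ?_ hC2 hC3 (natAdj_leaving hG s)
      (Nat.le_pow_clog (by norm_num) n) le_rfl fun _ h => h
    rw [hF.arr 1 (by decide)]
    exact hC1
  · have hb : broadcastTime G s ≤ n := by
      obtain ⟨t, ht, ht'⟩ := exists_canBroadcast hG s
      exact (Nat.sInf_le ht').trans (by simpa using ht)
    refine ⟨_, 3 ^ n, main _ _ fun τ hF h4 h5 h6 h8 => ?_, Or.inr ⟨rfl, rfl, by omega⟩⟩
    refine Stmt.wp_ite (htest τ hF h8) (fun _ => ?_) fun h => absurd h (by omega)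
    refine wp_exactProg (s := s) (hEnv τ hF h4) (by rw [hF.reg 1 (by decide)]; rfl) s.2 h6
      (fun j => by rw [hF.arr 7 (by decide)]; rfl) hM hb (fun M D P hM hD => ?_) fun _ h => h
    exact hD.le_of_canBroadcast (fun u v h => (natAdj_iff u v).2 h) hM
      (canBroadcast_broadcastTime hG s)

lemma ratio_bound {a d L q : ℕ} {ε : ℚ} (hε : 0 < ε) (ha : a = ε.num.toNat) (hd : d = ε.den) :
    (q * d ≤ a * L → (q : ℝ) ≤ ε * L) ∧ (a * L < q * d → (L : ℝ) ≤ q / ε) := by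
  have hd0 : (0 : ℝ) < d := by rw [hd]; exact_mod_cast ε.den_pos
  have hεR : (0 : ℝ) < ε := by exact_mod_cast hε
  have he : (a : ℝ) = ε * d := by
    have h1 : ((ε.num.toNat : ℤ) : ℚ) = ε * ε.den := by
      rw [Int.toNat_of_nonneg (Rat.num_nonneg.2 hε.le), Rat.mul_den_eq_num]
    rw [ha, hd]
    exact_mod_cast h1
  constructor
  · intro h
    have h' : (q : ℝ) * d ≤ a * L := by exact_mod_cast h
    rw [he] at h'
    refine le_of_mul_le_mul_right ?_ hd0
    linarith
  · intro h
    have h' : (a : ℝ) * L < q * d := by exact_mod_cast h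
    rw [he] at h'
    rw [le_div_iff₀ hεR]
    refine le_of_mul_le_mul_right ?_ hd0
    linarith

end Telephone

open WordRAM Telephone in
theorem mainTheorem10 :
    ∃ (P : WordRAM.Prog) (c : ℕ),
      ∀ (n p : ℕ) (G : SimpleGraph (Fin n)) (s : Fin n) (Q : Fin p → Set (Fin n)) (ε : ℚ),
        G.Connected → Telephone.IsCliqueCover G Q → 0 < ε →
          ∃ (σ : WordRAM.Store) (T t : ℕ) (B : Telephone.BroadcastProtocol G s t),
            WordRAM.Exec (c * (n + ε.num.toNat.size + ε.den.size)) P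
              (Telephone.inputStore G s Q ε) σ T ∧
            Telephone.Outputs σ B ∧
            (t : ℝ) ≤ (1 + (ε : ℝ)) * (Telephone.broadcastTime G s : ℝ) ∧
            (T : ℝ) ≤ (c : ℝ) * (3 : ℝ) ^ ((2 : ℝ) ^ (2 * (p : ℝ) / (ε : ℝ)) * (p : ℝ)) *
              (n : ℝ) ^ c := by
  -- All registers of the source program are below `30`. In `c`, the first two terms provide word
  -- length, the others bound the factor and the exponent of the running time.
  refine ⟨mainProg.compile 30, 4 * mainProg.deg + 1 + mainProg.coef + mainProg.depth, ?_⟩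
  intro n p G s Q ε hG hQ hε
  set c := 4 * mainProg.deg + 1 + mainProg.coef + mainProg.depth with hc
  set l := n + ε.num.toNat.size + ε.den.size with hl
  have hn : 1 ≤ n := by have := s.2; omega
  have hpos : 1 ≤ l := by omega
  have hpn := hQ.le
  have hp : 1 ≤ p := by
    obtain ⟨i, -⟩ := hQ.cover s
    have := i.2
    omega
  have hpow : ∀ {k : ℕ}, k ≤ 4 * l → 2 ^ k ≤ 2 ^ (4 * l) := fun h =>
    Nat.pow_le_pow_right (by norm_num) h
  have hn2 : n < 2 ^ n := Nat.lt_two_pow_self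
  have hM4 : 4 * n + 1 ≤ 2 ^ (4 * l) := by
    have h1 := hpow (k := n + 2) (by omega)
    rw [pow_add] at h1
    omega
  have hM3 : 3 ^ n + 1 ≤ 2 ^ (4 * l) := by
    have h1 := hpow (k := 2 * n) (by omega)
    rw [pow_mul] at h1
    have h2 : 3 ^ n < 4 ^ n := Nat.pow_lt_pow_left (by norm_num) (by omega)
    norm_num at h1
    omega
  have hsize : ∀ m : ℕ, m.size ≤ l → m ≤ 2 ^ (4 * l) := fun m hm =>
    (Nat.lt_size_self m).le.trans (hpow (by omega))
  -- The bound for memory cells is `M = 2 ^ (4 * l)`, which exceeds `3 ^ n`, `4 * n` and the input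
  -- numbers.
  have hMw : (2 ^ (4 * l)) ^ mainProg.deg < 2 ^ (c * l) := by
    rw [← pow_mul]
    refine Nat.pow_lt_pow_right (by norm_num) ?_
    nlinarith [Nat.zero_le (mainProg.coef * l), Nat.zero_le (mainProg.depth * l)]
  obtain ⟨t, K, hwp, hK⟩ := wp_mainProg (s := s) (ε := ε) hG hQ hM3 hM4
  have hKM : K ≤ 2 ^ (4 * l) ∧ 1 ≤ K := by
    have : 0 < 3 ^ n := by positivity
    rcases hK with ⟨rfl, -⟩ | ⟨rfl, -⟩ <;> omega
  obtain ⟨υ, τ, ⟨T, hT, hexec⟩, hdone, hA, -⟩ := mainProg.runs_compile (D := mainProg.deg)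
    (t₀ := 30) (t := 30) (by omega) hMw hKM.1 (by omega)
    (inputStore_bdd G s Q (by omega) (by omega) (hsize _ (by omega)) (hsize _ (by omega)))
    (by decide) le_rfl (show (inputStore G s Q ε).reg 0 ≤ n from le_rfl) le_rfl
    (Agree.refl _ _) hwp
  obtain ⟨B, hB⟩ := exists_protocol_of_done hdone
  refine ⟨τ, T, t, B, hexec, fun u v h => by rw [hA.arr]; exact hB u v h, ?_, ?_⟩
  · have hεR : (0 : ℝ) < ε := by exact_mod_cast hε
    rcases hK with ⟨-, rfl, h⟩ | ⟨-, rfl, -⟩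
    -- `2 (p - 1) + L ≤ (1 + ε) L ≤ (1 + ε) b(G,s)`.
    · have h1 := (ratio_bound hε rfl rfl).1 h
      have h2 : Nat.clog 2 n ≤ broadcastTime G s :=
        Nat.clog_le_of_le_pow (by simpa using (canBroadcast_broadcastTime hG s).card_le)
      have h3 : (Nat.clog 2 n : ℝ) ≤ broadcastTime G s := by exact_mod_cast h2
      push_cast at h1 ⊢
      nlinarith
    · nlinarith [Nat.cast_nonneg (α := ℝ) (broadcastTime G s)]
  · have hεR : (0 : ℝ) < ε := by exact_mod_cast hε
    have hpR : (1 : ℝ) ≤ p := by exact_mod_cast hp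
    have hKR : (K : ℝ) ≤ (3 : ℝ) ^ ((2 : ℝ) ^ (2 * (p : ℝ) / (ε : ℝ)) * (p : ℝ)) := by
      rcases hK with ⟨rfl, -⟩ | ⟨rfl, -, h⟩
      · rw [Nat.cast_one]
        exact Real.one_le_rpow (by norm_num) (by positivity)
      · have h1 := (ratio_bound hε rfl rfl).2 h
        push_cast
        rw [← Real.rpow_natCast]
        refine Real.rpow_le_rpow_of_exponent_le (by norm_num) ?_
        have h2 : (n : ℝ) ≤ (2 : ℝ) ^ (Nat.clog 2 n : ℝ) := by
          rw [Real.rpow_natCast]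
          exact_mod_cast Nat.le_pow_clog (by norm_num) n
        have h3 : (Nat.clog 2 n : ℝ) ≤ 2 * p / ε := by
          refine h1.trans (div_le_div_of_nonneg_right ?_ hεR.le)
          exact_mod_cast (show 2 * (p - 1) ≤ 2 * p by omega)
        have h4 := Real.rpow_le_rpow_of_exponent_le (x := 2) (by norm_num) h3
        -- The previous steps give `n ≤ 2 ^ (2p/ε)`; the further factor `p` in the exponent is
        -- harmless as `p ≥ 1`.
        have h5 : (0 : ℝ) < (2 : ℝ) ^ (2 * (p : ℝ) / (ε : ℝ)) := by positivity
        nlinarith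
    have hT' : T ≤ c * K * n ^ c := by
      refine hT.trans ((mainProg.cost_le hn hKM.2).trans ?_)
      -- Only the loop over the words is long, so `K` enters linearly.
      have hlong : mainProg.long = 1 := by decide
      rw [hlong, pow_one, ← mul_assoc]
      exact Nat.mul_le_mul (Nat.mul_le_mul_right _ (by omega))
        (Nat.pow_le_pow_right hn (by omega))
    calc (T : ℝ) ≤ c * K * (n : ℝ) ^ c := by exact_mod_cast hT'
      _ ≤ _ := by gcongr
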